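/- Let $A\in\mathbb R^{n\times n}$, $B\in\mathbb R^{n\times m}$, $K_\Omega\in\mathbb R^{m\times n}$, put $A_{cl}=A+BK_\Omega$, and consider the error system $e(k+1)=A_{cl}e(k)+w(k)$ with disturbances in a compact set $\mathcal W\subset\mathbb R^n$. Let $\mu$ be a probability distribution on $\mathbb R^n$ with $\mu(\mathcal W)=1$, let $\tilde w_1,\dots,\tilde w_{N_s}$ be independent random vectors with law $\mu$, let $\epsilon\in[0,1]$ and $n_s=(n^2+n)/2+1$. Consider the scenario program $$\min_{P\succ 0,\ \tau>0}\ -\log\det P\quad\text{s.t.}\quad \begin{pmatrix}A_{cl}^\top P A_{cl}-\tau P & A_{cl}^\top P w\\ w^\top P A_{cl} & w^\top P w+\tau-1\end{pmatrix}\preceq 0\quad\text{for } w=\tilde w_1,\dots,\tilde w_{N_s},$$ where $P$ ranges over the symmetric positive definite $n\times n$ matrices. Then with probability at least $$1-\sum_{i=0}^{n_s-1}\binom{N_s}{i}\epsilon^i(1-\epsilon)^{N_s-i}$$ over the draw of $\tilde w_1,\dots,\tilde w_{N_s}$ the following holds: if the scenario program attains a solution, then every solution $(P,\tau)$ is $\epsilon$-level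 robustly feasible, i.e. the set of $w\in\mathcal W$ for which the above matrix inequality is violated at $(P,\tau)$ has $\mu$-probability at most $\epsilon$. -/

import Mathlib

open MeasureTheory ProbabilityTheory

namespace ScenarioRPI

/-- The symmetric block matrix
`[[Aclᵀ P Acl - τ P, Aclᵀ P w], [wᵀ P Acl, wᵀ P w + τ - 1]]`
attached to the closed-loop matrix `Acl`, the decision variables `P`, `τ` and the
disturbance `w`. -/
noncomputable def lmiMatrix {n : ℕ} (Acl P : Matrix (Fin n) (Fin n) ℝ) (τ : ℝ)
    (w : Fin n → ℝ) : Matrix (Fin n ⊕ Unit) (Fin n ⊕ Unit) ℝ :=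
  let wc : Matrix (Fin n) Unit ℝ := Matrix.replicateCol Unit w
  Matrix.fromBlocks
    (Acl.transpose * P * Acl - τ • P) (Acl.transpose * P * wc)
    (wc.transpose * P * Acl) (wc.transpose * P * wc + (τ - 1) • (1 : Matrix Unit Unit ℝ))

/-- The linear matrix inequality for the disturbance `w`: the block matrix is negative
semidefinite. -/
def LMI {n : ℕ} (Acl P : Matrix (Fin n) (Fin n) ℝ) (τ : ℝ) (w : Fin n → ℝ) : Prop :=
  (-(lmiMatrix Acl P τ w)).PosSemidef

/-- Feasibility of `(P, τ)` for the scenario program with scenarios `w 0, …, w (N - 1)`: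
`P` is symmetric positive definite, `τ > 0`, and the inequality holds for every scenario. -/
structure IsFeasible {n N : ℕ} (Acl : Matrix (Fin n) (Fin n) ℝ) (w : Fin N → Fin n → ℝ)
    (P : Matrix (Fin n) (Fin n) ℝ) (τ : ℝ) : Prop where
  posDef : P.PosDef
  pos : 0 < τ
  lmi : ∀ i, LMI Acl P τ (w i)

/-- `(P, τ)` is a solution (global minimizer) of the scenario program
`min - log det P` over all feasible pairs. -/
structure IsSolution {n N : ℕ} (Acl : Matrix (Fin n) (Fin n) ℝ) (w : Fin N → Fin n → ℝ)
    (P : Matrix (Fin n) (Fin n) ℝ) (τ : ℝ) : Prop where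
  feasible : IsFeasible Acl w P τ
  optimal : ∀ (P' : Matrix (Fin n) (Fin n) ℝ) (τ' : ℝ), IsFeasible Acl w P' τ' →
    -Real.log P.det ≤ -Real.log P'.det

/-- `(P, τ)` is `ε`-level robustly feasible: the probability (under the disturbance law `μ`)
of a disturbance in `W` violating the inequality is at most `ε`. -/
def IsLevelRobustlyFeasible {n : ℕ} (Acl : Matrix (Fin n) (Fin n) ℝ)
    (W : Set (Fin n → ℝ)) (μ : Measure (Fin n → ℝ)) (ε : ℝ)
    (P : Matrix (Fin n) (Fin n) ℝ) (τ : ℝ) : Prop :=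
  μ.real {w | w ∈ W ∧ ¬ LMI Acl P τ w} ≤ ε

/-- The number of scalar decision variables: `(n² + n) / 2` for `P` and one for `τ`
(the division is exact). -/
def numVars (n : ℕ) : ℕ := (n ^ 2 + n) / 2 + 1

end ScenarioRPI

/-!
The bound is that of Campi and Garatti for convex scenario programs with `d` decision variables: in
a nondegenerate program almost surely exactly one subsample of size `d` determines the solution in
such a way that it agrees with all remaining scenarios. Counting these subsamples for samples of all
sizes gives the moments of the probability that a scenario agrees with a given subsample, hence the
law of that probability, and hence the binomial tail (`measure_exists_selected_le`).

The scenario program at hand is neither convex nor nondegenerate.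

The product `τ P` makes the matrix inequality nonconvex in `(P, τ)`. It is however geodesically
convex: it says that `y = (x, s) ↦ A x + s w` is a contraction from the norm with square
`τ xᵀ P x + (1 - τ) s ^ 2` to that with square `xᵀ P x`. If `P` and `P'` are diagonalized by one
congruence, and the diagonal entries and `τ` are interpolated geometrically, then contractions
remain contractions as in Stein interpolation (`interpolate_contraction`), the norm of `(x, s)` is
only enlarged since a geometric mean is at most the arithmetic mean, and `log det` is affine. This
gives uniqueness of the solution (`ScenarioRPI.IsSolution.unique`). For the support of the solution
by `d` scenarios (`PathConvexProgram.exists_support`) Helly's theorem is applied to the constraints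
made convex by a multiple of the squared distance from the solution; this does not change what
happens to first order there, and a path of feasible points is all that is needed.

Degeneracy is removed by a random perturbation: each scenario carries an independent mark `u`, and
its constraint is relaxed by a factor `1 + ρ exp u`, so that almost surely no constraint is active
by accident. As `ρ → 0` the perturbed solutions tend to the unique solution, and the probability of
violation is lower semicontinuous (`ScenarioProgram.measure_violation_le`). Compactness is provided
by a barrier added to the cost beyond a threshold that tends to infinity.
-/


/-! ### Binomial tails and beta moments -/

namespace Scenario

open Polynomial Set

/-- The derivative of a binomial tail is a single term, since the sum of derivatives telescopes. -/
theorem hasDerivAt_binomialTail (d N : ℕ) (hd : d ≤ N) (t : ℝ) :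
    HasDerivAt (fun t : ℝ => ∑ i ∈ Finset.range d, (N.choose i : ℝ) * (1 - t) ^ i * t ^ (N - i))
      ((N.choose d : ℝ) * d * (1 - t) ^ (d - 1) * t ^ (N - d)) t := by
  induction d with
  | zero => simpa using hasDerivAt_const t (0 : ℝ)
  | succ d ih =>
    simp only [Finset.sum_range_succ]
    have h1 : HasDerivAt (fun t : ℝ => (1 - t)) (-1) t := by
      simpa using (hasDerivAt_id t).const_sub 1
    have h2 := ((h1.pow d).const_mul (N.choose d : ℝ)).mul ((hasDerivAt_id t).pow (N - d))
    have h3 := (ih (by omega)).add h2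
    refine h3.congr_deriv ?_
    have hN : N - (d + 1) = N - d - 1 := by omega
    have hc : (N.choose (d + 1) : ℝ) * ((d : ℝ) + 1) = N.choose d * ((N - d : ℕ) : ℝ) := by
      exact_mod_cast Nat.choose_succ_right_eq N d
    rw [Nat.add_sub_cancel, hN]
    push_cast
    rw [hc]
    simp only [Pi.pow_apply, id]
    ring

theorem integral_beta_weight (d N : ℕ) (hd : d ≤ N) (t : ℝ) :
    ∫ s in (0 : ℝ)..t, (N.choose d : ℝ) * d * (1 - s) ^ (d - 1) * s ^ (N - d) =
      ∑ i ∈ Finset.range d, (N.choose i : ℝ) * (1 - t) ^ i * t ^ (N - i) := by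
  rw [intervalIntegral.integral_eq_sub_of_hasDerivAt
    (fun s _ => hasDerivAt_binomialTail d N hd s)
    (Continuous.intervalIntegrable (by fun_prop) _ _), sub_eq_self]
  refine Finset.sum_eq_zero fun i hi => ?_
  have : N - i ≠ 0 := by have := Finset.mem_range.1 hi; omega
  simp [this]

/-- A finite measure on `[0, 1]` is determined by its moments, by the Weierstrass approximation
theorem. -/
theorem measure_eq_of_moments_eq {P Q : Measure ℝ} [IsFiniteMeasure P] [IsFiniteMeasure Q]
    (hP : ∀ᵐ x ∂P, x ∈ Icc (0 : ℝ) 1) (hQ : ∀ᵐ x ∂Q, x ∈ Icc (0 : ℝ) 1)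
    (h : ∀ m : ℕ, ∫ x, x ^ m ∂P = ∫ x, x ^ m ∂Q) : P = Q := by
  have hint : ∀ (M : Measure ℝ) [IsFiniteMeasure M], (∀ᵐ x ∂M, x ∈ Icc (0 : ℝ) 1) →
      ∀ f : ℝ → ℝ, Continuous f → Integrable f M := by
    intro M _ hM f hf
    obtain ⟨C, hC⟩ := (isCompact_Icc (a := (0 : ℝ)) (b := 1)).exists_bound_of_continuousOn
      hf.continuousOn
    exact Integrable.of_bound hf.aestronglyMeasurable C (hM.mono fun x hx => hC x hx)
  have hpoly : ∀ p : ℝ[X], ∫ x, p.eval x ∂P = ∫ x, p.eval x ∂Q := by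
    intro p
    simp only [eval_eq_sum_range]
    rw [integral_finsetSum _ fun i _ => hint P hP _ (by fun_prop),
      integral_finsetSum _ fun i _ => hint Q hQ _ (by fun_prop)]
    simp only [integral_const_mul, h]
  refine ext_of_forall_integral_eq_of_IsFiniteMeasure fun f => ?_
  refine eq_of_forall_dist_le fun e he => ?_
  set C := P.real univ + Q.real univ + 1 with hC
  have hCpos : 0 < C := by positivity
  obtain ⟨p, hp⟩ := exists_polynomial_near_of_continuousOn 0 1 f f.continuous.continuousOn
    (e / C) (by positivity)
  have key : ∀ (M : Measure ℝ) [IsFiniteMeasure M], (∀ᵐ x ∂M, x ∈ Icc (0 : ℝ) 1) →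
      |∫ x, f x ∂M - ∫ x, p.eval x ∂M| ≤ e / C * M.real univ := by
    intro M _ hM
    rw [← integral_sub (hint M hM _ f.continuous) (hint M hM _ (by fun_prop))]
    rw [← Real.norm_eq_abs]
    refine norm_integral_le_of_norm_le_const (hM.mono fun x hx => ?_)
    rw [Real.norm_eq_abs, abs_sub_comm]
    exact (hp x hx).le
  rw [Real.dist_eq]
  calc |∫ x, f x ∂P - ∫ x, f x ∂Q|
      = |(∫ x, f x ∂P - ∫ x, p.eval x ∂P) - (∫ x, f x ∂Q - ∫ x, p.eval x ∂Q)| := by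
        rw [hpoly p]; ring_nf
    _ ≤ e / C * P.real univ + e / C * Q.real univ :=
        (abs_sub _ _).trans (add_le_add (key P hP) (key Q hQ))
    _ ≤ e := by
        rw [← mul_add, div_mul_eq_mul_div, div_le_iff₀ hCpos]
        nlinarith

/-- If `q` has the moments of the law with density `d (1 - t) ^ (d - 1)` on `[0, 1]`, then it has
that law, and its truncated moments are binomial tails. -/
theorem setIntegral_pow_eq_binomialTail {Y : Type*} [MeasurableSpace Y] (P : Measure Y)
    [IsProbabilityMeasure P] {q : Y → ℝ} (hq : Measurable q) (hq01 : ∀ y, q y ∈ Icc (0 : ℝ) 1)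
    {d : ℕ} (hd : 0 < d)
    (hmom : ∀ m : ℕ, ((d + m).choose d : ℝ) * ∫ y, q y ^ m ∂P = 1)
    {N : ℕ} (hN : d ≤ N) {t : ℝ} (ht0 : 0 ≤ t) (ht1 : t ≤ 1) :
    (N.choose d : ℝ) * ∫ y in {y | q y < t}, q y ^ (N - d) ∂P =
      ∑ i ∈ Finset.range d, (N.choose i : ℝ) * (1 - t) ^ i * t ^ (N - i) := by
  set dens : ℝ → NNReal := fun s => Real.toNNReal (d * (1 - s) ^ (d - 1)) with hdens
  have hdm : Measurable dens := by fun_prop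
  set Q : Measure ℝ := (volume.restrict (Ioc (0 : ℝ) 1)).withDensity (fun s => dens s) with hQ
  have hQint : ∀ f : ℝ → ℝ, ∫ x, f x ∂Q =
      ∫ x in Ioc (0 : ℝ) 1, (d * (1 - x) ^ (d - 1)) * f x := by
    intro f
    rw [hQ, integral_withDensity_eq_integral_smul hdm]
    refine setIntegral_congr_fun measurableSet_Ioc fun x hx => ?_
    have : 0 ≤ (d : ℝ) * (1 - x) ^ (d - 1) :=
      mul_nonneg (by positivity) (pow_nonneg (by linarith [hx.2]) _)
    simp [hdens, NNReal.smul_def, Real.coe_toNNReal _ this]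
  have : IsFiniteMeasure Q := by
    refine isFiniteMeasure_withDensity_ofReal ?_
    have : IntegrableOn (fun s : ℝ => (d : ℝ) * (1 - s) ^ (d - 1)) (Icc 0 1) :=
      ContinuousOn.integrableOn_Icc (by fun_prop)
    exact (this.mono_set Ioc_subset_Icc_self).2
  have hmap : P.map q = Q := by
    have : IsProbabilityMeasure (P.map q) := Measure.isProbabilityMeasure_map hq.aemeasurable
    refine measure_eq_of_moments_eq ?_ ?_ fun m => ?_
    · exact (ae_map_iff (p := fun x => x ∈ Icc (0 : ℝ) 1) hq.aemeasurable measurableSet_Icc).2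
        (ae_of_all _ hq01)
    · have : ∀ᵐ x ∂(volume.restrict (Ioc (0 : ℝ) 1)), x ∈ Icc (0 : ℝ) 1 :=
        (ae_restrict_mem measurableSet_Ioc).mono fun x hx => Ioc_subset_Icc_self hx
      exact (withDensity_absolutelyContinuous _ _).ae_le this
    · rw [integral_map hq.aemeasurable (by fun_prop), hQint]
      have hb := integral_beta_weight d (d + m) (by omega) 1
      rw [Finset.sum_eq_single_of_mem 0 (by simpa using hd)
        (fun i _ hi => by simp [hi])] at hb
      rw [intervalIntegral.integral_of_le zero_le_one] at hb
      have hc : ((d + m).choose d : ℝ) ≠ 0 := by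
        exact_mod_cast (Nat.choose_pos (by omega)).ne'
      refine mul_left_cancel₀ hc ?_
      rw [hmom m, ← integral_const_mul]
      simp only [Nat.choose_zero_right, Nat.cast_one, pow_zero, one_pow, mul_one,
        Nat.add_sub_cancel_left] at hb
      refine hb.symm.trans (integral_congr_ae (ae_of_all _ fun x => ?_))
      ring
  have h1 : ∫ y in {y | q y < t}, q y ^ (N - d) ∂P = ∫ x in Iio t, x ^ (N - d) ∂(P.map q) := by
    rw [setIntegral_map measurableSet_Iio (by fun_prop) hq.aemeasurable]
    rfl
  rw [h1, hmap, ← integral_indicator measurableSet_Iio, hQint, ← integral_beta_weight d N hN t,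
    intervalIntegral.integral_of_le ht0, ← integral_const_mul]
  have h2 : ∀ x, (N.choose d : ℝ) * (d * (1 - x) ^ (d - 1) *
      (Iio t).indicator (fun x => x ^ (N - d)) x) =
      (Iio t).indicator (fun x => (N.choose d : ℝ) * d * (1 - x) ^ (d - 1) * x ^ (N - d)) x := by
    intro x
    by_cases hx : x ∈ Iio t <;> simp [hx]; ring
  simp only [h2]
  rw [setIntegral_indicator measurableSet_Iio, integral_Ioc_eq_integral_Ioo (y := t)]
  have : Ioc (0 : ℝ) 1 ∩ Iio t = Ioo 0 t := by
    ext x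
    simp only [mem_inter_iff, mem_Ioc, mem_Iio, mem_Ioo]
    exact ⟨fun h => ⟨h.1.1, h.2⟩, fun h => ⟨⟨h.1, h.2.le.trans ht1⟩, h.2⟩⟩
  rw [this]

end Scenario

/-! ### Splitting a sample into selected and remaining scenarios -/

namespace Scenario

open Set
open scoped ENNReal

theorem range_comp_equiv_coe {Z ι : Type*} {d : ℕ} {B : Finset ι} (e : Fin d ≃ B) (z : ι → Z) :
    range (fun j => z (e j)) = z '' B := by
  ext x
  simp only [mem_range, mem_image, Finset.mem_coe]
  constructor
  · rintro ⟨j, rfl⟩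
    exact ⟨e j, (e j).2, rfl⟩
  · rintro ⟨i, hi, rfl⟩
    exact ⟨e.symm ⟨i, hi⟩, by simp⟩

theorem preimage_split {Z ι : Type*} {R : Set Z → Z → Prop} {C : Set Z → Prop} {d : ℕ}
    {B : Finset ι} (e : Fin d ≃ B) :
    {z : ι → Z | C (z '' B) ∧ ∀ i ∉ B, R (z '' B) (z i)} =
      (fun z : ι → Z => ((fun j => z (e j) : Fin d → Z), (fun i => z i : {i // i ∉ B} → Z))) ⁻¹'
        {p | C (range p.1) ∧ ∀ i, R (range p.1) (p.2 i)} := by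
  ext z
  simp only [mem_ofPred_eq, mem_preimage, range_comp_equiv_coe, Subtype.forall]

variable {Z : Type*} [MeasurableSpace Z]

theorem measurePreserving_split (π : Measure Z) [IsProbabilityMeasure π] {ι : Type*} [Fintype ι]
    [DecidableEq ι] {d : ℕ} (B : Finset ι) (e : Fin d ≃ B) :
    MeasurePreserving
      (fun z : ι → Z => ((fun j => z (e j) : Fin d → Z), (fun i => z i : {i // i ∉ B} → Z)))
      (Measure.pi fun _ => π) ((Measure.pi fun _ => π).prod (Measure.pi fun _ => π)) := by
  let _ : Fintype B := Subtype.fintype (· ∈ B)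
  have h1 := measurePreserving_piEquivPiSubtypeProd (fun _ : ι => π) (· ∈ B)
  have h2 := (measurePreserving_piCongrLeft (fun _ : B => π) e).symm
  have h3 := (h2.prod (MeasurePreserving.id (Measure.pi fun _ : {i // i ∉ B} => π))).comp h1
  exact h3

variable {R : Set Z → Z → Prop} {C : Set Z → Prop} {d : ℕ}

theorem measurableSet_accept
    (hR : MeasurableSet {p : (Fin d → Z) × Z | R (range p.1) p.2})
    (hC : MeasurableSet {b : Fin d → Z | C (range b)}) (κ : Type*) [Countable κ] :
    MeasurableSet {p : (Fin d → Z) × (κ → Z) | C (range p.1) ∧ ∀ i, R (range p.1) (p.2 i)} := by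
  refine (measurable_fst hC).inter ?_
  have : {p : (Fin d → Z) × (κ → Z) | ∀ i, R (range p.1) (p.2 i)} =
      ⋂ i, (fun p : (Fin d → Z) × (κ → Z) => (p.1, p.2 i)) ⁻¹'
        {p : (Fin d → Z) × Z | R (range p.1) p.2} := by
    ext p; simp
  change MeasurableSet {p : (Fin d → Z) × (κ → Z) | ∀ i, R (range p.1) (p.2 i)}
  rw [this]
  exact MeasurableSet.iInter fun i => (by fun_prop : Measurable _) hR

theorem measurableSet_selected
    (hR : MeasurableSet {p : (Fin d → Z) × Z | R (range p.1) p.2})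
    (hC : MeasurableSet {b : Fin d → Z | C (range b)})
    {ι : Type*} [Fintype ι] {B : Finset ι} (hB : B.card = d) :
    MeasurableSet {z : ι → Z | C (z '' B) ∧ ∀ i ∉ B, R (z '' B) (z i)} := by
  classical
  rw [preimage_split (Finset.equivFinOfCardEq hB).symm]
  exact (by fun_prop : Measurable _) (measurableSet_accept hR hC _)

/-- Given the subsample `B`, the remaining `card ι - d` scenarios are related to it independently of
each other. -/
theorem measure_selected (π : Measure Z) [IsProbabilityMeasure π]
    (hR : MeasurableSet {p : (Fin d → Z) × Z | R (range p.1) p.2})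
    (hC : MeasurableSet {b : Fin d → Z | C (range b)})
    {ι : Type*} [Fintype ι] {B : Finset ι} (hB : B.card = d) :
    (Measure.pi fun _ : ι => π) {z | C (z '' B) ∧ ∀ i ∉ B, R (z '' B) (z i)} =
      ∫⁻ b in {b : Fin d → Z | C (range b)}, π {z | R (range b) z} ^ (Fintype.card ι - d)
        ∂(Measure.pi fun _ => π) := by
  classical
  have hm := measurableSet_accept hR hC {i // i ∉ B}
  rw [preimage_split (Finset.equivFinOfCardEq hB).symm,
    (measurePreserving_split π B _).measure_preimage hm.nullMeasurableSet, Measure.prod_apply hm,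
    ← lintegral_indicator hC]
  refine lintegral_congr fun b => ?_
  by_cases hb : C (range b)
  · have : (Prod.mk b ⁻¹' {p : (Fin d → Z) × ({i // i ∉ B} → Z) |
        C (range p.1) ∧ ∀ i, R (range p.1) (p.2 i)}) =
        Set.univ.pi fun _ => {z | R (range b) z} := by
      ext y; simp [hb]
    rw [this, Measure.pi_pi, indicator_of_mem (by exact hb), Finset.prod_const]
    congr 1
    simp [Fintype.card_subtype_compl, hB]
  · simp [hb]

theorem measurable_accept (π : Measure Z) [IsProbabilityMeasure π]
    (hR : MeasurableSet {p : (Fin d → Z) × Z | R (range p.1) p.2}) :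
    Measurable fun b : Fin d → Z => π {z | R (range b) z} :=
  measurable_measure_prodMk_left hR

/-- The law of the probability of acceptance for a compression scheme. Suppose that in a sample of
any size almost surely exactly one subsample of size `d` is `R`-related to all remaining scenarios.
Summing over the subsamples gives, for every `m`, the `m`-th moment of the probability that a
scenario is related to a given subsample. These moments determine the law of that probability, and
hence the probability that it is small for the selected subsample. -/
theorem measure_exists_selected_le (π : Measure Z) [IsProbabilityMeasure π]
    (hd : 0 < d) (hR : MeasurableSet {p : (Fin d → Z) × Z | R (range p.1) p.2})
    (hsel : ∀ M, d ≤ M → ∀ᵐ z ∂(Measure.pi fun _ : Fin M => π),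
      ∃! B : Finset (Fin M), B.card = d ∧ ∀ i ∉ B, R (z '' B) (z i))
    {N : ℕ} (hN : d ≤ N) {t : ℝ} (ht0 : 0 ≤ t) (ht1 : t ≤ 1) :
    (Measure.pi fun _ : Fin N => π) {z | ∃ B : Finset (Fin N), B.card = d ∧
      (π.real {x | R (z '' B) x} < t ∧ ∀ i ∉ B, R (z '' B) (z i))} ≤
    ENNReal.ofReal (∑ i ∈ Finset.range d, (N.choose i : ℝ) * (1 - t) ^ i * t ^ (N - i)) := by
  classical
  set q : (Fin d → Z) → ℝ := fun b => π.real {x | R (range b) x} with hq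
  have hqm : Measurable q := (measurable_accept π hR).ennreal_toReal
  have hq01 : ∀ b, q b ∈ Icc (0 : ℝ) 1 := fun b => ⟨measureReal_nonneg, measureReal_le_one⟩
  have hpow : ∀ (k : ℕ) (S : Set (Fin d → Z)),
      ∫⁻ b in S, π {z | R (range b) z} ^ k ∂(Measure.pi fun _ => π) =
        ENNReal.ofReal (∫ b in S, q b ^ k ∂(Measure.pi fun _ => π)) := by
    intro k S
    rw [ofReal_integral_eq_lintegral_ofReal]
    · refine lintegral_congr fun b => ?_
      rw [ENNReal.ofReal_pow (hq01 b).1, hq, ofReal_measureReal]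
    · refine Integrable.of_bound (by fun_prop) 1 (ae_of_all _ fun b => ?_)
      rw [Real.norm_eq_abs, abs_of_nonneg (pow_nonneg (hq01 b).1 _)]
      exact pow_le_one₀ (hq01 b).1 (hq01 b).2
    · exact ae_of_all _ fun b => pow_nonneg (hq01 b).1 _
  have hmom : ∀ m : ℕ, ((d + m).choose d : ℝ) * ∫ b, q b ^ m ∂(Measure.pi fun _ => π) = 1 := by
    intro m
    -- In a sample of size `d + m` the events of selection are a partition, up to a null set.
    set S : Finset (Fin (d + m)) → Set (Fin (d + m) → Z) :=
      fun B => {z | True ∧ ∀ i ∉ B, R (z '' B) (z i)} with hS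
    have hSm : ∀ B ∈ Finset.powersetCard d (Finset.univ : Finset (Fin (d + m))),
        MeasurableSet (S B) := fun B hB =>
      measurableSet_selected (C := fun _ => True) hR (by simp) (Finset.mem_powersetCard.1 hB).2
    have h1 : ∫⁻ z, ∑ B ∈ Finset.powersetCard d (Finset.univ : Finset (Fin (d + m))),
        (S B).indicator 1 z ∂(Measure.pi fun _ : Fin (d + m) => π) = 1 := by
      rw [← measure_univ (μ := Measure.pi fun _ : Fin (d + m) => π), ← lintegral_one]
      refine lintegral_congr_ae ((hsel (d + m) (by omega)).mono fun z hz => ?_)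
      obtain ⟨B, ⟨hB, hBR⟩, huniq⟩ := hz
      change ∑ B ∈ Finset.powersetCard d (Finset.univ : Finset (Fin (d + m))),
        (S B).indicator 1 z = (1 : ℝ≥0∞)
      rw [Finset.sum_eq_single_of_mem B (Finset.mem_powersetCard.2 ⟨Finset.subset_univ _, hB⟩)]
      · exact indicator_of_mem (by exact ⟨trivial, hBR⟩) _
      · intro B' hB' hne
        refine indicator_of_notMem (fun h => hne ?_) _
        exact huniq B' ⟨(Finset.mem_powersetCard.1 hB').2, h.2⟩
    rw [lintegral_finsetSum _ fun B hB => measurable_one.indicator (hSm B hB)] at h1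
    rw [Finset.sum_congr rfl fun B hB => (lintegral_indicator_one (hSm B hB)).trans
      (measure_selected (C := fun _ => True) π hR (by simp) (Finset.mem_powersetCard.1 hB).2)] at h1
    have h3 := hpow m univ
    rw [Measure.restrict_univ] at h3
    simp only [ofPred_true, Finset.sum_const, Finset.card_powersetCard, Finset.card_univ,
      Fintype.card_fin, Nat.add_sub_cancel_left, Measure.restrict_univ, h3] at h1
    have h2 := congrArg ENNReal.toReal h1
    rwa [nsmul_eq_mul, ENNReal.toReal_mul, ENNReal.toReal_ofReal, ENNReal.toReal_natCast,
      ENNReal.toReal_one] at h2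
    exact integral_nonneg fun b => pow_nonneg (hq01 b).1 _
  have hsub : {z : Fin N → Z | ∃ B : Finset (Fin N), B.card = d ∧
      (π.real {x | R (z '' B) x} < t ∧ ∀ i ∉ B, R (z '' B) (z i))} ⊆
      ⋃ B ∈ Finset.powersetCard d (Finset.univ : Finset (Fin N)),
        {z | π.real {x | R (z '' B) x} < t ∧ ∀ i ∉ B, R (z '' B) (z i)} := by
    rintro z ⟨B, hB, h⟩
    simp only [mem_iUnion]
    exact ⟨B, Finset.mem_powersetCard.2 ⟨Finset.subset_univ _, hB⟩, h⟩
  refine (measure_mono hsub).trans ((measure_biUnion_finset_le _ _).trans ?_)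
  rw [Finset.sum_congr rfl fun B hB => measure_selected
    (C := fun A => π.real {x | R A x} < t) π hR (hqm measurableSet_Iio)
    (Finset.mem_powersetCard.1 hB).2]
  rw [hpow, Finset.sum_const, Finset.card_powersetCard, Finset.card_univ, Fintype.card_fin,
    nsmul_eq_mul, ← ENNReal.ofReal_natCast, ← ENNReal.ofReal_mul (by positivity)]
  refine (congrArg ENNReal.ofReal ?_).le
  exact setIntegral_pow_eq_binomialTail _ hqm hq01 hd hmom hN ht0 ht1

end Scenario

/-! ### Programs that are convex along paths -/

namespace Scenario

open Set Filter Topology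

/-- A sequence approaching `x` from the direction of `y`, to be thought of as the points at times
`2⁻ᵏ` of a curve from `x` to `y` along which the cost is convex and the constraints are quasiconvex.
The last field is the quantitative form of quasiconvexity: towards a point where a constraint is
slack, it becomes slack at a linear rate. -/
structure IsDyadicPath {E Z : Type*} [NormedAddCommGroup E] (domain : Set E) (cost : E → ℝ)
    (constr : E → Z → ℝ) (x y : E) (γ : ℕ → E) : Prop where
  mem_domain : ∀ k, γ k ∈ domain
  norm_sub_le : ∃ L, ∀ᶠ k in atTop, ‖γ k - x‖ ≤ L * (1 / 2) ^ k
  cost_le : ∀ k, cost (γ k) ≤ (1 - (1 / 2) ^ k) * cost x + (1 / 2) ^ k * cost y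
  constr_le : ∀ a, constr x a ≤ 0 → constr y a ≤ 0 → ∀ k, constr (γ k) a ≤ 0
  constr_lt : ∀ a, constr x a ≤ 0 → constr y a < 0 →
    ∃ κ > 0, ∀ᶠ k in atTop, constr (γ k) a ≤ -κ * (1 / 2) ^ k

/-- A program with a cost and constraints `constr x a ≤ 0` indexed by scenarios `a : Z`, strictly
satisfied at a common point. The constraints need not be convex: they are convex up to a multiple
of `‖x‖ ^ 2`, and any two points of the domain are joined by a path along which cost and
constraints behave as if they were convex. The function `rank` orders the scenarios; it serves to
break ties. -/
structure PathConvexProgram (E Z : Type*) [NormedAddCommGroup E] [InnerProductSpace ℝ E]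
    [MeasurableSpace Z] where
  domain : Set E
  cost : E → ℝ
  constr : E → Z → ℝ
  rank : Z → ℝ
  isCompact_sublevel : ∀ t, IsCompact {x | x ∈ domain ∧ cost x ≤ t}
  continuousOn_cost : ContinuousOn cost domain
  convexOn_cost : ConvexOn ℝ domain cost
  continuous_constr : ∀ a, Continuous fun x => constr x a
  weaklyConvex_constr : ∀ a, ∃ C ≥ 0, ConvexOn ℝ univ fun x => constr x a + C * ‖x‖ ^ 2
  measurable_constr : ∀ x, Measurable (constr x)
  measurable_rank : Measurable rank
  exists_feasible : ∃ x ∈ domain, ∀ a, constr x a < 0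
  exists_path : ∀ x ∈ domain, ∀ y ∈ domain, ∃ γ, IsDyadicPath domain cost constr x y γ ∧
    (x ≠ y → cost (γ 1) < (cost x + cost y) / 2)

theorem IsDyadicPath.tendsto {E Z : Type*} [NormedAddCommGroup E] {domain : Set E} {cost : E → ℝ}
    {constr : E → Z → ℝ} {x y : E} {γ : ℕ → E} (h : IsDyadicPath domain cost constr x y γ) :
    Tendsto γ atTop (𝓝 x) := by
  obtain ⟨L, hL⟩ := h.norm_sub_le
  rw [tendsto_iff_norm_sub_tendsto_zero]
  have h0 : Tendsto (fun k : ℕ => L * (1 / 2 : ℝ) ^ k) atTop (𝓝 (L * 0)) :=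
    (tendsto_pow_atTop_nhds_zero_of_lt_one (by norm_num) (by norm_num)).const_mul L
  rw [mul_zero] at h0
  exact squeeze_zero' (Eventually.of_forall fun k => norm_nonneg _) hL h0

/-- The existence of a point of a compact set at which a random continuous function is nonpositive
is measurable, since approximate zeros may be sought in a countable dense set. -/
theorem measurableSet_exists_le {E Ω : Type*} [MetricSpace E] [MeasurableSpace Ω] {K : Set E}
    (hK : IsCompact K) {Φ : E → Ω → ℝ} (hc : ∀ ω, ContinuousOn (fun x => Φ x ω) K)
    (hm : ∀ x, Measurable (Φ x)) : MeasurableSet {ω | ∃ x ∈ K, Φ x ω ≤ 0} := by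
  have : CompactSpace K := isCompact_iff_compactSpace.1 hK
  obtain ⟨D, hDc, hDd⟩ := TopologicalSpace.exists_countable_dense K
  have heq : {ω | ∃ x ∈ K, Φ x ω ≤ 0} =
      ⋂ n : ℕ, ⋃ x ∈ D, {ω | Φ (x : K) ω < 1 / ((n : ℝ) + 1)} := by
    ext ω
    simp only [mem_ofPred_eq, mem_iInter, mem_iUnion, exists_prop]
    have hcont : Continuous fun x : K => Φ x ω := continuousOn_iff_continuous_domRestrict.1 (hc ω)
    constructor
    · rintro ⟨x, hx, hle⟩ n
      have hopen : IsOpen {y : K | Φ y ω < 1 / ((n : ℝ) + 1)} := isOpen_lt hcont continuous_const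
      obtain ⟨y, hy, hyD⟩ := hDd.inter_open_nonempty _ hopen
        ⟨⟨x, hx⟩, lt_of_le_of_lt hle (by positivity)⟩
      exact ⟨y, hyD, hy⟩
    · intro h
      have hne : K.Nonempty := by
        obtain ⟨x, -, -⟩ := h 0
        exact ⟨x, x.2⟩
      obtain ⟨x, hx, hmin⟩ := hK.exists_isMinOn hne (hc ω)
      refine ⟨x, hx, le_of_forall_pos_le_add fun δ hδ => ?_⟩
      obtain ⟨n, hn⟩ := exists_nat_one_div_lt hδ
      obtain ⟨y, -, hy⟩ := h n
      have := hmin y.2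
      simp only [mem_ofPred_eq] at this
      linarith
  rw [heq]
  exact MeasurableSet.iInter fun n => MeasurableSet.biUnion hDc fun x _ =>
    measurableSet_lt (hm x) measurable_const

namespace PathConvexProgram

variable {E Z : Type*} [NormedAddCommGroup E] [InnerProductSpace ℝ E] [MeasurableSpace Z]
  (p : PathConvexProgram E Z)

/-- The points of the domain that satisfy all constraints of the scenarios in `A`. -/
def feasible (A : Set Z) : Set E := {x | x ∈ p.domain ∧ ∀ a ∈ A, p.constr x a ≤ 0}

variable {p} in
theorem feasible_anti {A B : Set Z} (h : A ⊆ B) : p.feasible B ⊆ p.feasible A :=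
  fun _ hx => ⟨hx.1, fun a ha => hx.2 a (h ha)⟩

theorem exists_isMinOn (A : Set Z) : ∃ x ∈ p.feasible A, IsMinOn p.cost (p.feasible A) x := by
  obtain ⟨x₀, hx₀, h₀⟩ := p.exists_feasible
  set K := {x | x ∈ p.domain ∧ p.cost x ≤ p.cost x₀} ∩ ⋂ a ∈ A, {x | p.constr x a ≤ 0} with hK
  have hKc : IsCompact K := (p.isCompact_sublevel _).inter_right
    (isClosed_biInter fun a _ => isClosed_le (p.continuous_constr a) continuous_const)
  have hKne : K.Nonempty := ⟨x₀, ⟨hx₀, le_rfl⟩, mem_iInter₂.2 fun a _ => (h₀ a).le⟩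
  obtain ⟨x, hx, hmin⟩ := hKc.exists_isMinOn hKne (p.continuousOn_cost.mono fun _ hx => hx.1.1)
  refine ⟨x, ⟨hx.1.1, fun a ha => mem_iInter₂.1 hx.2 a ha⟩, fun y hy => ?_⟩
  by_cases hyx : p.cost y ≤ p.cost x₀
  · exact hmin ⟨⟨hy.1, hyx⟩, mem_iInter₂.2 fun a ha => hy.2 a ha⟩
  · exact hx.1.2.trans (not_le.1 hyx).le

/-- The minimizer of the cost under the constraints of the scenarios in `A`. -/
noncomputable def sol (A : Set Z) : E := (p.exists_isMinOn A).choose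

theorem sol_mem (A : Set Z) : p.sol A ∈ p.feasible A := (p.exists_isMinOn A).choose_spec.1

variable {p}

theorem cost_sol_le {A : Set Z} {x : E} (hx : x ∈ p.feasible A) : p.cost (p.sol A) ≤ p.cost x :=
  (p.exists_isMinOn A).choose_spec.2 hx

/-- The minimizer is unique, since the cost is strictly convex along paths. -/
theorem eq_sol {A : Set Z} {x : E} (hx : x ∈ p.feasible A) (h : p.cost x ≤ p.cost (p.sol A)) :
    x = p.sol A := by
  by_contra hne
  have hs := p.sol_mem A
  obtain ⟨γ, hγ, hlt⟩ := p.exists_path x hx.1 _ hs.1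
  have h1 := hlt hne
  have h2 : p.cost (p.sol A) ≤ p.cost (γ 1) :=
    cost_sol_le ⟨hγ.mem_domain 1, fun a ha => hγ.constr_le a (hx.2 a ha) (hs.2 a ha) 1⟩
  linarith

theorem sol_eq_of_mem_feasible {A B : Set Z} (hAB : A ⊆ B) (h : p.sol A ∈ p.feasible B) :
    p.sol B = p.sol A :=
  (eq_sol h (cost_sol_le (feasible_anti hAB (p.sol_mem B)))).symm

theorem sol_eq_of_subset_of_subset {A B S : Set Z} (hAB : A ⊆ B) (hBS : B ⊆ S)
    (h : p.sol A = p.sol S) : p.sol B = p.sol S := by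
  rw [← h]
  exact sol_eq_of_mem_feasible hAB (h ▸ feasible_anti hBS (p.sol_mem S))

theorem cost_path_lt {x y : E} {γ : ℕ → E}
    (hγ : IsDyadicPath p.domain p.cost p.constr x y γ) (h : p.cost y < p.cost x) (k : ℕ) :
    p.cost (γ k) < p.cost x := by
  have h1 := hγ.cost_le k
  have h2 : (0 : ℝ) < (1 / 2) ^ k := by positivity
  nlinarith

/-- Constraints that are slack at the minimizer may be dropped: otherwise a short step along the
path towards the cheaper minimizer would stay feasible. -/
theorem sol_eq_of_inactive {A S : Set Z} (hS : S.Finite) (hAS : A ⊆ S)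
    (h : ∀ a ∈ S \ A, p.constr (p.sol S) a < 0) : p.sol A = p.sol S := by
  have hxA : p.sol S ∈ p.feasible A := feasible_anti hAS (p.sol_mem S)
  have hyA : p.sol A ∈ p.feasible A := p.sol_mem A
  by_contra hne
  have hlt : p.cost (p.sol A) < p.cost (p.sol S) := by
    by_contra hle
    exact hne (eq_sol hxA (not_lt.1 hle)).symm
  obtain ⟨γ, hγ, -⟩ := p.exists_path _ hxA.1 _ hyA.1
  have hev : ∀ᶠ k in atTop, ∀ a ∈ S \ A, p.constr (γ k) a < 0 := by
    rw [(hS.subset sdiff_subset).eventually_all]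
    intro a ha
    exact (((p.continuous_constr a).tendsto _).comp hγ.tendsto).eventually (gt_mem_nhds (h a ha))
  obtain ⟨k, hk⟩ := hev.exists
  refine (cost_path_lt hγ hlt k).not_ge (cost_sol_le ⟨hγ.mem_domain k, fun a ha => ?_⟩)
  by_cases haA : a ∈ A
  · exact hγ.constr_le a (hxA.2 a haA) (hyA.2 a haA) k
  · exact (hk a ⟨ha, haA⟩).le

/-- The coefficient of `‖x‖ ^ 2` that makes the constraint of `a` convex. -/
noncomputable def curvature (p : PathConvexProgram E Z) (a : Z) : ℝ :=
  (p.weaklyConvex_constr a).choose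

theorem curvature_nonneg (a : Z) : 0 ≤ p.curvature a := (p.weaklyConvex_constr a).choose_spec.1

/-- The points satisfying a convex strengthening of the constraint of `a` that is exact at `x`. -/
def convexified (p : PathConvexProgram E Z) (x : E) (a : Z) : Set E :=
  {y | p.constr y a + p.curvature a * ‖y - x‖ ^ 2 < 0}

theorem convex_convexified (x : E) (a : Z) : Convex ℝ (p.convexified x a) := by
  have h1 : ConvexOn ℝ univ fun y => p.constr y a + p.curvature a * ‖y‖ ^ 2 :=
    (p.weaklyConvex_constr a).choose_spec.2
  have h2 : ConvexOn ℝ univ fun y : E =>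
      (-(2 * p.curvature a)) • (innerSL ℝ x : E →L[ℝ] ℝ) y + p.curvature a * ‖x‖ ^ 2 :=
    (((-(2 * p.curvature a)) • (innerSL ℝ x : E →L[ℝ] ℝ)).toLinearMap.convexOn
      convex_univ).add_const _
  have h3 := (h1.add h2).convex_lt 0
  convert h3 using 1
  ext y
  simp only [convexified, mem_ofPred_eq, mem_univ, true_and, Pi.add_apply, innerSL_apply_apply,
    smul_eq_mul]
  rw [norm_sub_sq_real, real_inner_comm]
  ring_nf

theorem constr_lt_of_mem_convexified {x y : E} {a : Z} (h : y ∈ p.convexified x a) :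
    p.constr y a < 0 := by
  have h1 : p.constr y a + p.curvature a * ‖y - x‖ ^ 2 < 0 := h
  have := mul_nonneg (p.curvature_nonneg a) (sq_nonneg ‖y - x‖)
  linarith

/-- Early points of a path satisfy even the convexified constraints: along the path the
constraint decreases at a linear rate, whereas the correction is quadratic. -/
theorem eventually_mem_convexified {x y : E} {γ : ℕ → E}
    (hγ : IsDyadicPath p.domain p.cost p.constr x y γ) {a : Z} (hx : p.constr x a ≤ 0)
    (hy : p.constr y a < 0) : ∀ᶠ k in atTop, γ k ∈ p.convexified x a := by
  obtain ⟨κ, hκ, hev⟩ := hγ.constr_lt a hx hy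
  obtain ⟨L, hL⟩ := hγ.norm_sub_le
  have h0 : Tendsto (fun k : ℕ => p.curvature a * L ^ 2 * (1 / 2 : ℝ) ^ k) atTop
      (𝓝 (p.curvature a * L ^ 2 * 0)) :=
    (tendsto_pow_atTop_nhds_zero_of_lt_one (by norm_num) (by norm_num)).const_mul _
  rw [mul_zero] at h0
  filter_upwards [hev, hL, h0.eventually (gt_mem_nhds hκ)] with k h1 h2 h3
  have ht : (0 : ℝ) < (1 / 2) ^ k := by positivity
  have h4 : ‖γ k - x‖ ^ 2 ≤ (L * (1 / 2) ^ k) ^ 2 := pow_le_pow_left₀ (norm_nonneg _) h2 2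
  have h5 := mul_le_mul_of_nonneg_left h4 (p.curvature_nonneg a)
  have h6 := mul_lt_mul_of_pos_right h3 ht
  change p.constr (γ k) a + p.curvature a * ‖γ k - x‖ ^ 2 < 0
  nlinarith

/-- The minimizer is determined by `finrank E` of the constraints. This is Helly's theorem for the
constraints convexified at the minimizer. -/
theorem exists_support [FiniteDimensional ℝ E] {ι : Type*} [Fintype ι] (z : ι → Z) :
    ∃ T : Finset ι, T.card ≤ Module.finrank ℝ E ∧ p.sol (z '' T) = p.sol (range z) := by
  classical
  by_contra! hcon
  set x := p.sol (range z) with hxdef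
  have hx : x ∈ p.feasible (range z) := p.sol_mem (range z)
  have hxi : ∀ i, p.constr x (z i) ≤ 0 := fun i => hx.2 _ (mem_range_self i)
  obtain ⟨x₀, hx₀, hneg⟩ := p.exists_feasible
  -- If no `finrank E` constraints determine the minimizer, then any `finrank E + 1` of the following
  -- sets intersect: the convexified constraints and, at the index `none`, the set of points cheaper
  -- than `x`.
  set F : Option ι → Set E := fun o => o.elim {y | y ∈ p.domain ∧ p.cost y < p.cost x}
    (fun i => p.convexified x (z i)) with hF
  have hne : (⋂ o ∈ (Finset.univ : Finset (Option ι)), F o).Nonempty := by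
    refine Convex.helly_theorem' (𝕜 := ℝ) ?_ ?_
    · rintro (_ | i) -
      · exact p.convexOn_cost.convex_lt _
      · exact convex_convexified x (z i)
    · intro I _ hI
      by_cases hn : none ∈ I
      · set T := I.eraseNone with hT
        have hcard : T.card ≤ Module.finrank ℝ E := by
          rw [hT, Finset.card_eraseNone_eq_card_erase, Finset.card_erase_of_mem hn]
          omega
        have hy := p.sol_mem (z '' T)
        have hlt : p.cost (p.sol (z '' T)) < p.cost x := not_le.1 fun hle => hcon T hcard
          (eq_sol (feasible_anti (image_subset_range _ _) hx) hle).symm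
        -- A point still cheaper than `x` at which the constraints in `T` are slack.
        obtain ⟨y', hy', hylt, hyneg⟩ : ∃ y' ∈ p.domain, p.cost y' < p.cost x ∧
            ∀ i ∈ T, p.constr y' (z i) < 0 := by
          obtain ⟨δ, hδ, -⟩ := p.exists_path _ hy.1 _ hx₀
          have h1 : ∀ᶠ k in atTop, p.cost (δ k) < p.cost x := by
            have := (p.continuousOn_cost _ hy.1).tendsto.comp (tendsto_nhdsWithin_iff.2
              ⟨hδ.tendsto, Eventually.of_forall hδ.mem_domain⟩)
            exact this.eventually (gt_mem_nhds hlt)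
          have h2 : ∀ᶠ k in atTop, ∀ i ∈ T, p.constr (δ k) (z i) < 0 := by
            rw [Finset.eventually_all]
            intro i hi
            filter_upwards [eventually_mem_convexified hδ
              (hy.2 _ (mem_image_of_mem z (by exact_mod_cast hi))) (hneg (z i))] with k hk
            exact constr_lt_of_mem_convexified hk
          obtain ⟨k, hk1, hk2⟩ := (h1.and h2).exists
          exact ⟨δ k, hδ.mem_domain k, hk1, hk2⟩
        obtain ⟨γ, hγ, -⟩ := p.exists_path _ hx.1 _ hy'
        have hev : ∀ᶠ k in atTop, ∀ i ∈ T, γ k ∈ p.convexified x (z i) := by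
          rw [Finset.eventually_all]
          exact fun i hi => eventually_mem_convexified hγ (hxi i) (hyneg i hi)
        obtain ⟨k, hk⟩ := hev.exists
        refine ⟨γ k, ?_⟩
        simp only [mem_iInter]
        rintro (_ | i) ho
        · exact ⟨hγ.mem_domain k, cost_path_lt hγ hylt k⟩
        · exact hk i (by simpa [hT] using ho)
      · obtain ⟨γ, hγ, -⟩ := p.exists_path _ hx.1 _ hx₀
        have hev : ∀ᶠ k in atTop, ∀ i, γ k ∈ p.convexified x (z i) := by
          rw [eventually_all]
          exact fun i => eventually_mem_convexified hγ (hxi i) (hneg (z i))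
        obtain ⟨k, hk⟩ := hev.exists
        refine ⟨γ k, ?_⟩
        simp only [mem_iInter]
        rintro (_ | i) ho
        · exact absurd ho hn
        · exact hk i
  obtain ⟨y, hy⟩ := hne
  simp only [Finset.mem_univ, iInter_true, mem_iInter] at hy
  have hy0 : y ∈ p.domain ∧ p.cost y < p.cost x := hy none
  refine hy0.2.not_ge (cost_sol_le ⟨hy0.1, ?_⟩)
  rintro _ ⟨i, rfl⟩
  exact (constr_lt_of_mem_convexified (hy (some i))).le

section Measurability

variable {κ : Type*} [Fintype κ]

variable (p) in
theorem measurableSet_exists_feasible {K : Set E} (hK : IsClosed K) {f : (κ → Z) → ℝ}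
    (hf : Measurable f) :
    MeasurableSet {z : κ → Z | ∃ x ∈ p.feasible (range z) ∩ K, p.cost x ≤ f z} := by
  -- All conditions on `x` hold when a sum of positive parts vanishes.
  have h := fun t : ℕ => measurableSet_exists_le ((p.isCompact_sublevel t).inter_right hK)
    (Φ := fun x (z : κ → Z) => max (p.cost x - f z) 0 + ∑ i, max (p.constr x (z i)) 0)
    (fun z => ((p.continuousOn_cost.mono fun _ hx => hx.1.1).sub continuousOn_const).sup
      continuousOn_const |>.add (continuousOn_finsetSum _ fun i _ =>
        ((p.continuous_constr _).sup continuous_const).continuousOn))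
    (fun x => by
      have := p.measurable_constr x
      fun_prop)
  convert MeasurableSet.iUnion h using 1
  ext z
  simp only [mem_ofPred_eq, mem_iUnion]
  have hs : ∀ x, 0 ≤ ∑ i, max (p.constr x (z i)) 0 := fun x =>
    Finset.sum_nonneg fun i _ => le_max_right _ _
  constructor
  · rintro ⟨x, ⟨⟨hd, hA⟩, hxK⟩, hle⟩
    obtain ⟨t, ht⟩ := exists_nat_ge (p.cost x)
    refine ⟨t, x, ⟨⟨hd, ht⟩, hxK⟩, ?_⟩
    rw [max_eq_right (by linarith), zero_add]
    exact Finset.sum_nonpos fun i _ => max_le (hA _ (mem_range_self i)) le_rfl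
  · rintro ⟨t, x, ⟨⟨hd, -⟩, hxK⟩, hle⟩
    have hm := le_max_right (p.cost x - f z) 0
    refine ⟨x, ⟨⟨hd, ?_⟩, hxK⟩, ?_⟩
    · rintro _ ⟨i, rfl⟩
      have h1 : max (p.constr x (z i)) 0 ≤ ∑ i, max (p.constr x (z i)) 0 :=
        Finset.single_le_sum (f := fun i => max (p.constr x (z i)) 0)
          (fun i _ => le_max_right _ _) (Finset.mem_univ i)
      have h2 := le_max_left (p.constr x (z i)) 0
      linarith
    · have := le_max_left (p.cost x - f z) 0
      linarith [hs x]

variable (p) in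
theorem measurable_cost_sol : Measurable fun z : κ → Z => p.cost (p.sol (range z)) := by
  refine measurable_of_Iic fun t => ?_
  convert p.measurableSet_exists_feasible (κ := κ) isClosed_univ (measurable_const (a := t)) using 1
  ext z
  simp only [mem_preimage, mem_Iic, inter_univ, mem_ofPred_eq]
  exact ⟨fun h => ⟨_, p.sol_mem _, h⟩, fun ⟨x, hx, h⟩ => (cost_sol_le hx).trans h⟩

variable [MeasurableSpace E] [BorelSpace E]

variable (p) in
theorem measurable_sol : Measurable fun z : κ → Z => p.sol (range z) := by
  refine measurable_of_isClosed fun K hK => ?_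
  convert p.measurableSet_exists_feasible hK (p.measurable_cost_sol (κ := κ)) using 1
  ext z
  simp only [mem_preimage, mem_ofPred_eq]
  exact ⟨fun h => ⟨_, ⟨p.sol_mem _, h⟩, le_rfl⟩, fun ⟨x, hx, h⟩ => eq_sol hx.1 h ▸ hx.2⟩

variable (p) in
theorem measurable_constr_sol [SecondCountableTopology E] {Ω : Type*} [MeasurableSpace Ω]
    {b : Ω → κ → Z} {a : Ω → Z} (hb : Measurable b) (ha : Measurable a) :
    Measurable fun ω => p.constr (p.sol (range (b ω))) (a ω) :=
  (measurable_uncurry_of_continuous_of_measurable (u := fun x a => p.constr x a)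
    p.continuous_constr p.measurable_constr).comp ((p.measurable_sol.comp hb).prodMk ha)

end Measurability

end PathConvexProgram

end Scenario

/-! ### The scenario bound under nondegeneracy -/

namespace Scenario

open Set Filter Topology

/-- A point independent of a subsample almost surely avoids sets that are null given the
subsample. -/
theorem ae_not_of_null_sections {Z : Type*} [MeasurableSpace Z] (π : Measure Z)
    [IsProbabilityMeasure π] {Q : Set Z → Z → Prop} {ι : Type*} [Fintype ι] {T : Finset ι}
    (hQ : MeasurableSet {q : (Fin T.card → Z) × Z | Q (range q.1) q.2})
    (h0 : ∀ b : Fin T.card → Z, π {a | Q (range b) a} = 0) {i : ι} (hi : i ∉ T) :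
    ∀ᵐ z ∂(Measure.pi fun _ : ι => π), ¬ Q (z '' T) (z i) := by
  classical
  set e := T.equivFin.symm with he
  have hS : MeasurableSet {q : (Fin T.card → Z) × ({i // i ∉ T} → Z) |
      Q (range q.1) (q.2 ⟨i, hi⟩)} :=
    (by fun_prop : Measurable fun q : (Fin T.card → Z) × ({i // i ∉ T} → Z) =>
      (q.1, q.2 ⟨i, hi⟩)) hQ
  have hnull : ((Measure.pi fun _ : Fin T.card => π).prod (Measure.pi fun _ => π))
      {q : (Fin T.card → Z) × ({i // i ∉ T} → Z) | Q (range q.1) (q.2 ⟨i, hi⟩)} = 0 := by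
    refine (Measure.measure_prod_null hS).2 (ae_of_all _ fun b => ?_)
    have hb : MeasurableSet {a | Q (range b) a} := measurable_prodMk_left hQ
    exact ((measurePreserving_eval (fun _ : {i // i ∉ T} => π) ⟨i, hi⟩).measure_preimage
      hb.nullMeasurableSet).trans (h0 b)
  have := (measurePreserving_split π T e).quasiMeasurePreserving.ae
    (p := fun q => ¬ Q (range q.1) (q.2 ⟨i, hi⟩)) (by rw [ae_iff]; simpa using hnull)
  filter_upwards [this] with z hz
  rwa [range_comp_equiv_coe] at hz

namespace PathConvexProgram

variable {E Z : Type*} [NormedAddCommGroup E] [InnerProductSpace ℝ E] [MeasurableSpace Z]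
  (p : PathConvexProgram E Z)

/-- The scenario `a` agrees with the subsample `A`: its constraint is slack at the solution for
`A`, and `a` ranks below those elements of `A` whose constraints are slack there as well. -/
def Agrees (A : Set Z) (a : Z) : Prop :=
  p.constr (p.sol A) a < 0 ∧ ∀ b ∈ A, p.constr (p.sol A) b < 0 → p.rank a < p.rank b

variable {p}

theorem measurableSet_agrees [MeasurableSpace E] [BorelSpace E] [SecondCountableTopology E]
    (k : ℕ) : MeasurableSet {q : (Fin k → Z) × Z | p.Agrees (range q.1) q.2} := by
  have h1 : Measurable fun q : (Fin k → Z) × Z => p.constr (p.sol (range q.1)) q.2 :=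
    p.measurable_constr_sol measurable_fst measurable_snd
  have h2 : ∀ j, Measurable fun q : (Fin k → Z) × Z => p.constr (p.sol (range q.1)) (q.1 j) :=
    fun j => p.measurable_constr_sol measurable_fst (by fun_prop)
  have hr := p.measurable_rank
  have heq : {q : (Fin k → Z) × Z | p.Agrees (range q.1) q.2} =
      {q | p.constr (p.sol (range q.1)) q.2 < 0} ∩ ⋂ j,
        ({q | p.constr (p.sol (range q.1)) (q.1 j) < 0}ᶜ ∪
          {q | p.rank q.2 < p.rank (q.1 j)}) := by
    ext q
    simp only [Agrees, forall_mem_range, mem_inter_iff, mem_iInter, mem_union, mem_compl_iff,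
      mem_ofPred_eq, ← imp_iff_not_or]
  rw [heq]
  refine (measurableSet_lt h1 measurable_const).inter (MeasurableSet.iInter fun j => ?_)
  exact (measurableSet_lt (h2 j) measurable_const).compl.union
    (measurableSet_lt (by fun_prop) (by fun_prop))

theorem sol_eq_of_agrees {ι : Type*} {z : ι → Z} {B : Finset ι}
    (h : ∀ i ∉ B, p.Agrees (z '' B) (z i)) : p.sol (range z) = p.sol (z '' B) := by
  refine sol_eq_of_mem_feasible (image_subset_range _ _) ⟨(p.sol_mem _).1, ?_⟩
  rintro _ ⟨i, rfl⟩
  by_cases hi : i ∈ B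
  · exact (p.sol_mem (z '' B)).2 _ (mem_image_of_mem z hi)
  · exact (h i hi).1.le

/-- At most one subsample of a given size agrees with all remaining scenarios: an element of the
symmetric difference of two such subsamples would be slack, and rank both above and below. -/
theorem eq_of_agrees {ι : Type*} {z : ι → Z} {B C : Finset ι} (hcard : B.card = C.card)
    (hB : ∀ i ∉ B, p.Agrees (z '' B) (z i)) (hC : ∀ i ∉ C, p.Agrees (z '' C) (z i)) : B = C := by
  by_contra hne
  obtain ⟨i, hiB, hiC⟩ : ∃ i ∈ B, i ∉ C := by
    by_contra! hsub
    exact hne (Finset.eq_of_subset_of_card_le hsub hcard.ge)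
  obtain ⟨j, hjC, hjB⟩ : ∃ j ∈ C, j ∉ B := by
    by_contra! hsub
    exact hne (Finset.eq_of_subset_of_card_le hsub hcard.le).symm
  have hs : p.sol (z '' B) = p.sol (z '' C) :=
    (sol_eq_of_agrees hB).symm.trans (sol_eq_of_agrees hC)
  have h1 := (hB j hjB).2 (z i) (mem_image_of_mem z hiB) (hs ▸ (hC i hiC).1)
  have h2 := (hC i hiC).2 (z j) (mem_image_of_mem z hjC) (hs ▸ (hB j hjB).1)
  exact lt_asymm h1 h2

/-- If the scenarios whose constraint is active at the solution number at most `d` and the ranks are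
distinct, then the active scenarios together with the top ranked other ones agree with the rest. -/
theorem exists_agrees {ι : Type*} [Fintype ι] {d : ℕ} {z : ι → Z} (hd : d ≤ Fintype.card ι)
    {T : Finset ι} (hT : T.card ≤ d) (hact : ∀ i ∉ T, p.constr (p.sol (range z)) (z i) ≠ 0)
    (hrank : ∀ i j, i ≠ j → p.rank (z i) ≠ p.rank (z j)) :
    ∃ B : Finset ι, B.card = d ∧ ∀ i ∉ B, p.Agrees (z '' B) (z i) := by
  classical
  set x := p.sol (range z) with hx
  have hle : ∀ i, p.constr x (z i) ≤ 0 := fun i => (p.sol_mem (range z)).2 _ (mem_range_self i)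
  set A : Finset ι := Finset.univ.filter fun i => p.constr x (z i) = 0 with hA
  have hAmem : ∀ i, i ∈ A ↔ p.constr x (z i) = 0 := fun i => by simp [hA]
  have hAcard : A.card ≤ d := (Finset.card_le_card fun i hi => by
    by_contra hiT
    exact hact i hiT ((hAmem i).1 hi)).trans hT
  have hsol : p.sol (z '' A) = x := by
    refine sol_eq_of_inactive (finite_range z) (image_subset_range _ _) ?_
    rintro _ ⟨⟨i, rfl⟩, hi⟩
    exact lt_of_le_of_ne (hle i) fun h0 => hi (mem_image_of_mem z ((hAmem i).2 h0))
  set 𝓑 := (Finset.powersetCard d (Finset.univ : Finset ι)).filter (A ⊆ ·) with h𝓑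
  have h𝓑ne : 𝓑.Nonempty := by
    obtain ⟨B, hAB, -, hB⟩ := Finset.exists_subsuperset_card_eq (Finset.subset_univ A) hAcard hd
    exact ⟨B, by simp [h𝓑, hB, hAB]⟩
  obtain ⟨B, hB, hmax⟩ := 𝓑.exists_max_image (fun B => ∑ i ∈ B, p.rank (z i)) h𝓑ne
  have hB' : B.card = d ∧ A ⊆ B := by simpa [h𝓑] using hB
  have hBsol : p.sol (z '' B) = x :=
    sol_eq_of_subset_of_subset (image_mono (by exact_mod_cast hB'.2))
      (image_subset_range _ _) hsol
  refine ⟨B, hB'.1, fun i hi => ⟨?_, ?_⟩⟩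
  · rw [hBsol]
    exact lt_of_le_of_ne (hle i) fun h0 => hi (hB'.2 ((hAmem i).2 h0))
  · rintro _ ⟨j, hj, rfl⟩ hneg
    rw [hBsol] at hneg
    have hjA : j ∉ A := fun h => hneg.ne ((hAmem j).1 h)
    have hij : i ≠ j := fun h => hi (h ▸ hj)
    refine lt_of_le_of_ne ?_ (hrank i j hij)
    have hjB : j ∈ B := hj
    have hi' : i ∉ B.erase j := fun h => hi (Finset.mem_of_mem_erase h)
    have hmem : insert i (B.erase j) ∈ 𝓑 := by
      simp only [h𝓑, Finset.mem_filter, Finset.mem_powersetCard, Finset.subset_univ, true_and]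
      refine ⟨?_, fun k hk => ?_⟩
      · rw [Finset.card_insert_of_notMem hi', Finset.card_erase_of_mem hjB, ← hB'.1]
        have := Finset.card_pos.2 ⟨j, hjB⟩
        omega
      · exact Finset.mem_insert_of_mem
          (Finset.mem_erase.2 ⟨fun h => hjA (h ▸ hk), hB'.2 hk⟩)
    have hs := hmax _ hmem
    rw [Finset.sum_insert hi', ← Finset.add_sum_erase B _ hjB] at hs
    linarith

variable [FiniteDimensional ℝ E]

/-- In the nondegenerate case almost surely exactly one subsample of size `finrank E` agrees with all
remaining scenarios. -/
theorem ae_existsUnique_agrees (π : Measure Z) [IsProbabilityMeasure π]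
    (hconstr : ∀ x ∈ p.domain, π {a | p.constr x a = 0} = 0) (hrank : ∀ r, π {a | p.rank a = r} = 0)
    {M : ℕ} (hM : Module.finrank ℝ E ≤ M) :
    ∀ᵐ z ∂(Measure.pi fun _ : Fin M => π), ∃! B : Finset (Fin M),
      B.card = Module.finrank ℝ E ∧ ∀ i ∉ B, p.Agrees (z '' B) (z i) := by
  borelize E
  have : SecondCountableTopology E := (ContinuousLinearEquiv.ofFinrankEq (𝕜 := ℝ) (E := E)
    (F := EuclideanSpace ℝ (Fin (Module.finrank ℝ E)))
      (by simp)).toHomeomorph.secondCountableTopology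
  have h1 : ∀ᵐ z ∂(Measure.pi fun _ : Fin M => π), ∀ T : Finset (Fin M), ∀ i, i ∉ T →
      p.constr (p.sol (z '' T)) (z i) ≠ 0 := by
    refine ae_all_iff.2 fun T => ae_all_iff.2 fun i => ?_
    by_cases hi : i ∈ T
    · exact ae_of_all _ fun z h => absurd hi h
    refine (ae_not_of_null_sections π (Q := fun A a => p.constr (p.sol A) a = 0) (T := T)
      ?_ (fun b => hconstr _ (p.sol_mem _).1) hi).mono fun z hz _ => hz
    exact p.measurable_constr_sol measurable_fst measurable_snd (measurableSet_singleton 0)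
  have h2 : ∀ᵐ z ∂(Measure.pi fun _ : Fin M => π), ∀ i j, i ≠ j →
      p.rank (z i) ≠ p.rank (z j) := by
    refine ae_all_iff.2 fun i => ae_all_iff.2 fun j => ?_
    by_cases hij : i = j
    · exact ae_of_all _ fun z h => absurd hij h
    have hr := p.measurable_rank
    refine (ae_not_of_null_sections π (Q := fun A a => ∃ b ∈ A, p.rank a = p.rank b) (T := {j})
      (i := i) ?_ ?_ (by simpa using hij)).mono fun z hz _ h => hz ⟨z j, by simp, h⟩
    · simp only [exists_range_iff, ofPred_exists]
      exact MeasurableSet.iUnion fun k => measurableSet_eq_fun (by fun_prop) (by fun_prop)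
    · intro b
      simp only [exists_range_iff, ofPred_exists]
      exact measure_iUnion_null fun k => hrank _
  filter_upwards [h1, h2] with z hz1 hz2
  obtain ⟨T, hT, hTsol⟩ := exists_support (p := p) z
  obtain ⟨B, hB, hBz⟩ := exists_agrees (p := p) (by simpa using hM) hT
    (fun i hi => hTsol ▸ hz1 T i hi) hz2
  exact ⟨B, ⟨hB, hBz⟩, fun C hC => eq_of_agrees (hC.1.trans hB.symm) hC.2 hBz⟩

/-- The scenario bound for a nondegenerate program: for every point of the domain the constraint is
almost surely not active, and the ranks have no atoms. -/
theorem measure_violation_le (π : Measure Z) [IsProbabilityMeasure π]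
    (hconstr : ∀ x ∈ p.domain, π {a | p.constr x a = 0} = 0) (hrank : ∀ r, π {a | p.rank a = r} = 0)
    (hE : 0 < Module.finrank ℝ E) {N : ℕ} (hN : Module.finrank ℝ E ≤ N) {ε : ℝ} (hε0 : 0 ≤ ε)
    (hε1 : ε ≤ 1) :
    (Measure.pi fun _ : Fin N => π) {z | ε < π.real {a | 0 < p.constr (p.sol (range z)) a}} ≤
      ENNReal.ofReal (∑ i ∈ Finset.range (Module.finrank ℝ E),
        (N.choose i : ℝ) * ε ^ i * (1 - ε) ^ (N - i)) := by
  borelize E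
  have : SecondCountableTopology E := (ContinuousLinearEquiv.ofFinrankEq (𝕜 := ℝ) (E := E)
    (F := EuclideanSpace ℝ (Fin (Module.finrank ℝ E)))
      (by simp)).toHomeomorph.secondCountableTopology
  have h := measure_exists_selected_le π hE (p.measurableSet_agrees _)
    (fun M hM => ae_existsUnique_agrees π hconstr hrank hM) hN (t := 1 - ε) (by linarith)
    (by linarith)
  simp only [sub_sub_cancel] at h
  refine le_trans (measure_mono_ae ?_) h
  filter_upwards [ae_existsUnique_agrees π hconstr hrank hN] with z ⟨B, ⟨hB, hBz⟩, _⟩ hz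
  refine ⟨B, hB, ?_, hBz⟩
  have hz : ε < π.real {a | 0 < p.constr (p.sol (range z)) a} := hz
  have hm : MeasurableSet {a | 0 < p.constr (p.sol (range z)) a} :=
    measurableSet_lt measurable_const (p.measurable_constr _)
  have hsub : {a | p.Agrees (z '' B) a} ⊆ {a | 0 < p.constr (p.sol (range z)) a}ᶜ := by
    intro a ha
    have := ha.1
    rw [← sol_eq_of_agrees hBz] at this
    exact not_lt.2 this.le
  have h1 := measureReal_mono (μ := π) hsub
  rw [probReal_compl_eq_one_sub hm] at h1
  linarith

end PathConvexProgram

end Scenario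

/-! ### The scenario bound for unique solutions -/

namespace Scenario

open Set Filter Topology
open scoped ENNReal

/-- A program with a cost and constraints `constr x a 1 ≤ 0` indexed by scenarios `a : Δ`, all of
them satisfied at a common point. The third argument of `constr` is a level: raising it relaxes the
constraint. Any two points of the domain are joined by a path along which the cost and the
constraints at all positive levels behave as if they were convex. The function `reg` serves to
regularize the cost: it is strictly convex along the paths. -/
structure ScenarioProgram (E Δ : Type*) [NormedAddCommGroup E] [InnerProductSpace ℝ E]
    [MeasurableSpace Δ] where
  domain : Set E
  cost : E → ℝ
  reg : E → ℝ
  constr : E → Δ → ℝ → ℝ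
  isCompact_sublevel : ∀ t, IsCompact {x | x ∈ domain ∧ cost x ≤ t}
  continuousOn_cost : ContinuousOn cost domain
  convexOn_cost : ConvexOn ℝ domain cost
  continuousOn_reg : ContinuousOn reg domain
  convexOn_reg : ConvexOn ℝ domain reg
  reg_nonneg : ∀ x ∈ domain, 0 ≤ reg x
  continuous_constr : ∀ a, Continuous fun q : E × ℝ => constr q.1 a q.2
  weaklyConvex_constr : ∀ a l, ∃ C ≥ 0, ConvexOn ℝ univ fun x => constr x a l + C * ‖x‖ ^ 2
  measurable_constr : ∀ x, Measurable fun q : Δ × ℝ => constr x q.1 q.2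
  strictAnti_constr : ∀ x ∈ domain, ∀ a, StrictAnti (constr x a)
  exists_feasible : ∃ x ∈ domain, ∀ a, constr x a 1 ≤ 0
  exists_path : ∀ x ∈ domain, ∀ y ∈ domain, ∃ γ,
    IsDyadicPath domain cost (fun x (a : Δ × Ioi (0 : ℝ)) => constr x a.1 a.2) x y γ ∧
    (∀ k, reg (γ k) ≤ (1 - (1 / 2) ^ k) * reg x + (1 / 2) ^ k * reg y) ∧
    (x ≠ y → reg (γ 1) < (reg x + reg y) / 2)

namespace ScenarioProgram

variable {E Δ : Type*} [NormedAddCommGroup E] [InnerProductSpace ℝ E] [MeasurableSpace Δ]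
  (p : ScenarioProgram E Δ)

/-- The level `1 + ρ * exp u` assigned to a scenario with mark `u`. -/
noncomputable def level (ρ : ℝ) (u : ℝ) : ℝ := 1 + ρ * Real.exp u

theorem one_lt_level {ρ : ℝ} (hρ : 0 < ρ) (u : ℝ) : 1 < level ρ u :=
  lt_add_of_pos_right _ (mul_pos hρ (Real.exp_pos u))

theorem continuous_level (ρ : ℝ) : Continuous (level ρ) := by
  unfold level; fun_prop

theorem tendsto_level {ρ : ℕ → ℝ} (hρ0 : Tendsto ρ atTop (𝓝 0)) (u : ℝ) :
    Tendsto (fun k => level (ρ k) u) atTop (𝓝 1) := by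
  have := (hρ0.mul_const (Real.exp u)).const_add 1
  simpa [level] using this

/-- The perturbation of size `ρ`: each scenario `a` comes with a mark `u`, which relaxes the
constraint to the level `1 + ρ * exp u`; the cost is made strictly convex along paths by adding
`ρ * reg`, and the marks serve as ranks. -/
noncomputable def perturb (ρ : ℝ) (hρ : 0 < ρ) : PathConvexProgram E (Δ × ℝ) where
  domain := p.domain
  cost x := p.cost x + ρ * p.reg x
  constr x a := p.constr x a.1 (level ρ a.2)
  rank a := a.2
  isCompact_sublevel t := by
    have hc : ContinuousOn (fun x => p.cost x + ρ * p.reg x) p.domain :=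
      p.continuousOn_cost.add (continuousOn_const.mul p.continuousOn_reg)
    have hK := p.isCompact_sublevel t
    have := (hc.mono fun x hx => hx.1).preimage_isClosed_of_isClosed hK.isClosed
      (isClosed_Iic (a := t))
    refine hK.of_isClosed_subset ?_ (fun x hx => ?_)
      (t := {x | x ∈ p.domain ∧ p.cost x + ρ * p.reg x ≤ t})
    · convert this using 1
      ext x
      refine ⟨fun hx => ⟨⟨hx.1, ?_⟩, hx.2⟩, fun hx => ⟨hx.1.1, hx.2⟩⟩
      have := mul_nonneg hρ.le (p.reg_nonneg x hx.1)
      linarith [hx.2]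
    · have := mul_nonneg hρ.le (p.reg_nonneg x hx.1)
      exact ⟨hx.1, by linarith [hx.2]⟩
  continuousOn_cost := p.continuousOn_cost.add (continuousOn_const.mul p.continuousOn_reg)
  convexOn_cost := p.convexOn_cost.add (p.convexOn_reg.smul hρ.le)
  continuous_constr a := (p.continuous_constr a.1).comp (by fun_prop : Continuous fun x : E =>
    (x, level ρ a.2))
  weaklyConvex_constr a := p.weaklyConvex_constr a.1 _
  measurable_constr x := (p.measurable_constr x).comp
    (measurable_fst.prodMk ((continuous_level ρ).measurable.comp measurable_snd))
  measurable_rank := measurable_snd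
  exists_feasible := by
    obtain ⟨x, hx, h⟩ := p.exists_feasible
    exact ⟨x, hx, fun a => (p.strictAnti_constr x hx a.1 (one_lt_level hρ a.2)).trans_le (h a.1)⟩
  exists_path x hx y hy := by
    obtain ⟨γ, hγ, hreg, hlt⟩ := p.exists_path x hx y hy
    have hl : ∀ u, level ρ u ∈ Ioi (0 : ℝ) := fun u => one_pos.trans (one_lt_level hρ u)
    refine ⟨γ, ⟨hγ.mem_domain, hγ.norm_sub_le, fun k => ?_,
      fun a => hγ.constr_le (a.1, ⟨_, hl a.2⟩), fun a => hγ.constr_lt (a.1, ⟨_, hl a.2⟩)⟩,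
      fun hne => ?_⟩
    · have h1 := hγ.cost_le k
      have h2 := mul_le_mul_of_nonneg_left (hreg k) hρ.le
      linarith
    · have h1 := hγ.cost_le 1
      have h2 := mul_lt_mul_of_pos_left (hlt hne) hρ
      norm_num at h1
      linarith

variable {p}

/-- The law of the marked scenarios: the marks are standard Gaussian, independent of the
scenarios. Any atomless law would do. -/
noncomputable def markedLaw (μ : Measure Δ) : Measure (Δ × ℝ) := μ.prod (gaussianReal 0 1)

instance (μ : Measure Δ) [IsProbabilityMeasure μ] : IsProbabilityMeasure (markedLaw μ) := by
  unfold markedLaw; infer_instance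

theorem gaussianReal_singleton (r : ℝ) : gaussianReal 0 1 {r} = 0 := by
  have := nullSingletonClass_gaussianReal (μ := 0) (v := 1) one_ne_zero
  exact measure_singleton r

theorem markedLaw_rank_eq (μ : Measure Δ) [IsProbabilityMeasure μ] (r : ℝ) :
    markedLaw μ {a | a.2 = r} = 0 := by
  have : {a : Δ × ℝ | a.2 = r} = univ ×ˢ {r} := by ext; simp
  rw [this, markedLaw, Measure.prod_prod, gaussianReal_singleton, mul_zero]

theorem markedLaw_constr_eq (μ : Measure Δ) [IsProbabilityMeasure μ] {ρ : ℝ} (hρ : 0 < ρ) {x : E}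
    (hx : x ∈ p.domain) : markedLaw μ {a | (p.perturb ρ hρ).constr x a = 0} = 0 := by
  have hm : MeasurableSet {a | (p.perturb ρ hρ).constr x a = 0} :=
    (p.perturb ρ hρ).measurable_constr x (measurableSet_singleton 0)
  refine (Measure.measure_prod_null hm).2 (ae_of_all _ fun a => ?_)
  have hsub : {u | p.constr x a (level ρ u) = 0}.Subsingleton := by
    intro u hu v hv
    have h1 := (p.strictAnti_constr x hx a).injective (Eq.trans hu (Eq.symm hv))
    simpa [level, hρ.ne'] using h1
  have := nullSingletonClass_gaussianReal (μ := 0) (v := 1) one_ne_zero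
  exact hsub.measure_zero _

/-- A point is the only minimizer for the scenarios `s` when every feasible point of no larger cost
coincides with it. -/
structure IsUniqueSolution (p : ScenarioProgram E Δ) {N : ℕ} (s : Fin N → Δ) (x : E) : Prop where
  mem_domain : x ∈ p.domain
  constr_le : ∀ i, p.constr x (s i) 1 ≤ 0
  unique : ∀ y ∈ p.domain, (∀ i, p.constr y (s i) 1 ≤ 0) → p.cost y ≤ p.cost x → y = x

/-- A unique solution is the limit of the solutions of vanishing perturbations. -/
theorem tendsto_sol_perturb {N : ℕ} {z : Fin N → Δ × ℝ} {x : E}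
    (hx : p.IsUniqueSolution (fun i => (z i).1) x) {ρ : ℕ → ℝ} (hρ : ∀ k, 0 < ρ k)
    (hρ0 : Tendsto ρ atTop (𝓝 0)) :
    Tendsto (fun k => (p.perturb (ρ k) (hρ k)).sol (range z)) atTop (𝓝 x) := by
  set y := fun k => (p.perturb (ρ k) (hρ k)).sol (range z) with hy
  have hmem : ∀ k, y k ∈ p.domain := fun k => ((p.perturb (ρ k) (hρ k)).sol_mem (range z)).1
  have hcon : ∀ k i, p.constr (y k) (z i).1 (level (ρ k) (z i).2) ≤ 0 := fun k i =>
    ((p.perturb (ρ k) (hρ k)).sol_mem (range z)).2 _ (mem_range_self i)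
  have hcost : ∀ k, p.cost (y k) ≤ p.cost x + ρ k * p.reg x := by
    intro k
    have hfeas : x ∈ (p.perturb (ρ k) (hρ k)).feasible (range z) := by
      refine ⟨hx.mem_domain, ?_⟩
      rintro _ ⟨i, rfl⟩
      exact (p.strictAnti_constr x hx.mem_domain _ (one_lt_level (hρ k) _)).le.trans
        (hx.constr_le i)
    have h1 : p.cost (y k) + ρ k * p.reg (y k) ≤ p.cost x + ρ k * p.reg x :=
      PathConvexProgram.cost_sol_le hfeas
    have h2 := mul_nonneg (hρ k).le (p.reg_nonneg _ (hmem k))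
    linarith
  have hbound : Tendsto (fun k => p.cost x + ρ k * p.reg x) atTop (𝓝 (p.cost x)) := by
    have := (hρ0.mul_const (p.reg x)).const_add (p.cost x)
    simpa using this
  have hev : ∀ᶠ k in atTop, y k ∈ {w | w ∈ p.domain ∧ p.cost w ≤ p.cost x + 1} := by
    filter_upwards [hbound.eventually (gt_mem_nhds (lt_add_one _))] with k hk
    exact ⟨hmem k, (hcost k).trans hk.le⟩
  refine (p.isCompact_sublevel _).tendsto_nhds_of_unique_mapClusterPt hev ?_
  intro w hw hclus
  obtain ⟨φ, hφ, hlim⟩ := hclus.tendsto_subseq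
  refine hx.unique w hw.1 (fun i => ?_) ?_
  · have h1 := ((p.continuous_constr (z i).1).tendsto (w, 1)).comp
      (hlim.prodMk_nhds ((tendsto_level hρ0 (z i).2).comp hφ.tendsto_atTop))
    exact le_of_tendsto' h1 fun k => hcon _ i
  · have hlim' : Tendsto (y ∘ φ) atTop (𝓝[p.domain] w) :=
      tendsto_nhdsWithin_iff.2 ⟨hlim, Eventually.of_forall fun k => hmem _⟩
    exact le_of_tendsto_of_tendsto' ((p.continuousOn_cost w hw.1).tendsto.comp hlim')
      (hbound.comp hφ.tendsto_atTop) fun k => hcost _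

/-- Under vanishing perturbations the probability of violation is lower semicontinuous. -/
theorem eventually_lt_violation (μ : Measure Δ) [IsProbabilityMeasure μ] {x : E} {ρ : ℕ → ℝ}
    (hρ : ∀ k, 0 < ρ k) (hρ0 : Tendsto ρ atTop (𝓝 0)) {y : ℕ → E} (hy : Tendsto y atTop (𝓝 x))
    {ε : ℝ} (hε0 : 0 ≤ ε) (hε : ε < μ.real {a | 0 < p.constr x a 1}) :
    ∀ᶠ k in atTop, ε < (markedLaw μ).real {a | 0 < (p.perturb (ρ k) (hρ k)).constr (y k) a} := by
  set A : ℕ → Set (Δ × ℝ) := fun k => {a | 0 < (p.perturb (ρ k) (hρ k)).constr (y k) a} with hA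
  have hmono : Monotone fun n => ⋂ k, ⋂ _ : n ≤ k, A k := fun m n hmn =>
    iInter_mono fun k => iInter_mono' fun hk => ⟨hmn.trans hk, le_rfl⟩
  have hsub : ({a | 0 < p.constr x a 1} ×ˢ univ : Set (Δ × ℝ)) ⊆ ⋃ n, ⋂ k, ⋂ _ : n ≤ k, A k := by
    rintro ⟨a, u⟩ ⟨ha, -⟩
    have h1 := ((p.continuous_constr a).tendsto (x, 1)).comp
      (hy.prodMk_nhds (tendsto_level hρ0 u))
    obtain ⟨n, hn⟩ := eventually_atTop.1 (h1.eventually (lt_mem_nhds ha))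
    simp only [mem_iUnion, mem_iInter]
    exact ⟨n, hn⟩
  have h1 : ENNReal.ofReal ε < markedLaw μ (⋃ n, ⋂ k, ⋂ _ : n ≤ k, A k) := by
    refine lt_of_lt_of_le ?_ (measure_mono hsub)
    rw [markedLaw, Measure.prod_prod, measure_univ, mul_one]
    exact (ENNReal.ofReal_lt_iff_lt_toReal hε0 (measure_ne_top _ _)).2 hε
  rw [hmono.measure_iUnion] at h1
  obtain ⟨n, hn⟩ := lt_iSup_iff.1 h1
  refine eventually_atTop.2 ⟨n, fun k hk => ?_⟩
  refine (ENNReal.ofReal_lt_iff_lt_toReal hε0 (measure_ne_top _ _)).1 (hn.trans_le ?_)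
  exact measure_mono (iInter₂_subset k hk)

variable (p) in
/-- The scenario bound of Campi and Garatti, without nondegeneracy assumptions, for the samples at
which the solution is unique. The bound is for an outer measure: the event need not be
measurable. -/
theorem measure_violation_le [FiniteDimensional ℝ E] (μ : Measure Δ) [IsProbabilityMeasure μ]
    (hE : 0 < Module.finrank ℝ E) {N : ℕ} (hN : Module.finrank ℝ E ≤ N) {ε : ℝ} (hε0 : 0 ≤ ε)
    (hε1 : ε ≤ 1) :
    (Measure.pi fun _ : Fin N => μ)
      {s | ∃ x, p.IsUniqueSolution s x ∧ ε < μ.real {a | 0 < p.constr x a 1}} ≤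
      ENNReal.ofReal (∑ i ∈ Finset.range (Module.finrank ℝ E),
        (N.choose i : ℝ) * ε ^ i * (1 - ε) ^ (N - i)) := by
  set S := {s : Fin N → Δ |
    ∃ x, p.IsUniqueSolution s x ∧ ε < μ.real {a | 0 < p.constr x a 1}} with hS
  have hρ : ∀ k : ℕ, (0 : ℝ) < 1 / ((k : ℝ) + 1) := fun k => by positivity
  set L : ℕ → Set (Fin N → Δ × ℝ) := fun k => {z | ε < (markedLaw μ).real
    {a | 0 < (p.perturb _ (hρ k)).constr ((p.perturb _ (hρ k)).sol (range z)) a}} with hL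
  have hLle : ∀ k, (Measure.pi fun _ : Fin N => markedLaw μ) (L k) ≤
      ENNReal.ofReal (∑ i ∈ Finset.range (Module.finrank ℝ E),
        (N.choose i : ℝ) * ε ^ i * (1 - ε) ^ (N - i)) := fun k =>
    PathConvexProgram.measure_violation_le (markedLaw μ)
      (fun x hx => markedLaw_constr_eq μ (hρ k) hx) (markedLaw_rank_eq μ) hE hN hε0 hε1
  have hmono : Monotone fun n => ⋂ k, ⋂ _ : n ≤ k, L k := fun m n hmn =>
    iInter_mono fun k => iInter_mono' fun hk => ⟨hmn.trans hk, le_rfl⟩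
  have hsub : {z : Fin N → Δ × ℝ | (fun i => (z i).1) ∈ S} ⊆ ⋃ n, ⋂ k, ⋂ _ : n ≤ k, L k := by
    rintro z ⟨x, hx, hv⟩
    have hlim := tendsto_sol_perturb hx hρ tendsto_one_div_add_atTop_nhds_zero_nat
    obtain ⟨n, hn⟩ := eventually_atTop.1 (eventually_lt_violation μ hρ
      tendsto_one_div_add_atTop_nhds_zero_nat hlim hε0 hv)
    simp only [mem_iUnion, mem_iInter]
    exact ⟨n, hn⟩
  have hpre : (Measure.pi fun _ : Fin N => markedLaw μ) {z | (fun i => (z i).1) ∈ S} =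
      (Measure.pi fun _ : Fin N => μ) S := by
    have h := (measurePreserving_arrowProdEquivProdArrow Δ ℝ (Fin N) (fun _ => μ)
      (fun _ => gaussianReal 0 1)).measure_preimage_equiv (S ×ˢ univ)
    rw [Measure.prod_prod, measure_univ, mul_one] at h
    rw [← h]
    congr 1
    ext z
    simp [MeasurableEquiv.arrowProdEquivProdArrow, Equiv.arrowProdEquivProdArrow]
  rw [← hpre]
  refine (measure_mono hsub).trans ?_
  rw [hmono.measure_iUnion]
  exact iSup_le fun n => (measure_mono (iInter₂_subset n le_rfl)).trans (hLle n)

end ScenarioProgram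

end Scenario

/-! ### Interpolation of contractions between diagonal weights -/

namespace Scenario

open Matrix

/-- The transpose of a weighted contraction is a contraction for the inverse weights, by the
Cauchy-Schwarz inequality. -/
theorem transpose_contraction {m l : Type*} [Fintype m] [Fintype l] (B : Matrix m l ℝ)
    {r : m → ℝ} {c : l → ℝ} (hr : ∀ i, 0 < r i) (hc : ∀ j, 0 < c j)
    (h : ∀ z, ∑ i, r i * (B *ᵥ z) i ^ 2 ≤ ∑ j, c j * z j ^ 2) (p : m → ℝ) :
    ∑ j, (c j)⁻¹ * (Bᵀ *ᵥ p) j ^ 2 ≤ ∑ i, (r i)⁻¹ * p i ^ 2 := by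
  set S := ∑ j, (c j)⁻¹ * (Bᵀ *ᵥ p) j ^ 2 with hS
  set T := ∑ i, (r i)⁻¹ * p i ^ 2 with hT
  set z : l → ℝ := fun j => (c j)⁻¹ * (Bᵀ *ᵥ p) j with hz
  have hS0 : 0 ≤ S := Finset.sum_nonneg fun j _ => mul_nonneg (inv_nonneg.2 (hc j).le) (sq_nonneg _)
  have hT0 : 0 ≤ T := Finset.sum_nonneg fun j _ => mul_nonneg (inv_nonneg.2 (hr j).le) (sq_nonneg _)
  have h1 : ∑ j, c j * z j ^ 2 = S := Finset.sum_congr rfl fun j _ => by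
    have := (hc j).ne'
    simp only [hz]; field_simp
  have h2 : S = ∑ i, p i * (B *ᵥ z) i := by
    have : p ⬝ᵥ B *ᵥ z = (Bᵀ *ᵥ p) ⬝ᵥ z := by
      rw [dotProduct_mulVec, mulVec_transpose]
    calc S = (Bᵀ *ᵥ p) ⬝ᵥ z := Finset.sum_congr rfl fun j _ => by simp only [hz]; ring
      _ = _ := this.symm
  have h3 : S ^ 2 ≤ T * ∑ i, r i * (B *ᵥ z) i ^ 2 := by
    rw [h2]
    refine Finset.sum_sq_le_sum_mul_sum_of_sq_le_mul _
      (fun i _ => mul_nonneg (inv_nonneg.2 (hr i).le) (sq_nonneg _))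
      (fun i _ => mul_nonneg (hr i).le (sq_nonneg _)) fun i _ => ?_
    have := (hr i).ne'
    apply le_of_eq
    field_simp
  have h4 := mul_le_mul_of_nonneg_left ((h z).trans h1.le) hT0
  nlinarith

/-- A matrix that is contractive for two pairs of weights is contractive for their geometric means:
the midpoint case of Stein interpolation between weighted `L²` spaces. -/
theorem interpolate_contraction {m l : Type*} [Fintype m] [Fintype l]
    (B : Matrix m l ℝ) {r₀ r₁ r : m → ℝ} {c₀ c₁ c : l → ℝ} (hr₀ : ∀ i, 0 < r₀ i)
    (hc₀ : ∀ j, 0 < c₀ j) (hc₁ : ∀ j, 0 < c₁ j)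
    (hc : ∀ j, 0 < c j) (hrr : ∀ i, r i ^ 2 = r₀ i * r₁ i) (hcc : ∀ j, c j ^ 2 = c₀ j * c₁ j)
    (h₀ : ∀ z, ∑ i, r₀ i * (B *ᵥ z) i ^ 2 ≤ ∑ j, c₀ j * z j ^ 2)
    (h₁ : ∀ z, ∑ i, r₁ i * (B *ᵥ z) i ^ 2 ≤ ∑ j, c₁ j * z j ^ 2) (z : l → ℝ) :
    ∑ i, r i * (B *ᵥ z) i ^ 2 ≤ ∑ j, c j * z j ^ 2 := by
  classical
  set s : l → ℝ := fun j => (√(c j))⁻¹ with hs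
  have hs0 : ∀ j, 0 < s j := fun j => inv_pos.2 (Real.sqrt_pos.2 (hc j))
  have hsc : ∀ j, c j * s j ^ 2 = 1 := fun j => by
    simp only [hs]
    rw [inv_pow, Real.sq_sqrt (hc j).le, mul_inv_cancel₀ (hc j).ne']
  set D := B * diagonal s with hD
  set H := Dᵀ * diagonal r * D with hH
  have hHherm : (1 - H).IsHermitian := by
    have : Hᵀ = H := by
      simp only [hH, transpose_mul, transpose_transpose, diagonal_transpose, Matrix.mul_assoc]
    rw [IsHermitian, conjTranspose_eq_transpose_of_trivial, transpose_sub, transpose_one, this]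
  -- For an eigenvector of `H` the contraction with weights `r₁`, `c₁` and the transpose of the one
  -- with weights `r₀`, `c₀` together bound the square of the eigenvalue by `1`.
  have hpsd : (1 - H).PosSemidef := by
    rw [hHherm.posSemidef_iff_eigenvalues_nonneg]
    intro k
    set μ := hHherm.eigenvalues k with hμ
    set u : l → ℝ := ⇑(hHherm.eigenvectorBasis k) with hu
    have heig : (1 - H) *ᵥ u = μ • u := hHherm.mulVec_eigenvectorBasis k
    have hu0 : u ≠ 0 := by
      intro h0
      have := hHherm.eigenvectorBasis.orthonormal.ne_zero k
      exact this (by ext j; exact congrFun h0 j)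
    have hHu : H *ᵥ u = (1 - μ) • u := by
      rw [sub_mulVec, one_mulVec] at heig
      rw [sub_smul, one_smul, ← heig, sub_sub_cancel]
    set z : l → ℝ := fun j => s j * u j with hz
    have hDz : D *ᵥ u = B *ᵥ z := by
      rw [hD, ← mulVec_mulVec]
      congr 1
      ext j
      rw [mulVec_diagonal]
    set p : m → ℝ := fun i => r i * (B *ᵥ z) i with hp
    have hBp : ∀ j, (Bᵀ *ᵥ p) j = (1 - μ) * (c j * z j) := by
      intro j
      have h1 : H *ᵥ u = diagonal s *ᵥ (Bᵀ *ᵥ p) := by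
        rw [hH, ← mulVec_mulVec, ← mulVec_mulVec, hDz, hD, transpose_mul, diagonal_transpose,
          ← mulVec_mulVec]
        congr 2
        ext i
        rw [mulVec_diagonal]
      have h2 := congrFun (h1.symm.trans hHu) j
      rw [mulVec_diagonal, Pi.smul_apply, smul_eq_mul] at h2
      refine mul_left_cancel₀ (hs0 j).ne' (h2.trans ?_)
      simp only [hz]
      linear_combination -(1 - μ) * u j * hsc j
    have h1 := transpose_contraction B hr₀ hc₀ h₀ p
    have h2 : ∑ j, (c₀ j)⁻¹ * (Bᵀ *ᵥ p) j ^ 2 = (1 - μ) ^ 2 * ∑ j, c₁ j * z j ^ 2 := by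
      rw [Finset.mul_sum]
      refine Finset.sum_congr rfl fun j _ => ?_
      have := (hc₀ j).ne'
      rw [hBp, mul_pow, mul_pow, hcc]
      field_simp
    have h3 : ∑ i, (r₀ i)⁻¹ * p i ^ 2 = ∑ i, r₁ i * (B *ᵥ z) i ^ 2 := by
      refine Finset.sum_congr rfl fun i _ => ?_
      have := (hr₀ i).ne'
      simp only [hp]
      rw [mul_pow, hrr]
      field_simp
    have hpos : 0 < ∑ j, c₁ j * z j ^ 2 := by
      obtain ⟨j, hj⟩ := Function.ne_iff.1 hu0
      refine Finset.sum_pos' (fun j _ => mul_nonneg (hc₁ j).le (sq_nonneg _))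
        ⟨j, Finset.mem_univ j, mul_pos (hc₁ j) (sq_pos_of_ne_zero ?_)⟩
      exact mul_ne_zero (hs0 j).ne' hj
    have h4 := h₁ z
    rw [h2, h3] at h1
    by_contra hneg
    have hμ0 : μ < 0 := not_le.1 hneg
    nlinarith [mul_pos hpos (neg_pos.2 hμ0),
      mul_pos hpos (mul_pos (neg_pos.2 hμ0) (neg_pos.2 hμ0))]
  have h5 := hpsd.dotProduct_mulVec_nonneg (fun j => √(c j) * z j)
  have hDz : D *ᵥ (fun j => √(c j) * z j) = B *ᵥ z := by
    rw [hD, ← mulVec_mulVec]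
    congr 1
    ext j
    rw [mulVec_diagonal, ← mul_assoc, inv_mul_cancel₀ (Real.sqrt_pos.2 (hc j)).ne', one_mul]
  rw [star_trivial, sub_mulVec, one_mulVec, dotProduct_sub, hH, ← mulVec_mulVec, ← mulVec_mulVec,
    hDz, dotProduct_mulVec, vecMul_transpose, hDz, sub_nonneg] at h5
  calc ∑ i, r i * (B *ᵥ z) i ^ 2 = B *ᵥ z ⬝ᵥ diagonal r *ᵥ B *ᵥ z :=
        Finset.sum_congr rfl fun i _ => by rw [mulVec_diagonal]; ring
    _ ≤ _ := h5
    _ = ∑ j, c j * z j ^ 2 := Finset.sum_congr rfl fun j _ => by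
        have := Real.mul_self_sqrt (hc j).le
        linear_combination z j ^ 2 * this

/-- Weighted contractions may be interpolated at the times `2⁻ᵏ`, by repeatedly taking the midpoint
with the first pair of weights. -/
theorem interpolate_contraction_dyadic {m l : Type*} [Fintype m] [Fintype l] (B : Matrix m l ℝ)
    {r₀ r₁ : m → ℝ} {c₀ c₁ : l → ℝ} (hr₀ : ∀ i, 0 < r₀ i) (hr₁ : ∀ i, 0 < r₁ i)
    (hc₀ : ∀ j, 0 < c₀ j) (hc₁ : ∀ j, 0 < c₁ j)
    (h₀ : ∀ z, ∑ i, r₀ i * (B *ᵥ z) i ^ 2 ≤ ∑ j, c₀ j * z j ^ 2)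
    (h₁ : ∀ z, ∑ i, r₁ i * (B *ᵥ z) i ^ 2 ≤ ∑ j, c₁ j * z j ^ 2) (k : ℕ) (z : l → ℝ) :
    ∑ i, r₀ i ^ (1 - (1 / 2 : ℝ) ^ k) * r₁ i ^ ((1 / 2 : ℝ) ^ k) * (B *ᵥ z) i ^ 2 ≤
      ∑ j, c₀ j ^ (1 - (1 / 2 : ℝ) ^ k) * c₁ j ^ ((1 / 2 : ℝ) ^ k) * z j ^ 2 := by
  have hmid : ∀ {a b : ℝ}, 0 < a → 0 < b → ∀ t : ℝ,
      (a ^ (1 - t * (1 / 2)) * b ^ (t * (1 / 2))) ^ 2 = a * (a ^ (1 - t) * b ^ t) := by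
    intro a b ha hb t
    rw [mul_pow, ← Real.rpow_natCast, ← Real.rpow_natCast, ← Real.rpow_mul ha.le,
      ← Real.rpow_mul hb.le, ← mul_assoc]
    nth_rw 2 [← Real.rpow_one a]
    rw [← Real.rpow_add ha]
    congr 2 <;> push_cast <;> ring
  induction k generalizing z with
  | zero => simpa using h₁ z
  | succ k ih =>
    rw [pow_succ]
    exact interpolate_contraction B hr₀ hc₀
      (fun j => mul_pos (Real.rpow_pos_of_pos (hc₀ j) _) (Real.rpow_pos_of_pos (hc₁ j) _))
      (fun j => mul_pos (Real.rpow_pos_of_pos (hc₀ j) _) (Real.rpow_pos_of_pos (hc₁ j) _))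
      (fun i => hmid (hr₀ i) (hr₁ i) _) (fun j => hmid (hc₀ j) (hc₁ j) _) h₀ ih z

end Scenario

/-! ### Simultaneous diagonalization and log det -/

namespace Scenario

open Matrix

section Diagonalization

variable {ι : Type*} [Fintype ι] [DecidableEq ι]

theorem exists_orthogonal_diagonal {S : Matrix ι ι ℝ} (hS : S.IsHermitian) :
    ∃ U : Matrix ι ι ℝ, U * Uᵀ = 1 ∧ S = U * diagonal hS.eigenvalues * Uᵀ := by
  refine ⟨hS.eigenvectorUnitary, ?_, ?_⟩
  · have := Unitary.coe_mul_star_self hS.eigenvectorUnitary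
    rwa [Unitary.coe_star, star_eq_conjTranspose, conjTranspose_eq_transpose_of_trivial] at this
  · have := hS.spectral_theorem
    rw [Unitary.conjStarAlgAut_apply, star_eq_conjTranspose,
      conjTranspose_eq_transpose_of_trivial] at this
    exact this

/-- Two positive definite matrices are simultaneously diagonalized by a congruence. -/
theorem exists_congruence_diagonal {P Q : Matrix ι ι ℝ} (hP : P.PosDef) (hQ : Q.PosDef) :
    ∃ (M : Matrix ι ι ℝ) (d : ι → ℝ), M.det ≠ 0 ∧ (∀ i, 0 < d i) ∧ P = Mᵀ * M ∧
      Q = Mᵀ * diagonal d * M := by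
  obtain ⟨U, hU, hPU⟩ := exists_orthogonal_diagonal hP.isHermitian
  set B := diagonal (fun i => √(hP.isHermitian.eigenvalues i)) * Uᵀ with hB
  have hPB : P = Bᵀ * B := by
    rw [hB, transpose_mul, transpose_transpose, diagonal_transpose, Matrix.mul_assoc,
      ← Matrix.mul_assoc (diagonal _), diagonal_mul_diagonal, ← Matrix.mul_assoc]
    simp only [Real.mul_self_sqrt (hP.eigenvalues_pos _).le]
    exact hPU
  have hBdet : B.det ≠ 0 := by
    intro h0
    have := hP.det_pos
    rw [hPB, det_mul, h0, mul_zero] at this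
    exact this.false
  have hBu : IsUnit B.det := isUnit_iff_ne_zero.2 hBdet
  have hC : (B⁻¹ᵀ * Q * B⁻¹).PosDef := by
    have := hQ.conjTranspose_mul_mul_same (B := B⁻¹)
      (mulVec_injective_of_isUnit ((isUnit_nonsing_inv_iff).2 ((isUnit_iff_isUnit_det B).2 hBu)))
    rwa [conjTranspose_eq_transpose_of_trivial] at this
  obtain ⟨V, hV, hCV⟩ := exists_orthogonal_diagonal hC.isHermitian
  refine ⟨Vᵀ * B, hC.isHermitian.eigenvalues, ?_, hC.eigenvalues_pos, ?_, ?_⟩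
  · rw [det_mul, det_transpose]
    have := congrArg det hV
    rw [det_mul, det_transpose, det_one] at this
    exact mul_ne_zero (fun h => by simp [h] at this) hBdet
  · rw [transpose_mul, transpose_transpose, Matrix.mul_assoc, ← Matrix.mul_assoc V, hV,
      Matrix.one_mul, hPB]
  · have h1 : (Vᵀ * B)ᵀ * diagonal hC.isHermitian.eigenvalues * (Vᵀ * B) =
        Bᵀ * (V * diagonal hC.isHermitian.eigenvalues * Vᵀ) * B := by
      rw [transpose_mul, transpose_transpose]
      simp only [Matrix.mul_assoc]
    rw [h1, ← hCV, transpose_nonsing_inv]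
    have hBt : IsUnit Bᵀ.det := by rwa [det_transpose]
    rw [Matrix.mul_assoc, Matrix.mul_assoc, Matrix.mul_assoc, nonsing_inv_mul _ hBu,
      ← Matrix.mul_assoc, mul_nonsing_inv _ hBt, Matrix.one_mul, Matrix.mul_one]

theorem posDef_congruence_diagonal {M : Matrix ι ι ℝ} (hM : M.det ≠ 0) {e : ι → ℝ}
    (he : ∀ i, 0 < e i) : (Mᵀ * diagonal e * M).PosDef := by
  have := (PosDef.diagonal he).conjTranspose_mul_mul_same (B := M)
    (mulVec_injective_of_isUnit ((isUnit_iff_isUnit_det M).2 (isUnit_iff_ne_zero.2 hM)))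
  rwa [conjTranspose_eq_transpose_of_trivial] at this

theorem log_det_congruence_diagonal {M : Matrix ι ι ℝ} (hM : M.det ≠ 0) {e : ι → ℝ}
    (he : ∀ i, 0 < e i) :
    Real.log (Mᵀ * diagonal e * M).det = 2 * Real.log M.det + ∑ i, Real.log (e i) := by
  rw [det_mul, det_mul, det_transpose, det_diagonal, mul_right_comm, Real.log_mul
    (mul_ne_zero hM hM) (Finset.prod_ne_zero_iff.2 fun i _ => (he i).ne'), Real.log_mul hM hM,
    Real.log_prod fun i _ => (he i).ne']
  ring

theorem trace_congruence_diagonal (M : Matrix ι ι ℝ) (e : ι → ℝ) :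
    (Mᵀ * diagonal e * M).trace = ∑ i, e i * ∑ j, M i j ^ 2 := by
  rw [Matrix.mul_assoc, trace_mul_comm, Matrix.mul_assoc, trace]
  refine Finset.sum_congr rfl fun i _ => ?_
  rw [diag_apply, diagonal_mul, mul_apply]
  congr 1
  exact Finset.sum_congr rfl fun j _ => by rw [transpose_apply, sq]

theorem sum_row_sq_pos {M : Matrix ι ι ℝ} (hM : M.det ≠ 0) (i : ι) : 0 < ∑ j, M i j ^ 2 := by
  refine lt_of_le_of_ne (Finset.sum_nonneg fun j _ => sq_nonneg _) fun h => hM ?_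
  refine det_eq_zero_of_row_eq_zero i fun j => ?_
  have := (Finset.sum_eq_zero_iff_of_nonneg fun j _ => sq_nonneg (M i j)).1 h.symm j
    (Finset.mem_univ j)
  exact pow_eq_zero_iff two_ne_zero |>.1 this

theorem log_det_concave {P Q : Matrix ι ι ℝ} (hP : P.PosDef) (hQ : Q.PosDef) {a b : ℝ}
    (ha : 0 ≤ a) (hb : 0 ≤ b) (hab : a + b = 1) :
    a * Real.log P.det + b * Real.log Q.det ≤ Real.log (a • P + b • Q).det := by
  obtain ⟨M, d, hM, hd, rfl, rfl⟩ := exists_congruence_diagonal hP hQ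
  have h1 : a • (Mᵀ * M) + b • (Mᵀ * diagonal d * M) =
      Mᵀ * diagonal (fun i => a * 1 + b * d i) * M := by
    have : diagonal (fun i => a * 1 + b * d i) = a • (1 : Matrix ι ι ℝ) + b • diagonal d := by
      ext i j; by_cases h : i = j <;> simp [h]
    rw [this, Matrix.mul_add, Matrix.add_mul]
    simp
  have h2 : Mᵀ * M = Mᵀ * diagonal (fun _ => 1) * M := by simp
  have hpos : ∀ i, 0 < a * 1 + b * d i := fun i => by
    have := hd i
    rcases ha.eq_or_lt with rfl | ha
    · nlinarith
    · nlinarith [mul_nonneg hb this.le]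
  rw [h1, h2, log_det_congruence_diagonal hM fun _ => one_pos, log_det_congruence_diagonal hM hd,
    log_det_congruence_diagonal hM hpos]
  have h3 : b * ∑ i, Real.log (d i) ≤ ∑ i, Real.log (a * 1 + b * d i) := by
    rw [Finset.mul_sum]
    refine Finset.sum_le_sum fun i _ => ?_
    have := strictConcaveOn_log_Ioi.concaveOn.2 (Set.mem_Ioi.2 one_pos)
      (Set.mem_Ioi.2 (hd i)) ha hb hab
    simpa using this
  simp only [Real.log_one, Finset.sum_const_zero]
  linear_combination h3 + (2 * Real.log M.det) * hab

theorem log_det_midpoint_lt {P Q : Matrix ι ι ℝ} (hP : P.PosDef) (hQ : Q.PosDef) (hne : P ≠ Q) :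
    (Real.log P.det + Real.log Q.det) / 2 <
      Real.log ((1 / 2 : ℝ) • P + (1 / 2 : ℝ) • Q).det := by
  obtain ⟨M, d, hM, hd, rfl, rfl⟩ := exists_congruence_diagonal hP hQ
  have h1 : (1 / 2 : ℝ) • (Mᵀ * M) + (1 / 2 : ℝ) • (Mᵀ * diagonal d * M) =
      Mᵀ * diagonal (fun i => (1 / 2) * 1 + (1 / 2) * d i) * M := by
    have : diagonal (fun i => (1 / 2) * 1 + (1 / 2) * d i) =
        (1 / 2 : ℝ) • (1 : Matrix ι ι ℝ) + (1 / 2 : ℝ) • diagonal d := by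
      ext i j; by_cases h : i = j <;> simp [h]
    rw [this, Matrix.mul_add, Matrix.add_mul]
    simp
  have h2 : Mᵀ * M = Mᵀ * diagonal (fun _ => 1) * M := by simp
  have hpos : ∀ i, 0 < (1 / 2) * 1 + (1 / 2) * d i := fun i => by have := hd i; linarith
  obtain ⟨i₀, hi₀⟩ : ∃ i, d i ≠ 1 := by
    by_contra! h
    exact hne (by rw [h2, show d = fun _ => 1 from funext h])
  rw [h1, h2, log_det_congruence_diagonal hM fun _ => one_pos, log_det_congruence_diagonal hM hd,
    log_det_congruence_diagonal hM hpos]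
  have h3 : (1 / 2) * ∑ i, Real.log (d i) < ∑ i, Real.log ((1 / 2) * 1 + (1 / 2) * d i) := by
    rw [Finset.mul_sum]
    refine Finset.sum_lt_sum (fun i _ => ?_) ⟨i₀, Finset.mem_univ _, ?_⟩
    · have := strictConcaveOn_log_Ioi.concaveOn.2 (Set.mem_Ioi.2 one_pos) (Set.mem_Ioi.2 (hd i))
        (by norm_num : (0 : ℝ) ≤ 1 / 2) (by norm_num : (0 : ℝ) ≤ 1 / 2) (by norm_num)
      simpa using this
    · have := strictConcaveOn_log_Ioi.2 (Set.mem_Ioi.2 one_pos) (Set.mem_Ioi.2 (hd i₀))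
        (Ne.symm hi₀) (by norm_num : (0 : ℝ) < 1 / 2) (by norm_num : (0 : ℝ) < 1 / 2) (by norm_num)
      simpa using this
  simp only [Real.log_one, Finset.sum_const_zero]
  linarith

end Diagonalization

end Scenario

/-! ### The matrix inequality as a domination of quadratic forms -/

namespace Scenario

open Matrix

variable {n : ℕ}

/-- The quadratic form `xᵀ P x`. -/
def quad (P : Matrix (Fin n) (Fin n) ℝ) (x : Fin n → ℝ) : ℝ := x ⬝ᵥ P *ᵥ x

/-- The quadratic form `(A x + s w)ᵀ P (A x + s w)` in `y = (x, s)`. -/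
def num (A : Matrix (Fin n) (Fin n) ℝ) (w : Fin n → ℝ) (P : Matrix (Fin n) (Fin n) ℝ)
    (y : Fin n ⊕ Unit → ℝ) : ℝ :=
  quad P (A *ᵥ (fun i => y (Sum.inl i)) + y (Sum.inr ()) • w)

/-- The quadratic form `τ xᵀ P x + (1 - τ) s ^ 2` in `y = (x, s)`. The matrix inequality of the
scenario program says that it dominates `num`. -/
def den (P : Matrix (Fin n) (Fin n) ℝ) (τ : ℝ) (y : Fin n ⊕ Unit → ℝ) : ℝ :=
  τ * quad P (fun i => y (Sum.inl i)) + (1 - τ) * y (Sum.inr ()) ^ 2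

theorem quad_smul (P : Matrix (Fin n) (Fin n) ℝ) (r : ℝ) (x : Fin n → ℝ) :
    quad P (r • x) = r ^ 2 * quad P x := by
  simp only [quad, mulVec_smul, smul_dotProduct, dotProduct_smul, smul_eq_mul]
  ring

theorem num_smul (A : Matrix (Fin n) (Fin n) ℝ) (w : Fin n → ℝ) (P : Matrix (Fin n) (Fin n) ℝ)
    (r : ℝ) (y : Fin n ⊕ Unit → ℝ) : num A w P (r • y) = r ^ 2 * num A w P y := by
  rw [num, num, ← quad_smul, smul_add, ← mulVec_smul, smul_smul]
  rfl

theorem den_smul (P : Matrix (Fin n) (Fin n) ℝ) (τ r : ℝ) (y : Fin n ⊕ Unit → ℝ) :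
    den P τ (r • y) = r ^ 2 * den P τ y := by
  have : (fun i => (r • y) (Sum.inl i)) = r • fun i => y (Sum.inl i) := rfl
  rw [den, den, this, quad_smul, Pi.smul_apply, smul_eq_mul]
  ring

theorem quad_pos {P : Matrix (Fin n) (Fin n) ℝ} (hP : P.PosDef) {x : Fin n → ℝ} (hx : x ≠ 0) :
    0 < quad P x := by
  simpa [quad] using hP.dotProduct_mulVec_pos hx

theorem quad_nonneg {P : Matrix (Fin n) (Fin n) ℝ} (hP : P.PosSemidef) (x : Fin n → ℝ) :
    0 ≤ quad P x := by
  simpa [quad] using hP.dotProduct_mulVec_nonneg x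

theorem den_pos {P : Matrix (Fin n) (Fin n) ℝ} (hP : P.PosDef) {τ : ℝ} (h0 : 0 < τ) (h1 : τ < 1)
    {y : Fin n ⊕ Unit → ℝ} (hy : y ≠ 0) : 0 < den P τ y := by
  have hq := quad_nonneg hP.posSemidef fun i => y (Sum.inl i)
  by_cases hs : y (Sum.inr ()) = 0
  · have hx : (fun i => y (Sum.inl i)) ≠ 0 := by
      intro h
      apply hy
      ext (i | ⟨⟩)
      · exact congrFun h i
      · exact hs
    have := mul_pos h0 (quad_pos hP hx)
    rw [den, hs]
    linarith
  · have h2 : 0 < (1 - τ) * y (Sum.inr ()) ^ 2 :=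
      mul_pos (by linarith) (sq_pos_of_ne_zero hs)
    have := mul_nonneg h0.le hq
    rw [den]
    linarith

theorem quad_congruence_diagonal (M : Matrix (Fin n) (Fin n) ℝ) (e : Fin n → ℝ) (x : Fin n → ℝ) :
    quad (Mᵀ * diagonal e * M) x = ∑ i, e i * (M *ᵥ x) i ^ 2 := by
  rw [quad, ← mulVec_mulVec, ← mulVec_mulVec, dotProduct_mulVec, vecMul_transpose]
  exact Finset.sum_congr rfl fun i _ => by rw [mulVec_diagonal]; ring

section Path

variable (A : Matrix (Fin n) (Fin n) ℝ) (w : Fin n → ℝ) {M : Matrix (Fin n) (Fin n) ℝ}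
  {d : Fin n → ℝ}

/-- In the coordinates `z = (M x, s)` the form `num` is a weighted sum of squares of the coordinates
of `[M A M⁻¹, M w] z`. -/
theorem num_congruence_diagonal (e : Fin n → ℝ) (z : Fin n ⊕ Unit → ℝ) :
    num A w (Mᵀ * diagonal e * M)
      (Sum.elim (M⁻¹ *ᵥ fun i => z (Sum.inl i)) fun _ => z (Sum.inr ())) =
    ∑ i, e i * (fromCols (M * A * M⁻¹) (replicateCol Unit (M *ᵥ w)) *ᵥ z) i ^ 2 := by
  rw [num, quad_congruence_diagonal]
  refine Finset.sum_congr rfl fun i _ => ?_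
  congr 2
  rw [fromCols_mulVec]
  simp only [Sum.elim_inl, Sum.elim_inr, mulVec_add, mulVec_mulVec, mulVec_smul, Pi.add_apply,
    Pi.smul_apply, smul_eq_mul, Matrix.mul_assoc]
  congr 1
  simp [mulVec, dotProduct, mul_comm]

theorem den_congruence_diagonal (hM : M.det ≠ 0) (e : Fin n → ℝ) (τ : ℝ) (z : Fin n ⊕ Unit → ℝ) :
    den (Mᵀ * diagonal e * M) τ
      (Sum.elim (M⁻¹ *ᵥ fun i => z (Sum.inl i)) fun _ => z (Sum.inr ())) =
    τ * ∑ i, e i * z (Sum.inl i) ^ 2 + (1 - τ) * z (Sum.inr ()) ^ 2 := by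
  rw [den, quad_congruence_diagonal]
  simp only [Sum.elim_inl, Sum.elim_inr, mulVec_mulVec,
    mul_nonsing_inv _ (isUnit_iff_ne_zero.2 hM), one_mulVec]

/-- Dyadic interpolation of the matrix inequality at levels `l₀` and `l₁` between the pairs
`(Mᵀ M, τ₀)` and `(Mᵀ diag(d) M, τ₁)`. -/
theorem num_le_interpolate (hM : M.det ≠ 0) (hd : ∀ i, 0 < d i) {τ₀ τ₁ l₀ l₁ : ℝ} (hτ₀ : 0 < τ₀)
    (hτ₀' : τ₀ < 1) (hτ₁ : 0 < τ₁) (hτ₁' : τ₁ < 1) (hl₀ : 0 < l₀) (hl₁ : 0 < l₁)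
    (h₀ : ∀ y, num A w (Mᵀ * M) y ≤ l₀ * den (Mᵀ * M) τ₀ y)
    (h₁ : ∀ y, num A w (Mᵀ * diagonal d * M) y ≤ l₁ * den (Mᵀ * diagonal d * M) τ₁ y)
    (k : ℕ) {t : ℝ} (ht : t = (1 / 2) ^ k) (y : Fin n ⊕ Unit → ℝ) :
    num A w (Mᵀ * diagonal (fun i => d i ^ t) * M) y ≤ l₀ ^ (1 - t) * l₁ ^ t *
      (τ₀ ^ (1 - t) * τ₁ ^ t *
          quad (Mᵀ * diagonal (fun i => d i ^ t) * M) (fun i => y (Sum.inl i)) +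
        (1 - τ₀) ^ (1 - t) * (1 - τ₁) ^ t * y (Sum.inr ()) ^ 2) := by
  have hM0 : Mᵀ * M = Mᵀ * diagonal (fun _ => 1) * M := by simp
  rw [hM0] at h₀
  set B := fromCols (M * A * M⁻¹) (replicateCol Unit (M *ᵥ w)) with hB
  have key := interpolate_contraction_dyadic B (r₀ := fun _ => 1) (r₁ := d)
    (c₀ := Sum.elim (fun _ => l₀ * τ₀) fun _ => l₀ * (1 - τ₀))
    (c₁ := Sum.elim (fun i => l₁ * (τ₁ * d i)) fun _ => l₁ * (1 - τ₁))
    (fun _ => one_pos) hd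
    (by rintro (i | i); exacts [mul_pos hl₀ hτ₀, mul_pos hl₀ (by linarith)])
    (by rintro (i | i); exacts [mul_pos hl₁ (mul_pos hτ₁ (hd i)), mul_pos hl₁ (by linarith)])
    (fun z => by
      rw [hB, ← num_congruence_diagonal A w]
      refine (h₀ _).trans (le_of_eq ?_)
      rw [den_congruence_diagonal hM]
      simp only [Fintype.sum_sum_type, Sum.elim_inl, Sum.elim_inr, Finset.univ_unique,
        Finset.sum_singleton, one_mul, mul_add, Finset.mul_sum, mul_assoc])
    (fun z => by
      rw [hB, ← num_congruence_diagonal A w]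
      refine (h₁ _).trans (le_of_eq ?_)
      rw [den_congruence_diagonal hM]
      simp only [Fintype.sum_sum_type, Sum.elim_inl, Sum.elim_inr, Finset.univ_unique,
        Finset.sum_singleton, mul_add, Finset.mul_sum, mul_assoc])
    k (Sum.elim (M *ᵥ fun i => y (Sum.inl i)) fun _ => y (Sum.inr ()))
  rw [← ht] at key
  simp only [Real.one_rpow, one_mul] at key
  rw [hB, ← num_congruence_diagonal A w (fun i => d i ^ t)] at key
  have hy : (Sum.elim (M⁻¹ *ᵥ fun i => (Sum.elim (M *ᵥ fun i => y (Sum.inl i))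
      (fun _ => y (Sum.inr ())) : Fin n ⊕ Unit → ℝ) (Sum.inl i))
      (fun _ => (Sum.elim (M *ᵥ fun i => y (Sum.inl i)) (fun _ => y (Sum.inr ())) :
        Fin n ⊕ Unit → ℝ) (Sum.inr ())) : Fin n ⊕ Unit → ℝ) = y := by
    ext (i | i)
    · simp only [Sum.elim_inl, mulVec_mulVec, nonsing_inv_mul _ (isUnit_iff_ne_zero.2 hM),
        one_mulVec]
    · rfl
  rw [hy] at key
  refine key.trans (le_of_eq ?_)
  rw [quad_congruence_diagonal]
  have h1 : (0 : ℝ) ≤ 1 - τ₀ := by linarith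
  have h2 : (0 : ℝ) ≤ 1 - τ₁ := by linarith
  simp only [Fintype.sum_sum_type, Sum.elim_inl, Sum.elim_inr, Finset.univ_unique,
    Finset.sum_singleton, mul_add, Finset.mul_sum]
  congr 1
  · refine Finset.sum_congr rfl fun i _ => ?_
    rw [Real.mul_rpow hl₀.le hτ₀.le, Real.mul_rpow hl₁.le (mul_pos hτ₁ (hd i)).le,
      Real.mul_rpow hτ₁.le (hd i).le]
    ring
  · rw [Real.mul_rpow hl₀.le h1, Real.mul_rpow hl₁.le h2]
    ring

theorem geom_add_geom_le_one {τ₀ τ₁ t : ℝ} (hτ₀ : 0 < τ₀) (hτ₀' : τ₀ < 1) (hτ₁ : 0 < τ₁)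
    (hτ₁' : τ₁ < 1) (ht0 : 0 ≤ t) (ht1 : t ≤ 1) :
    (1 - τ₀) ^ (1 - t) * (1 - τ₁) ^ t ≤ 1 - τ₀ ^ (1 - t) * τ₁ ^ t := by
  have h1 := Real.geom_mean_le_arith_mean2_weighted (sub_nonneg.2 ht1) ht0 hτ₀.le hτ₁.le (by ring)
  have h2 := Real.geom_mean_le_arith_mean2_weighted (sub_nonneg.2 ht1) ht0
    (sub_nonneg.2 hτ₀'.le) (sub_nonneg.2 hτ₁'.le) (by ring)
  linarith

/-- The matrix inequality persists along the path on which `P`, `τ` and the level are interpolated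
geometrically. -/
theorem num_le_den_path (hM : M.det ≠ 0) (hd : ∀ i, 0 < d i) {τ₀ τ₁ l₀ l₁ : ℝ} (hτ₀ : 0 < τ₀)
    (hτ₀' : τ₀ < 1) (hτ₁ : 0 < τ₁) (hτ₁' : τ₁ < 1) (hl₀ : 0 < l₀) (hl₁ : 0 < l₁)
    (h₀ : ∀ y, num A w (Mᵀ * M) y ≤ l₀ * den (Mᵀ * M) τ₀ y)
    (h₁ : ∀ y, num A w (Mᵀ * diagonal d * M) y ≤ l₁ * den (Mᵀ * diagonal d * M) τ₁ y)
    (k : ℕ) {t : ℝ} (ht : t = (1 / 2) ^ k) (y : Fin n ⊕ Unit → ℝ) :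
    num A w (Mᵀ * diagonal (fun i => d i ^ t) * M) y ≤ l₀ ^ (1 - t) * l₁ ^ t *
      den (Mᵀ * diagonal (fun i => d i ^ t) * M) (τ₀ ^ (1 - t) * τ₁ ^ t) y := by
  refine (num_le_interpolate A w hM hd hτ₀ hτ₀' hτ₁ hτ₁' hl₀ hl₁ h₀ h₁ k ht y).trans ?_
  refine mul_le_mul_of_nonneg_left ?_
    (mul_nonneg (Real.rpow_nonneg hl₀.le _) (Real.rpow_nonneg hl₁.le _))
  rw [den]
  gcongr
  refine geom_add_geom_le_one hτ₀ hτ₀' hτ₁ hτ₁' (ht ▸ by positivity) (ht ▸ ?_)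
  exact pow_le_one₀ (by norm_num) (by norm_num)

end Path

end Scenario

/-! ### The matrix inequality as a real-valued constraint -/

namespace Scenario

open Matrix Filter Topology

variable {n : ℕ}

/-- The space of decisions `(P, τ)` with `P` symmetric. The entries of `P` are indexed by unordered
pairs, so that the dimension is `n (n + 1) / 2 + 1`. -/
abbrev Decision (n : ℕ) := EuclideanSpace ℝ (Sym2 (Fin n) ⊕ Unit)

theorem finrank_decision (n : ℕ) :
    Module.finrank ℝ (Decision n) = ScenarioRPI.numVars n := by
  rw [finrank_euclideanSpace, Fintype.card_sum, Sym2.card, Fintype.card_fin, Fintype.card_unit,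
    ScenarioRPI.numVars, Nat.choose_two_right]
  congr 2
  rw [Nat.add_sub_cancel]
  ring

namespace Decision

/-- The matrix component of a decision. -/
def mat (v : Decision n) : Matrix (Fin n) (Fin n) ℝ := of fun i j => v (Sum.inl s(i, j))

/-- The scalar component of a decision. -/
def tau (v : Decision n) : ℝ := v (Sum.inr ())

/-- The decision with the given components; the matrix is symmetrized. -/
noncomputable def mk (P : Matrix (Fin n) (Fin n) ℝ) (τ : ℝ) : Decision n :=
  WithLp.toLp 2 (Sum.elim
    (Sym2.lift ⟨fun i j => (P i j + P j i) / 2, fun _ _ => congrArg (· / 2) (add_comm _ _)⟩)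
    fun _ => τ)

theorem mat_mk {P : Matrix (Fin n) (Fin n) ℝ} (hP : Pᵀ = P) (τ : ℝ) : mat (mk P τ) = P := by
  ext i j
  have : P j i = P i j := congrFun (congrFun hP i) j
  simp [mat, mk, this]

theorem tau_mk (P : Matrix (Fin n) (Fin n) ℝ) (τ : ℝ) : tau (mk P τ) = τ := rfl

theorem ext_mat_tau {v v' : Decision n} (h1 : mat v = mat v') (h2 : tau v = tau v') : v = v' := by
  ext (s | u)
  · induction s with
    | h i j => exact congrFun (congrFun h1 i) j
  · exact h2

theorem mat_transpose (v : Decision n) : (mat v)ᵀ = mat v := by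
  ext i j
  simp [mat, Sym2.eq_swap]

theorem mat_combo (a b : ℝ) (v v' : Decision n) :
    mat (a • v + b • v') = a • mat v + b • mat v' := by
  ext i j
  simp [mat]

theorem tau_combo (a b : ℝ) (v v' : Decision n) :
    tau (a • v + b • v') = a * tau v + b * tau v' := by
  simp [tau]

@[fun_prop]
theorem continuous_mat : Continuous (mat : Decision n → _) := by
  refine continuous_matrix fun i j => ?_
  simp only [mat, of_apply]
  fun_prop

@[fun_prop]
theorem continuous_tau : Continuous (tau : Decision n → ℝ) := by
  unfold tau
  fun_prop

end Decision

open Decision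

@[fun_prop]
theorem continuous_quad {α : Type*} [TopologicalSpace α] {P : α → Matrix (Fin n) (Fin n) ℝ}
    {x : α → Fin n → ℝ} (hP : Continuous P) (hx : Continuous x) :
    Continuous fun a => quad (P a) (x a) := by
  unfold quad
  exact hx.dotProduct (hP.matrix_mulVec hx)

/-- The amount by which a multiple of `den` fails to dominate `num`, as a quadratic form. -/
def gapForm (A : Matrix (Fin n) (Fin n) ℝ) (v : Decision n) (w : Fin n → ℝ) (l : ℝ)
    (y : Fin n ⊕ Unit → ℝ) : ℝ :=
  num A w (mat v) y - l * den (mat v) (tau v) y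

/-- The supremum of the form `gapForm` over a sphere: a real-valued constraint that is
nonpositive exactly when the matrix inequality holds at level `l`. The sphere is that of the
sup norm; any compact set without the origin that meets every line through it
would do. -/
noncomputable def gap (A : Matrix (Fin n) (Fin n) ℝ) (v : Decision n) (w : Fin n → ℝ) (l : ℝ) :
    ℝ :=
  sSup (gapForm A v w l '' Metric.sphere 0 1)

theorem continuous_gapForm (A : Matrix (Fin n) (Fin n) ℝ) :
    Continuous fun q : (Decision n × (Fin n → ℝ) × ℝ) × (Fin n ⊕ Unit → ℝ) =>
      gapForm A q.1.1 q.1.2.1 q.1.2.2 q.2 := by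
  have h1 : Continuous fun q : (Decision n × (Fin n → ℝ) × ℝ) × (Fin n ⊕ Unit → ℝ) =>
      (fun i => q.2 (Sum.inl i) : Fin n → ℝ) := by fun_prop
  have h2 : Continuous fun q : (Decision n × (Fin n → ℝ) × ℝ) × (Fin n ⊕ Unit → ℝ) =>
      A *ᵥ (fun i => q.2 (Sum.inl i) : Fin n → ℝ) := continuous_const.matrix_mulVec h1
  unfold gapForm num den
  fun_prop

theorem isCompact_ySphere : IsCompact (Metric.sphere (0 : Fin n ⊕ Unit → ℝ) 1) :=
  isCompact_sphere 0 1

theorem ySphere_nonempty : (Metric.sphere (0 : Fin n ⊕ Unit → ℝ) 1).Nonempty :=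
  ⟨fun _ => 1, by rw [mem_sphere_zero_iff_norm, pi_norm_const, norm_one]⟩

theorem ne_zero_of_mem_ySphere {y : Fin n ⊕ Unit → ℝ} (hy : y ∈ Metric.sphere 0 1) : y ≠ 0 :=
  ne_zero_of_mem_sphere one_ne_zero ⟨y, hy⟩

theorem continuous_gap (A : Matrix (Fin n) (Fin n) ℝ) :
    Continuous fun q : Decision n × (Fin n → ℝ) × ℝ => gap A q.1 q.2.1 q.2.2 :=
  isCompact_ySphere.continuous_sSup (f := fun q : Decision n × (Fin n → ℝ) × ℝ =>
    gapForm A q.1 q.2.1 q.2.2) (continuous_gapForm A)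

variable (A : Matrix (Fin n) (Fin n) ℝ)

theorem continuous_gapForm_apply (v : Decision n) (w : Fin n → ℝ) (l : ℝ) :
    Continuous (gapForm A v w l) :=
  Continuous.comp (g := fun q : (Decision n × (Fin n → ℝ) × ℝ) × (Fin n ⊕ Unit → ℝ) =>
    gapForm A q.1.1 q.1.2.1 q.1.2.2 q.2) (f := fun y => ((v, w, l), y))
    (continuous_gapForm A) (continuous_const.prodMk continuous_id)

theorem gapForm_le_gap (v : Decision n) (w : Fin n → ℝ) (l : ℝ) {y : Fin n ⊕ Unit → ℝ}
    (hy : y ∈ Metric.sphere 0 1) : gapForm A v w l y ≤ gap A v w l :=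
  le_csSup (isCompact_ySphere.image (continuous_gapForm_apply A v w l)).bddAbove
    (Set.mem_image_of_mem _ hy)

theorem exists_gap_eq (v : Decision n) (w : Fin n → ℝ) (l : ℝ) :
    ∃ y ∈ Metric.sphere 0 1, gap A v w l = gapForm A v w l y :=
  isCompact_ySphere.exists_sSup_image_eq ySphere_nonempty
    (continuous_gapForm_apply A v w l).continuousOn

theorem gapForm_smul (v : Decision n) (w : Fin n → ℝ) (l r : ℝ) (y : Fin n ⊕ Unit → ℝ) :
    gapForm A v w l (r • y) = r ^ 2 * gapForm A v w l y := by
  rw [gapForm, gapForm, num_smul, den_smul]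
  ring

theorem gapForm_nonpos {v : Decision n} {w : Fin n → ℝ} {l : ℝ}
    (h : ∀ y ∈ Metric.sphere 0 1, gapForm A v w l y ≤ 0) (y : Fin n ⊕ Unit → ℝ) :
    gapForm A v w l y ≤ 0 := by
  by_cases hy : y = 0
  · have := gapForm_smul A v w l 0 y
    rw [zero_smul, zero_pow two_ne_zero, zero_mul] at this
    rw [hy, this]
  · have hn : ‖y‖ ≠ 0 := norm_ne_zero_iff.2 hy
    have := gapForm_smul A v w l ‖y‖ (‖y‖⁻¹ • y)
    rw [smul_inv_smul₀ hn] at this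
    rw [this]
    refine mul_nonpos_of_nonneg_of_nonpos (sq_nonneg _) (h _ ?_)
    simp [norm_smul, hn]

theorem gap_nonpos_iff {v : Decision n} {w : Fin n → ℝ} {l : ℝ} :
    gap A v w l ≤ 0 ↔ ∀ y, num A w (mat v) y ≤ l * den (mat v) (tau v) y := by
  constructor
  · intro h y
    exact sub_nonpos.1 (gapForm_nonpos A (fun y hy => (gapForm_le_gap A v w l hy).trans h) y)
  · intro h
    obtain ⟨y, -, hy⟩ := exists_gap_eq A v w l
    rw [hy]
    exact sub_nonpos.2 (h y)

/-- The decisions with `P` positive definite and `0 < τ < 1`. -/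
def domain (n : ℕ) : Set (Decision n) := {v | (mat v).PosDef ∧ 0 < tau v ∧ tau v < 1}

theorem strictAnti_gap {v : Decision n} (hv : v ∈ domain n) (w : Fin n → ℝ) :
    StrictAnti (gap A v w) := by
  intro l l' hl
  obtain ⟨y, hy, h⟩ := exists_gap_eq A v w l'
  rw [h]
  refine lt_of_lt_of_le ?_ (gapForm_le_gap A v w l hy)
  have := den_pos hv.1 hv.2.1 hv.2.2 (ne_zero_of_mem_ySphere hy)
  rw [gapForm, gapForm]
  nlinarith

theorem continuous_den (P : Matrix (Fin n) (Fin n) ℝ) (τ : ℝ) : Continuous (den P τ) := by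
  unfold den
  fun_prop

/-- A strict inequality at level `l` persists at some smaller positive level. -/
theorem exists_level_lt {v : Decision n} {w : Fin n → ℝ} {l : ℝ} (hl : 0 < l)
    (h : gap A v w l < 0) : ∃ l', 0 < l' ∧ l' < l ∧
      ∀ y, num A w (mat v) y ≤ l' * den (mat v) (tau v) y := by
  have hc : Continuous fun l => gap A v w l :=
    Continuous.comp (g := fun q : Decision n × (Fin n → ℝ) × ℝ => gap A q.1 q.2.1 q.2.2)
      (f := fun l => (v, w, l)) (continuous_gap A)
      (continuous_const.prodMk (continuous_const.prodMk continuous_id))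
  have hev := (hc.tendsto l).eventually (gt_mem_nhds h)
  have h1 : ∀ᶠ l' in 𝓝[<] l, gap A v w l' < 0 := nhdsWithin_le_nhds hev
  have h2 : ∀ᶠ l' in 𝓝[<] l, 0 < l' := nhdsWithin_le_nhds (lt_mem_nhds hl)
  obtain ⟨l', ⟨h3, h4⟩, h5⟩ := ((h1.and h2).and self_mem_nhdsWithin).exists
  exact ⟨l', h4, h5, (gap_nonpos_iff A).1 h3.le⟩

/-- Near a decision of the domain `den` is bounded below on the sphere, uniformly. -/
theorem exists_den_lower_bound {v : Decision n} (hv : v ∈ domain n) :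
    ∃ m > 0, ∀ᶠ v' in 𝓝 v, ∀ y ∈ Metric.sphere 0 1, m ≤ den (mat v') (tau v') y := by
  have hcont : Continuous fun q : Decision n × (Fin n ⊕ Unit → ℝ) =>
      den (mat q.1) (tau q.1) q.2 := by
    have h1 : Continuous fun q : Decision n × (Fin n ⊕ Unit → ℝ) =>
      (fun i => q.2 (Sum.inl i) : Fin n → ℝ) := by fun_prop
    unfold den
    fun_prop
  have hinf : Continuous fun v' : Decision n =>
      sInf (den (mat v') (tau v') '' Metric.sphere 0 1) :=
    isCompact_ySphere.continuous_sInf (f := fun v' : Decision n => den (mat v') (tau v')) hcont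
  have hle : ∀ v' : Decision n, ∀ y ∈ Metric.sphere 0 1,
      sInf (den (mat v') (tau v') '' Metric.sphere 0 1) ≤ den (mat v') (tau v') y := fun v' y hy =>
    csInf_le (isCompact_ySphere.image (continuous_den _ _)).bddBelow (Set.mem_image_of_mem _ hy)
  obtain ⟨y, hy, hyeq⟩ := isCompact_ySphere.exists_sInf_image_eq ySphere_nonempty
    (continuous_den (mat v) (tau v)).continuousOn
  have hpos : 0 < sInf (den (mat v) (tau v) '' Metric.sphere 0 1) := by
    rw [hyeq]
    exact den_pos hv.1 hv.2.1 hv.2.2 (ne_zero_of_mem_ySphere hy)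
  refine ⟨_, half_pos hpos, ?_⟩
  filter_upwards [(hinf.tendsto v).eventually (lt_mem_nhds (half_lt_self hpos))] with v' hv' y hy
  exact hv'.le.trans (hle v' y hy)

/-- The constraint becomes convex upon adding a multiple of the squared norm: its only nonconvex
part is the product of `τ` and a linear function of `P`. -/
theorem weaklyConvex_gap (w : Fin n → ℝ) (l : ℝ) :
    ∃ C ≥ 0, ConvexOn ℝ Set.univ fun v : Decision n => gap A v w l + C * ‖v‖ ^ 2 := by
  have hquad : ∀ (a b : ℝ) (P Q : Matrix (Fin n) (Fin n) ℝ) (x : Fin n → ℝ),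
      quad (a • P + b • Q) x = a * quad P x + b * quad Q x := fun a b P Q x => by
    simp [quad, add_mulVec, smul_mulVec, dotProduct_add, dotProduct_smul]
  have hcoord : ∀ (v : Decision n) i, |v i| ≤ ‖v‖ := fun v i => by
    simpa using PiLp.norm_apply_le v i
  have hbound : ∀ (v : Decision n), ∀ y ∈ Metric.sphere (0 : Fin n ⊕ Unit → ℝ) 1,
      |quad (mat v) (fun i => y (Sum.inl i))| ≤ n * n * ‖v‖ := by
    intro v y hy
    have hy1 : ∀ j, |y j| ≤ 1 := fun j => by
      have := norm_le_pi_norm y j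
      rw [mem_sphere_zero_iff_norm.1 hy] at this
      exact this
    rw [quad, dotProduct]
    simp only [mulVec, dotProduct, Finset.mul_sum]
    refine (Finset.abs_sum_le_sum_abs _ _).trans ?_
    refine (Finset.sum_le_sum fun i _ => (Finset.abs_sum_le_sum_abs _ _).trans
      (Finset.sum_le_sum (g := fun _ => ‖v‖) fun j _ => ?_)).trans (le_of_eq (by simp [mul_assoc]))
    rw [abs_mul, abs_mul]
    calc _ ≤ 1 * (‖v‖ * 1) := by
          gcongr
          · exact hy1 _
          · exact hcoord v _
          · exact hy1 _
      _ = ‖v‖ := by ring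
  refine ⟨|l| * (n * n), by positivity, convex_univ, fun v _ v' _ a b ha hb hab => ?_⟩
  obtain ⟨y, hy, heq⟩ := exists_gap_eq A (a • v + b • v') w l
  have h1 := gapForm_le_gap A v w l hy
  have h2 := gapForm_le_gap A v' w l hy
  set q := quad (mat v) (fun i => y (Sum.inl i)) with hq
  set q' := quad (mat v') (fun i => y (Sum.inl i)) with hq'
  have hnorm : ‖a • v + b • v'‖ ^ 2 = a * ‖v‖ ^ 2 + b * ‖v'‖ ^ 2 - a * b * ‖v - v'‖ ^ 2 := by
    rw [norm_add_sq_real, norm_sub_sq_real, norm_smul, norm_smul, inner_smul_left, inner_smul_right,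
      Real.norm_of_nonneg ha, Real.norm_of_nonneg hb]
    simp only [RCLike.conj_to_real]
    obtain rfl : b = 1 - a := by linarith
    ring
  -- The only term that is not affine is bilinear in `τ` and `q`.
  have hform : gapForm A (a • v + b • v') w l y = a * gapForm A v w l y + b * gapForm A v' w l y +
      a * b * (l * ((tau v - tau v') * (q - q'))) := by
    simp only [gapForm, num, den, mat_combo, tau_combo, hquad, ← hq, ← hq']
    obtain rfl : b = 1 - a := by linarith
    ring
  have hprod : l * ((tau v - tau v') * (q - q')) ≤ |l| * (n * n) * ‖v - v'‖ ^ 2 := by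
    have h3 : |tau v - tau v'| ≤ ‖v - v'‖ := hcoord (v - v') _
    have h4 : |q - q'| ≤ n * n * ‖v - v'‖ := by
      have h5 := hbound (v - v') y hy
      have h6 : v - v' = (1 : ℝ) • v + (-1 : ℝ) • v' := by
        simp [sub_eq_add_neg]
      rw [h6, mat_combo, hquad, ← h6] at h5
      simpa [← sub_eq_add_neg] using h5
    calc _ ≤ |l * ((tau v - tau v') * (q - q'))| := le_abs_self _
      _ = |l| * (|tau v - tau v'| * |q - q'|) := by rw [abs_mul, abs_mul]
      _ ≤ |l| * (‖v - v'‖ * (n * n * ‖v - v'‖)) := by gcongr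
      _ = _ := by ring
  have h7 := mul_le_mul_of_nonneg_left hprod (mul_nonneg ha hb)
  simp only [smul_eq_mul]
  rw [heq, hform, hnorm]
  nlinarith [mul_le_mul_of_nonneg_left h1 ha, mul_le_mul_of_nonneg_left h2 hb]

end Scenario

/-! ### The barrier cost -/

namespace Scenario

open Matrix Filter Topology

open Decision

variable {n : ℕ}

/-- A barrier that is strictly convex along the geometric paths between decisions and blows up
as `τ` approaches `0` or `1`. -/
noncomputable def barrier (v : Decision n) : ℝ :=
  (mat v).trace - Real.log (tau v) - Real.log (1 - tau v)

/-- The objective `-log det P`, modified where the barrier exceeds `b` so as to have compact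
sublevel sets. -/
noncomputable def barrierCost (b : ℝ) (v : Decision n) : ℝ :=
  -Real.log (mat v).det + max (barrier v - b) 0

theorem convex_domain : Convex ℝ (domain n) := by
  rintro v ⟨hP, h0, h1⟩ v' ⟨hP', h0', h1'⟩ a b ha hb hab
  refine ⟨?_, ?_, ?_⟩
  · rw [mat_combo]
    rcases ha.eq_or_lt with rfl | ha
    · obtain rfl : b = 1 := by linarith
      simpa using hP'
    · exact (hP.smul ha).add_posSemidef (hP'.posSemidef.smul hb)
  · rw [tau_combo]
    exact (convex_Ioi (0 : ℝ)) h0 h0' ha hb hab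
  · rw [tau_combo]
    exact (convex_Iio (1 : ℝ)) h1 h1' ha hb hab

theorem continuousOn_barrier : ContinuousOn barrier (domain n) := by
  unfold barrier
  refine ((Continuous.continuousOn (by fun_prop)).sub (ContinuousOn.log (by fun_prop) ?_)).sub
    (ContinuousOn.log (by fun_prop) ?_)
  · exact fun v hv => hv.2.1.ne'
  · exact fun v hv => (sub_pos.2 hv.2.2).ne'

theorem continuousOn_barrierCost (b : ℝ) : ContinuousOn (barrierCost b) (domain n) := by
  unfold barrierCost
  refine ContinuousOn.add (ContinuousOn.neg (ContinuousOn.log ?_ ?_))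
    ((continuousOn_barrier.sub continuousOn_const).sup continuousOn_const)
  · exact continuous_mat.matrix_det.continuousOn
  · exact fun v hv => hv.1.det_pos.ne'

theorem concave_log {x y a b : ℝ} (hx : 0 < x) (hy : 0 < y) (ha : 0 ≤ a) (hb : 0 ≤ b)
    (hab : a + b = 1) : a * Real.log x + b * Real.log y ≤ Real.log (a * x + b * y) :=
  strictConcaveOn_log_Ioi.concaveOn.2 hx hy ha hb hab

theorem convexOn_barrier : ConvexOn ℝ (domain n) barrier := by
  refine ⟨convex_domain, fun v hv v' hv' a b ha hb hab => ?_⟩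
  have h1 := concave_log hv.2.1 hv'.2.1 ha hb hab
  have h2 := concave_log (sub_pos.2 hv.2.2) (sub_pos.2 hv'.2.2) ha hb hab
  have h3 : a * (1 - tau v) + b * (1 - tau v') = 1 - (a * tau v + b * tau v') := by
    linear_combination hab
  rw [h3] at h2
  simp only [barrier, mat_combo, tau_combo, trace_add, trace_smul, smul_eq_mul]
  linarith

theorem convexOn_barrierCost (b : ℝ) : ConvexOn ℝ (domain n) (barrierCost b) := by
  refine ConvexOn.add ⟨convex_domain, fun v hv v' hv' a b ha hb hab => ?_⟩
    ((convexOn_barrier.add_const (-b)).sup (convexOn_const 0 convex_domain))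
  have := log_det_concave hv.1 hv'.1 ha hb hab
  simp only [mat_combo, smul_eq_mul]
  linarith

theorem neg_log_nonneg {x : ℝ} (h0 : 0 < x) (h1 : x < 1) : 0 ≤ -Real.log x :=
  neg_nonneg.2 (Real.log_nonpos h0.le h1.le)

theorem barrier_nonneg {v : Decision n} (hv : v ∈ domain n) : 0 ≤ barrier v := by
  have h1 := neg_log_nonneg hv.2.1 hv.2.2
  have h2 := neg_log_nonneg (sub_pos.2 hv.2.2) (sub_lt_self 1 hv.2.1)
  have h3 := hv.1.posSemidef.trace_nonneg
  rw [barrier]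
  linarith

theorem neg_log_det_le_barrierCost (b : ℝ) (v : Decision n) :
    -Real.log (mat v).det ≤ barrierCost b v :=
  le_add_of_nonneg_right (le_max_right _ _)

theorem barrierCost_eq {b : ℝ} {v : Decision n} (h : barrier v ≤ b) :
    barrierCost b v = -Real.log (mat v).det := by
  rw [barrierCost, max_eq_right (sub_nonpos.2 h), add_zero]

/-- A bound that makes `trace P - log det P` coercive. -/
theorem log_det_le_half_trace {P : Matrix (Fin n) (Fin n) ℝ} (hP : P.PosDef) :
    Real.log P.det ≤ P.trace / 2 := by
  have hdet := hP.isHermitian.det_eq_prod_eigenvalues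
  have htr := hP.isHermitian.trace_eq_sum_eigenvalues
  simp only [RCLike.ofReal_real_eq_id, id] at hdet htr
  rw [hdet, htr, Real.log_prod fun i _ => (hP.eigenvalues_pos i).ne', Finset.sum_div]
  refine Finset.sum_le_sum fun i _ => ?_
  have hpos := hP.eigenvalues_pos i
  have h1 := Real.log_le_sub_one_of_pos (half_pos hpos)
  rw [Real.log_div hpos.ne' two_ne_zero] at h1
  have h2 := Real.log_le_sub_one_of_pos (two_pos (α := ℝ))
  linarith

theorem abs_apply_le_trace {P : Matrix (Fin n) (Fin n) ℝ} (hP : P.PosSemidef) (i j : Fin n) :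
    |P i j| ≤ P.trace := by
  have hdiag : ∀ i, 0 ≤ P i i := fun i => hP.diag_nonneg
  have hle : ∀ i, P i i ≤ P.trace := fun i =>
    Finset.single_le_sum (f := fun i => P i i) (fun i _ => hdiag i) (Finset.mem_univ i)
  have hsymm : P j i = P i j := by simpa using hP.isHermitian.apply i j
  have hform : ∀ s : ℝ, 0 ≤ P i i + 2 * s * P i j + s ^ 2 * P j j := fun s => by
    have := quad_nonneg hP (Pi.single i 1 + s • Pi.single j 1)
    simp only [quad, mulVec_add, mulVec_smul, mulVec_single_one, add_dotProduct, dotProduct_add,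
      smul_dotProduct, dotProduct_smul, single_dotProduct, one_mul, smul_eq_mul, col_apply,
      hsymm] at this
    linarith
  have h1 := hform 1
  have h2 := hform (-1)
  have h3 := hle i
  have h4 := hle j
  rw [abs_le]
  constructor <;> linarith

theorem isCompact_sublevel_barrierCost (b t : ℝ) :
    IsCompact {v | v ∈ domain n ∧ barrierCost b v ≤ t} := by
  set δ := Real.exp (-(t + b)) with hδ
  have hδ0 : 0 < δ := Real.exp_pos _
  set S : Set (Decision n) := {v | (∀ x, 0 ≤ quad (mat v) x) ∧ (mat v).trace ≤ 2 * (t + b) ∧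
    δ ≤ (mat v).det ∧ δ ≤ tau v ∧ tau v ≤ 1 - δ} with hS
  have hpsd : ∀ v : Decision n, (∀ x, 0 ≤ quad (mat v) x) → (mat v).PosSemidef := fun v h =>
    PosSemidef.of_dotProduct_mulVec_nonneg
      (by rw [IsHermitian, conjTranspose_eq_transpose_of_trivial, mat_transpose])
      fun x => by simpa [quad] using h x
  have hSdom : S ⊆ domain n := fun v hv =>
    ⟨(hpsd v hv.1).posDef_iff_det_ne_zero.2 (hδ0.trans_le hv.2.2.1).ne',
      hδ0.trans_le hv.2.2.2.1, by linarith [hv.2.2.2.2]⟩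
  have hsub : {v | v ∈ domain n ∧ barrierCost b v ≤ t} ⊆ S := by
    rintro v ⟨hv, hle⟩
    have h1 := neg_log_nonneg hv.2.1 hv.2.2
    have h2 := neg_log_nonneg (sub_pos.2 hv.2.2) (sub_lt_self 1 hv.2.1)
    have h3 := hv.1.posSemidef.trace_nonneg
    have h4 := log_det_le_half_trace hv.1
    have h5 : -Real.log (mat v).det + barrier v ≤ t + b := by
      have := le_max_left (barrier v - b) 0
      rw [barrierCost] at hle
      linarith
    rw [barrier] at h5
    refine ⟨quad_nonneg hv.1.posSemidef, by linarith, ?_, ?_, ?_⟩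
    · exact (Real.le_log_iff_exp_le hv.1.det_pos).1 (by linarith)
    · exact (Real.le_log_iff_exp_le hv.2.1).1 (by linarith)
    · have := (Real.le_log_iff_exp_le (x := -(t + b)) (sub_pos.2 hv.2.2)).1 (by linarith)
      linarith
  have hSclosed : IsClosed S := by
    have hdet : Continuous fun v : Decision n => (mat v).det := continuous_mat.matrix_det
    have htr : Continuous fun v : Decision n => (mat v).trace := by fun_prop
    have hquad : IsClosed {v : Decision n | ∀ x, 0 ≤ quad (mat v) x} := by
      rw [Set.ofPred_forall]
      exact isClosed_iInter fun x => isClosed_le continuous_const (by fun_prop)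
    exact hquad.inter ((isClosed_le htr continuous_const).inter
      ((isClosed_le continuous_const hdet).inter
        ((isClosed_le continuous_const continuous_tau).inter
          (isClosed_le continuous_tau continuous_const))))
  have hSbdd : ∀ v ∈ S, ‖v‖ ≤ ∑ _i : Sym2 (Fin n) ⊕ Unit, (2 * |t + b| + 1) := by
    intro v hv
    have hcoord : ∀ i, ‖v i‖ ≤ 2 * |t + b| + 1 := by
      rintro (s | u)
      · induction s with
        | h i j =>
          have h1 := abs_apply_le_trace (hpsd v hv.1) i j
          have h2 := hv.2.1
          have h3 := le_abs_self (t + b)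
          have h4 : ‖v (Sum.inl s(i, j))‖ = |mat v i j| := rfl
          linarith
      · have h1 : ‖v (Sum.inr u)‖ = |tau v| := rfl
        rw [h1, abs_of_pos (hδ0.trans_le hv.2.2.2.1)]
        have := hv.2.2.2.2
        have := abs_nonneg (t + b)
        linarith
    have hsum := (EuclideanSpace.basisFun (Sym2 (Fin n) ⊕ Unit) ℝ).sum_repr v
    rw [← hsum]
    refine (norm_sum_le _ _).trans (Finset.sum_le_sum fun i _ => ?_)
    rw [norm_smul, OrthonormalBasis.norm_eq_one, mul_one]
    exact hcoord i
  have hScpt : IsCompact S :=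
    (isCompact_closedBall (0 : Decision n) _).of_isClosed_subset hSclosed
      fun v hv => mem_closedBall_zero_iff.2 (hSbdd v hv)
  have heq : {v | v ∈ domain n ∧ barrierCost b v ≤ t} = S ∩ barrierCost b ⁻¹' Set.Iic t := by
    ext v
    exact ⟨fun h => ⟨hsub h, h.2⟩, fun h => ⟨hSdom h.1, h.2⟩⟩
  rw [heq]
  exact hScpt.of_isClosed_subset (((continuousOn_barrierCost
    b).mono hSdom).preimage_isClosed_of_isClosed hSclosed isClosed_Iic) Set.inter_subset_left

end Scenario

/-! ### Geodesics -/

namespace Scenario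

open Matrix Filter Topology

open Decision

variable {n : ℕ}

theorem geom_mean_lt_arith_mean {a b : ℝ} (ha : 0 < a) (hb : 0 < b) (hab : a ≠ b) :
    a ^ (1 - 1 / 2 : ℝ) * b ^ (1 / 2 : ℝ) < (1 - 1 / 2) * a + 1 / 2 * b := by
  rw [show (1 - 1 / 2 : ℝ) = 1 / 2 by norm_num, ← Real.sqrt_eq_rpow, ← Real.sqrt_eq_rpow]
  have h : √a - √b ≠ 0 := fun h => hab ((Real.sqrt_inj ha.le hb.le).1 (sub_eq_zero.1 h))
  nlinarith [sq_pos_of_ne_zero h, Real.sq_sqrt ha.le, Real.sq_sqrt hb.le]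

/-- A point of the curve joining `(Mᵀ M, τ₀)` to `(Mᵀ diag(d) M, τ₁)` along which both components
are interpolated geometrically: in `P` it is a geodesic for the affine-invariant metric. -/
noncomputable def geodesic (M : Matrix (Fin n) (Fin n) ℝ) (d : Fin n → ℝ) (τ₀ τ₁ t : ℝ) :
    Decision n :=
  mk (Mᵀ * diagonal (fun i => d i ^ t) * M) (τ₀ ^ (1 - t) * τ₁ ^ t)

theorem mat_geodesic (M : Matrix (Fin n) (Fin n) ℝ) (d : Fin n → ℝ) (τ₀ τ₁ t : ℝ) :
    mat (geodesic M d τ₀ τ₁ t) = Mᵀ * diagonal (fun i => d i ^ t) * M := by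
  refine mat_mk ?_ _
  rw [transpose_mul, transpose_mul, transpose_transpose, diagonal_transpose, Matrix.mul_assoc]

theorem tau_geodesic (M : Matrix (Fin n) (Fin n) ℝ) (d : Fin n → ℝ) (τ₀ τ₁ t : ℝ) :
    tau (geodesic M d τ₀ τ₁ t) = τ₀ ^ (1 - t) * τ₁ ^ t := rfl

theorem differentiableAt_geodesic (M : Matrix (Fin n) (Fin n) ℝ) {d : Fin n → ℝ}
    (hd : ∀ i, 0 < d i) {τ₀ τ₁ : ℝ} (h₀ : 0 < τ₀) (h₁ : 0 < τ₁) (t : ℝ) :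
    DifferentiableAt ℝ (geodesic M d τ₀ τ₁) t := by
  have hpow : ∀ {a : ℝ}, 0 < a → DifferentiableAt ℝ (fun t : ℝ => a ^ t) t := fun ha =>
    (Real.hasStrictDerivAt_const_rpow ha t).hasDerivAt.differentiableAt
  rw [differentiableAt_euclidean]
  rintro (s | u)
  · induction s with
    | h i j =>
      have heq : (fun t => geodesic M d τ₀ τ₁ t (Sum.inl s(i, j))) =
          fun t => ∑ l, M l i * d l ^ t * M l j := by
        ext t
        have := congrFun (congrFun (mat_geodesic M d τ₀ τ₁ t) i) j
        rw [mul_apply] at this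
        simp only [mul_diagonal, transpose_apply] at this
        exact this
      rw [heq]
      exact DifferentiableAt.fun_sum fun l _ => ((hpow (hd l)).const_mul _).mul_const _
  · have heq : (fun t => geodesic M d τ₀ τ₁ t (Sum.inr u)) = fun t => τ₀ ^ (1 - t) * τ₁ ^ t := rfl
    rw [heq]
    have h2 : (fun t : ℝ => τ₀ ^ (1 - t)) = fun t : ℝ => τ₀ * (τ₀⁻¹) ^ t := by
      ext t
      rw [Real.rpow_sub h₀, Real.rpow_one, Real.inv_rpow h₀.le, div_eq_mul_inv]
    have h3 := (hpow (inv_pos.2 h₀)).const_mul τ₀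
    rw [← h2] at h3
    exact h3.mul (hpow h₁)

section Geodesic

variable {v v' : Decision n} (hv : v ∈ domain n) (hv' : v' ∈ domain n)
  {M : Matrix (Fin n) (Fin n) ℝ} {d : Fin n → ℝ} (hM : M.det ≠ 0) (hd : ∀ i, 0 < d i)
  (hP : mat v = Mᵀ * M) (hQ : mat v' = Mᵀ * diagonal d * M) {t : ℝ} (ht0 : 0 ≤ t) (ht1 : t ≤ 1)

include hP in
theorem geodesic_zero : geodesic M d (tau v) (tau v') 0 = v := by
  refine ext_mat_tau ?_ ?_
  · rw [mat_geodesic, hP]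
    simp
  · rw [tau_geodesic]
    simp

include hv hv' hM hd ht0 ht1 in
theorem geodesic_mem_domain : geodesic M d (tau v) (tau v') t ∈ domain n := by
  refine ⟨?_, ?_, ?_⟩
  · rw [mat_geodesic]
    exact posDef_congruence_diagonal hM fun i => Real.rpow_pos_of_pos (hd i) _
  · exact mul_pos (Real.rpow_pos_of_pos hv.2.1 _) (Real.rpow_pos_of_pos hv'.2.1 _)
  · have h1 := geom_add_geom_le_one hv.2.1 hv.2.2 hv'.2.1 hv'.2.2 ht0 ht1
    have h2 : 0 < (1 - tau v) ^ (1 - t) * (1 - tau v') ^ t :=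
      mul_pos (Real.rpow_pos_of_pos (sub_pos.2 hv.2.2) _)
        (Real.rpow_pos_of_pos (sub_pos.2 hv'.2.2) _)
    rw [tau_geodesic]
    linarith

theorem log_geom_mean {a b : ℝ} (ha : 0 < a) (hb : 0 < b) (t : ℝ) :
    Real.log (a ^ (1 - t) * b ^ t) = (1 - t) * Real.log a + t * Real.log b := by
  rw [Real.log_mul (Real.rpow_pos_of_pos ha _).ne' (Real.rpow_pos_of_pos hb _).ne',
    Real.log_rpow ha, Real.log_rpow hb]

include hM hd hP hQ in
theorem log_det_geodesic : Real.log (mat (geodesic M d (tau v) (tau v') t)).det =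
    (1 - t) * Real.log (mat v).det + t * Real.log (mat v').det := by
  have h2 : Mᵀ * M = Mᵀ * diagonal (fun _ => 1) * M := by simp
  rw [mat_geodesic, hP, hQ, h2, log_det_congruence_diagonal hM fun _ => one_pos,
    log_det_congruence_diagonal hM hd,
    log_det_congruence_diagonal hM fun i => Real.rpow_pos_of_pos (hd i) _]
  simp only [Real.log_rpow (hd _), Real.log_one, ← Finset.mul_sum]
  simp
  ring

include hd hP hQ ht0 ht1 in
theorem trace_geodesic_le : (mat (geodesic M d (tau v) (tau v') t)).trace ≤
    (1 - t) * (mat v).trace + t * (mat v').trace := by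
  have h2 : Mᵀ * M = Mᵀ * diagonal (fun _ => 1) * M := by simp
  rw [mat_geodesic, hP, hQ, h2, trace_congruence_diagonal, trace_congruence_diagonal,
    trace_congruence_diagonal, Finset.mul_sum, Finset.mul_sum, ← Finset.sum_add_distrib]
  refine Finset.sum_le_sum fun i _ => ?_
  have h := Real.geom_mean_le_arith_mean2_weighted (sub_nonneg.2 ht1) ht0 zero_le_one (hd i).le
    (by ring)
  rw [Real.one_rpow, one_mul, mul_one] at h
  have := mul_le_mul_of_nonneg_right h (Finset.sum_nonneg fun j (_ : j ∈ Finset.univ) =>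
    sq_nonneg (M i j))
  linarith

include hv hv' ht0 ht1 in
theorem log_one_sub_tau_geodesic_le : (1 - t) * Real.log (1 - tau v) + t * Real.log (1 - tau v') ≤
    Real.log (1 - tau (geodesic M d (tau v) (tau v') t)) := by
  have h0 := sub_pos.2 hv.2.2
  have h1 := sub_pos.2 hv'.2.2
  rw [← log_geom_mean h0 h1]
  exact Real.log_le_log (mul_pos (Real.rpow_pos_of_pos h0 _) (Real.rpow_pos_of_pos h1 _))
    (geom_add_geom_le_one hv.2.1 hv.2.2 hv'.2.1 hv'.2.2 ht0 ht1)

include hv hv' hd hP hQ ht0 ht1 in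
theorem barrier_geodesic_le : barrier (geodesic M d (tau v) (tau v') t) ≤
    (1 - t) * barrier v + t * barrier v' := by
  have h1 := trace_geodesic_le hd hP hQ ht0 ht1
  have h2 := log_one_sub_tau_geodesic_le (M := M) (d := d) hv hv' ht0 ht1
  have h3 := log_geom_mean hv.2.1 hv'.2.1 t
  rw [← tau_geodesic M d] at h3
  rw [barrier, barrier, barrier]
  linarith

include hv hv' hM hd hP hQ ht0 ht1 in
theorem barrierCost_geodesic_le (b : ℝ) : barrierCost b (geodesic M d (tau v) (tau v') t) ≤
    (1 - t) * barrierCost b v + t * barrierCost b v' := by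
  have h1 := barrier_geodesic_le hv hv' hd hP hQ ht0 ht1
  have h2 := log_det_geodesic (t := t) hM hd hP hQ
  have h3 : max (barrier (geodesic M d (tau v) (tau v') t) - b) 0 ≤
      (1 - t) * max (barrier v - b) 0 + t * max (barrier v' - b) 0 := by
    have ht1' := sub_nonneg.2 ht1
    refine max_le ?_ (by positivity)
    have h4 := mul_le_mul_of_nonneg_left (le_max_left (barrier v - b) 0) ht1'
    have h5 := mul_le_mul_of_nonneg_left (le_max_left (barrier v' - b) 0) ht0
    linarith
  rw [barrierCost, barrierCost, barrierCost]
  linarith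

include hv hv' in
/-- Two distinct values of `τ` leave room above the geometric mean of `1 - τ`. -/
theorem geom_mean_one_sub_tau_lt (hne : tau v ≠ tau v') :
    (1 - tau v) ^ (1 - 1 / 2 : ℝ) * (1 - tau v') ^ (1 / 2 : ℝ) <
      1 - tau (geodesic M d (tau v) (tau v') (1 / 2)) := by
  have h0 := geom_mean_lt_arith_mean hv.2.1 hv'.2.1 hne
  have h1 := Real.geom_mean_le_arith_mean2_weighted (by norm_num) (by norm_num)
    (sub_nonneg.2 hv.2.2.le) (sub_nonneg.2 hv'.2.2.le) (sub_add_cancel (1 : ℝ) (1 / 2))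
  rw [tau_geodesic]
  linarith

include hv hv' hM hd hP hQ in
theorem barrier_geodesic_half_lt (hne : v ≠ v') :
    barrier (geodesic M d (tau v) (tau v') (1 / 2)) < (barrier v + barrier v') / 2 := by
  have ht0 : (0 : ℝ) ≤ 1 / 2 := by norm_num
  have ht1 : (1 / 2 : ℝ) ≤ 1 := by norm_num
  have h1 := trace_geodesic_le (v := v) (v' := v') hd hP hQ ht0 ht1
  have h2 := log_one_sub_tau_geodesic_le (M := M) (d := d) hv hv' ht0 ht1
  have h3 := log_geom_mean hv.2.1 hv'.2.1 (1 / 2)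
  rw [← tau_geodesic M d] at h3
  rw [barrier, barrier, barrier]
  by_cases hτ : tau v = tau v'
  · have hdne : ∃ i, d i ≠ 1 := by
      by_contra! h
      refine hne (ext_mat_tau ?_ hτ)
      have : diagonal d = 1 := by rw [← diagonal_one]; congr; exact funext h
      rw [hP, hQ, this, Matrix.mul_one]
    obtain ⟨i₀, hi₀⟩ := hdne
    have h4 : (mat (geodesic M d (tau v) (tau v') (1 / 2))).trace <
        (1 - 1 / 2) * (mat v).trace + 1 / 2 * (mat v').trace := by
      have h2 : Mᵀ * M = Mᵀ * diagonal (fun _ => 1) * M := by simp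
      rw [mat_geodesic, hP, hQ, h2, trace_congruence_diagonal, trace_congruence_diagonal,
        trace_congruence_diagonal, Finset.mul_sum, Finset.mul_sum, ← Finset.sum_add_distrib]
      refine Finset.sum_lt_sum (fun i _ => ?_) ⟨i₀, Finset.mem_univ _, ?_⟩
      · have h := Real.geom_mean_le_arith_mean2_weighted (sub_nonneg.2 ht1) ht0 zero_le_one
          (hd i).le (by ring)
        rw [Real.one_rpow, one_mul, mul_one] at h
        have := mul_le_mul_of_nonneg_right h (sum_row_sq_pos hM i).le
        linarith
      · have h := geom_mean_lt_arith_mean one_pos (hd i₀) hi₀.symm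
        rw [Real.one_rpow, one_mul, mul_one] at h
        have := mul_lt_mul_of_pos_right h (sum_row_sq_pos hM i₀)
        linarith
    linarith
  · have h0 := sub_pos.2 hv.2.2
    have h0' := sub_pos.2 hv'.2.2
    have h4 := Real.log_lt_log (mul_pos (Real.rpow_pos_of_pos h0 _) (Real.rpow_pos_of_pos h0' _))
      (geom_mean_one_sub_tau_lt (M := M) (d := d) hv hv' hτ)
    rw [log_geom_mean h0 h0'] at h4
    linarith

variable (A : Matrix (Fin n) (Fin n) ℝ) (w : Fin n → ℝ)

include hv hv' hM hd hP hQ in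
theorem gap_geodesic_nonpos {l : ℝ} (hl : 0 < l) (h₀ : gap A v w l ≤ 0) (h₁ : gap A v' w l ≤ 0)
    (k : ℕ) : gap A (geodesic M d (tau v) (tau v') ((1 / 2) ^ k)) w l ≤ 0 := by
  rw [gap_nonpos_iff] at h₀ h₁ ⊢
  rw [hP] at h₀
  rw [hQ] at h₁
  intro y
  have := num_le_den_path A w hM hd hv.2.1 hv.2.2 hv'.2.1 hv'.2.2 hl hl h₀ h₁ k rfl y
  rwa [← Real.rpow_add hl, sub_add_cancel, Real.rpow_one, ← mat_geodesic M d (tau v) (tau v'),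
    ← tau_geodesic M d] at this

theorem tendsto_half_pow : Tendsto (fun k : ℕ => (1 / 2 : ℝ) ^ k) atTop (𝓝 0) :=
  tendsto_pow_atTop_nhds_zero_of_lt_one (by norm_num) (by norm_num)

include hv hv' hM hd hP hQ in
theorem gap_geodesic_le {l : ℝ} (hl : 0 < l) (h₀ : gap A v w l ≤ 0) (h₁ : gap A v' w l < 0) :
    ∃ κ > 0, ∀ᶠ k : ℕ in atTop,
      gap A (geodesic M d (tau v) (tau v') ((1 / 2) ^ k)) w l ≤ -κ * (1 / 2) ^ k := by
  obtain ⟨l', hl', hll, h₁⟩ := exists_level_lt A hl h₁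
  obtain ⟨m, hm, hden⟩ := exists_den_lower_bound hv
  refine ⟨(l - l') * m, mul_pos (sub_pos.2 hll) hm, ?_⟩
  have htend : Tendsto (fun k : ℕ => geodesic M d (tau v) (tau v') ((1 / 2) ^ k)) atTop (𝓝 v) := by
    have := (differentiableAt_geodesic M hd hv.2.1 hv'.2.1 0).continuousAt.tendsto
    rw [geodesic_zero hP] at this
    exact this.comp tendsto_half_pow
  filter_upwards [htend.eventually hden] with k hk
  set t : ℝ := (1 / 2) ^ k with ht
  have ht0 : 0 ≤ t := by positivity
  have ht1 : t ≤ 1 := pow_le_one₀ (by norm_num) (by norm_num)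
  rw [gap_nonpos_iff, hP] at h₀
  rw [hQ] at h₁
  obtain ⟨y, hy, hgap⟩ := exists_gap_eq A (geodesic M d (tau v) (tau v') t) w l
  have h2 := num_le_den_path A w hM hd hv.2.1 hv.2.2 hv'.2.1 hv'.2.2 hl hl' h₀ h₁ k rfl y
  rw [← ht, ← mat_geodesic M d (tau v) (tau v'), ← tau_geodesic M d (tau v) (tau v')] at h2
  have h3 := Real.geom_mean_le_arith_mean2_weighted (sub_nonneg.2 ht1) ht0 hl.le hl'.le (by ring)
  have h4 := hk y hy
  rw [hgap, gapForm]
  have h5 := mul_le_mul_of_nonneg_right h3 (hm.le.trans h4)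
  have h6 := mul_le_mul_of_nonneg_left h4 (mul_nonneg ht0 (sub_pos.2 hll).le)
  linarith

end Geodesic

/-- The barrier cost and the matrix inequalities behave along geodesics as convex functions do
along segments. -/
theorem exists_isDyadicPath (A : Matrix (Fin n) (Fin n) ℝ) {Δ : Type*} (r : Δ → Fin n → ℝ) (b : ℝ)
    {v v' : Decision n} (hv : v ∈ domain n) (hv' : v' ∈ domain n) :
    ∃ γ, IsDyadicPath (domain n) (barrierCost b)
        (fun x (a : Δ × Set.Ioi (0 : ℝ)) => gap A x (r a.1) a.2) v v' γ ∧
      (∀ k, barrier (γ k) ≤ (1 - (1 / 2) ^ k) * barrier v + (1 / 2) ^ k * barrier v') ∧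
      (v ≠ v' → barrier (γ 1) < (barrier v + barrier v') / 2) := by
  obtain ⟨M, d, hM, hd, hP, hQ⟩ := exists_congruence_diagonal hv.1 hv'.1
  have ht0 : ∀ k : ℕ, (0 : ℝ) ≤ (1 / 2) ^ k := fun k => by positivity
  have ht1 : ∀ k : ℕ, (1 / 2 : ℝ) ^ k ≤ 1 := fun k => pow_le_one₀ (by norm_num) (by norm_num)
  refine ⟨fun k => geodesic M d (tau v) (tau v') ((1 / 2) ^ k), ⟨?_, ?_, ?_, ?_, ?_⟩, ?_, ?_⟩
  · exact fun k => geodesic_mem_domain hv hv' hM hd (ht0 k) (ht1 k)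
  · obtain ⟨L, hL⟩ :=
      (differentiableAt_geodesic M hd hv.2.1 hv'.2.1 0).isBigO_sub.bound
    refine ⟨L, ?_⟩
    filter_upwards [tendsto_half_pow.eventually hL] with k hk
    rwa [geodesic_zero hP, sub_zero, Real.norm_of_nonneg (ht0 k)] at hk
  · exact fun k => barrierCost_geodesic_le hv hv' hM hd hP hQ (ht0 k) (ht1 k) b
  · exact fun a h₀ h₁ k => gap_geodesic_nonpos hv hv' hM hd hP hQ A _ a.2.2 h₀ h₁ k
  · exact fun a h₀ h₁ => gap_geodesic_le hv hv' hM hd hP hQ A _ a.2.2 h₀ h₁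
  · exact fun k => barrier_geodesic_le hv hv' hd hP hQ (ht0 k) (ht1 k)
  · intro hne
    simp only [pow_one]
    exact barrier_geodesic_half_lt hv hv' hM hd hP hQ hne

/-- The scenario program with the barrier cost. Its scenarios are arbitrary indices `a` with a
disturbance `r a`, such that some decision satisfies the matrix inequality for all of them. -/
noncomputable def barrierProgram (A : Matrix (Fin n) (Fin n) ℝ) {Δ : Type*} [MeasurableSpace Δ]
    {r : Δ → Fin n → ℝ} (hr : Measurable r) (b : ℝ)
    (hfeas : ∃ v ∈ domain n, ∀ a, gap A v (r a) 1 ≤ 0) : ScenarioProgram (Decision n) Δ where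
  domain := domain n
  cost := barrierCost b
  reg := barrier
  constr v a l := gap A v (r a) l
  isCompact_sublevel := isCompact_sublevel_barrierCost b
  continuousOn_cost := continuousOn_barrierCost b
  convexOn_cost := convexOn_barrierCost b
  continuousOn_reg := continuousOn_barrier
  convexOn_reg := convexOn_barrier
  reg_nonneg _ hv := barrier_nonneg hv
  continuous_constr a := Continuous.comp
    (g := fun q : Decision n × (Fin n → ℝ) × ℝ => gap A q.1 q.2.1 q.2.2)
    (f := fun q : Decision n × ℝ => (q.1, r a, q.2)) (continuous_gap A)
    (continuous_fst.prodMk (continuous_const.prodMk continuous_snd))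
  weaklyConvex_constr a l := weaklyConvex_gap A (r a) l
  measurable_constr v := Measurable.comp
    (g := fun q : (Fin n → ℝ) × ℝ => gap A v q.1 q.2) (f := fun q : Δ × ℝ => (r q.1, q.2))
    (Continuous.comp (g := fun q : Decision n × (Fin n → ℝ) × ℝ => gap A q.1 q.2.1 q.2.2)
      (f := fun q : (Fin n → ℝ) × ℝ => (v, q)) (continuous_gap A)
      (continuous_const.prodMk continuous_id)).measurable
    ((hr.comp measurable_fst).prodMk measurable_snd)
  strictAnti_constr _ hv a := strictAnti_gap A hv (r a)
  exists_feasible := hfeas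
  exists_path _ hv _ hv' := exists_isDyadicPath A r b hv hv'

end Scenario

/-! ### Solutions of the scenario program -/

namespace Scenario

open Matrix

open Decision ScenarioRPI

variable {n N : ℕ} {A : Matrix (Fin n) (Fin n) ℝ}

theorem quad_matrix_smul (c : ℝ) (P : Matrix (Fin n) (Fin n) ℝ) (x : Fin n → ℝ) :
    quad (c • P) x = c * quad P x := by
  rw [quad, smul_mulVec, dotProduct_smul, quad, smul_eq_mul]

theorem quad_matrix_add (P Q : Matrix (Fin n) (Fin n) ℝ) (x : Fin n → ℝ) :
    quad (P + Q) x = quad P x + quad Q x := by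
  rw [quad, add_mulVec, dotProduct_add, quad, quad]

theorem dotProduct_lmiMatrix_mulVec (P : Matrix (Fin n) (Fin n) ℝ) (τ : ℝ) (w : Fin n → ℝ)
    (y : Fin n ⊕ Unit → ℝ) : y ⬝ᵥ lmiMatrix A P τ w *ᵥ y = num A w P y - den P τ y := by
  set x : Fin n → ℝ := fun i => y (Sum.inl i) with hx
  set s := y (Sum.inr ()) with hs
  have hy : y = Sum.elim x fun _ => s := by
    ext (i | u) <;> rfl
  have hcol : replicateCol Unit w *ᵥ (fun _ => s) = s • w := by
    ext i
    simp [mulVec, dotProduct, mul_comm]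
  have hrow : ∀ z, (replicateCol Unit w)ᵀ *ᵥ z = fun _ => w ⬝ᵥ z := fun z => by
    ext i
    simp [mulVec, dotProduct]
  have hadj : ∀ z, x ⬝ᵥ Aᵀ *ᵥ z = (A *ᵥ x) ⬝ᵥ z := fun z => by
    rw [dotProduct_mulVec, vecMul_transpose]
  rw [num, den, ← hx, ← hs, hy, lmiMatrix, fromBlocks_mulVec, sumElim_dotProduct_sumElim]
  simp only [Sum.elim_comp_inl, Sum.elim_comp_inr, sub_mulVec, add_mulVec, ← mulVec_mulVec, hcol,
    hrow, smul_mulVec, one_mulVec, dotProduct_add, dotProduct_sub, hadj, quad, mulVec_add,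
    mulVec_smul, add_dotProduct, smul_dotProduct, dotProduct_smul, smul_eq_mul]
  simp [dotProduct]
  ring

theorem lmi_iff {P : Matrix (Fin n) (Fin n) ℝ} (hP : Pᵀ = P) {τ : ℝ} {w : Fin n → ℝ} :
    LMI A P τ w ↔ ∀ y, num A w P y ≤ den P τ y := by
  have hherm : (-lmiMatrix A P τ w).IsHermitian := by
    refine IsHermitian.neg ?_
    rw [IsHermitian, conjTranspose_eq_transpose_of_trivial, lmiMatrix, fromBlocks_transpose]
    simp [transpose_mul, hP, Matrix.mul_assoc]
  have hform : ∀ y, star y ⬝ᵥ (-lmiMatrix A P τ w) *ᵥ y = den P τ y - num A w P y := fun y => by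
    rw [star_trivial, neg_mulVec, dotProduct_neg, dotProduct_lmiMatrix_mulVec, neg_sub]
  refine ⟨fun h y => ?_, fun h => PosSemidef.of_dotProduct_mulVec_nonneg hherm fun y => ?_⟩
  · have := h.dotProduct_mulVec_nonneg y
    rw [hform] at this
    linarith
  · rw [hform]
    linarith [h y]

theorem lmi_iff_gap_nonpos {v : Decision n} {w : Fin n → ℝ} :
    LMI A (mat v) (tau v) w ↔ gap A v w 1 ≤ 0 := by
  rw [gap_nonpos_iff, lmi_iff (mat_transpose v)]
  simp only [one_mul]

theorem _root_.Matrix.PosDef.transpose_eq_self {P : Matrix (Fin n) (Fin n) ℝ} (hP : P.PosDef) :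
    Pᵀ = P := by
  rw [← conjTranspose_eq_transpose_of_trivial]
  exact hP.isHermitian

section Solution

variable {w : Fin N → Fin n → ℝ} {P P' : Matrix (Fin n) (Fin n) ℝ} {τ τ' : ℝ}

theorem log_det_lt_log_det_smul [Nonempty (Fin n)] (hP : P.PosDef) {α : ℝ} (hα : 1 < α) :
    Real.log P.det < Real.log (α • P).det := by
  rw [det_smul, Fintype.card_fin]
  refine Real.log_lt_log hP.det_pos (lt_mul_of_one_lt_left hP.det_pos (one_lt_pow₀ hα ?_))
  exact Fin.pos_iff_nonempty.2 ‹_› |>.ne'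

/-- A matrix whose determinant is at least the optimal one cannot be enlarged. -/
theorem _root_.ScenarioRPI.IsSolution.not_isFeasible_smul [Nonempty (Fin n)]
    (h : IsSolution A w P τ) (hP' : P'.PosDef) (hdet : Real.log P.det ≤ Real.log P'.det)
    {α : ℝ} (hα : 1 < α) : ¬ IsFeasible A w (α • P') τ' := fun hf => by
  have h1 := h.optimal _ _ hf
  have h2 := log_det_lt_log_det_smul hP' hα
  linarith

theorem quad_le_one_sub (hP : P.PosDef) {w : Fin n → ℝ} (h : LMI A P τ w) :
    quad P w ≤ 1 - τ := by
  have := (lmi_iff hP.transpose_eq_self).1 h (Sum.elim 0 fun _ => 1)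
  have h0 : (fun _ : Fin n => (0 : ℝ)) = 0 := rfl
  simpa [num, den, quad, h0] using this

theorem quad_mulVec_le (hP : P.PosDef) {w : Fin n → ℝ} (h : LMI A P τ w) (x : Fin n → ℝ) :
    quad P (A *ᵥ x) ≤ τ * quad P x := by
  have := (lmi_iff hP.transpose_eq_self).1 h (Sum.elim x fun _ => 0)
  simpa [num, den] using this

/-- At a solution `τ = 1` is excluded: then all scenarios would vanish, and `P` could be scaled up
arbitrarily. -/
theorem _root_.ScenarioRPI.IsSolution.tau_lt_one [Nonempty (Fin n)] [Nonempty (Fin N)]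
    (h : IsSolution A w P τ) : τ < 1 := by
  have hP := h.feasible.posDef
  have hquad := fun i => quad_le_one_sub hP (h.feasible.lmi i)
  obtain ⟨i₀⟩ := ‹Nonempty (Fin N)›
  have hle : τ ≤ 1 := by linarith [hquad i₀, quad_nonneg hP.posSemidef (w i₀)]
  refine lt_of_le_of_ne hle fun h1 => ?_
  subst h1
  have hw : ∀ i, w i = 0 := fun i => by
    by_contra hne
    have := quad_pos hP hne
    linarith [hquad i]
  refine h.not_isFeasible_smul (τ' := 1) hP le_rfl one_lt_two
    ⟨hP.smul two_pos, one_pos, fun i => ?_⟩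
  rw [lmi_iff (hP.smul two_pos).transpose_eq_self]
  intro y
  have := (lmi_iff hP.transpose_eq_self).1 (h.feasible.lmi i) y
  rw [num, den] at this ⊢
  rw [quad_matrix_smul, quad_matrix_smul]
  linarith

/-- The solution is unique. If two solutions differ in `τ`, then half way on the geodesic joining
them the inequality has slack, and `P` can be scaled up; if they agree in `τ`, then the inequality
is linear and strict concavity of `log det` applies. -/
theorem _root_.ScenarioRPI.IsSolution.unique [Nonempty (Fin n)] {v v' : Decision n}
    (hv : v ∈ domain n) (hv' : v' ∈ domain n) (h : IsSolution A w (mat v) (tau v))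
    (h' : ∀ i, LMI A (mat v') (tau v') (w i))
    (hdet : -Real.log (mat v').det ≤ -Real.log (mat v).det) : v' = v := by
  have hlmi : ∀ i y, num A (w i) (mat v) y ≤ 1 * den (mat v) (tau v) y := fun i y => by
    rw [one_mul]
    exact (lmi_iff (mat_transpose v)).1 (h.feasible.lmi i) y
  have hlmi' : ∀ i y, num A (w i) (mat v') y ≤ 1 * den (mat v') (tau v') y := fun i y => by
    rw [one_mul]
    exact (lmi_iff (mat_transpose v')).1 (h' i) y
  by_cases hτ : tau v = tau v'
  · refine ext_mat_tau (by_contra fun hne => ?_) hτ.symm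
    have hmid : ((1 / 2 : ℝ) • mat v + (1 / 2 : ℝ) • mat v').PosDef :=
      (hv.1.smul (by norm_num)).add (hv'.1.smul (by norm_num))
    have h1 := log_det_midpoint_lt hv.1 hv'.1 (Ne.symm hne)
    have h2 := h.optimal ((1 / 2 : ℝ) • mat v + (1 / 2 : ℝ) • mat v') (tau v)
      ⟨hmid, hv.2.1, fun i => (lmi_iff hmid.transpose_eq_self).2 fun y => ?_⟩
    · linarith
    · have h3 := hlmi i y
      have h4 := hlmi' i y
      rw [num, den] at h3 h4 ⊢
      rw [← hτ] at h4
      simp only [quad_matrix_add, quad_matrix_smul]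
      linarith
  · exfalso
    obtain ⟨M, d, hM, hd, hP, hQ⟩ := exists_congruence_diagonal hv.1 hv'.1
    set c := (1 - tau v) ^ (1 - 1 / 2 : ℝ) * (1 - tau v') ^ (1 / 2 : ℝ) with hc
    set u := geodesic M d (tau v) (tau v') (1 / 2) with hu
    have hc0 : 0 < c := mul_pos (Real.rpow_pos_of_pos (sub_pos.2 hv.2.2) _)
      (Real.rpow_pos_of_pos (sub_pos.2 hv'.2.2) _)
    have hclt : c < 1 - tau u := geom_mean_one_sub_tau_lt hv hv' hτ
    have hudom : u ∈ domain n := geodesic_mem_domain hv hv' hM hd (by norm_num) (by norm_num)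
    have hudet := log_det_geodesic (t := 1 / 2) hM hd hP hQ
    rw [← hu] at hudet
    have hα : 1 < (1 - tau u) / c := (one_lt_div hc0).2 hclt
    have hpos := hudom.1.smul (zero_lt_one.trans hα)
    refine h.not_isFeasible_smul (τ' := tau u) hudom.1 (by linarith) hα
      ⟨hpos, hudom.2.1, fun i => (lmi_iff hpos.transpose_eq_self).2 fun y => ?_⟩
    have h0 := hlmi i
    have h1 := hlmi' i
    rw [hP] at h0
    rw [hQ] at h1
    have h2 := num_le_interpolate A (w i) hM hd hv.2.1 hv.2.2 hv'.2.1 hv'.2.2 one_pos one_pos h0 h1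
      1 (pow_one _).symm y
    rw [Real.one_rpow, Real.one_rpow, one_mul, one_mul, ← mat_geodesic M d (tau v) (tau v'),
      ← tau_geodesic M d (tau v) (tau v'), ← hu, ← hc] at h2
    have h3 := mul_le_mul_of_nonneg_left h2 (zero_lt_one.trans hα).le
    rw [num] at h3 ⊢
    rw [den, quad_matrix_smul, quad_matrix_smul]
    refine h3.trans (le_of_eq ?_)
    field_simp

end Solution

/-- The inequality `2 ⟨a, b⟩ ≤ η ‖a‖ ^ 2 + η⁻¹ ‖b‖ ^ 2` for the form `quad P`. -/
theorem quad_add_le {P : Matrix (Fin n) (Fin n) ℝ} (hP : P.PosSemidef) {η : ℝ} (hη : 0 < η)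
    (a b : Fin n → ℝ) :
    quad P (a + b) ≤ (1 + η) * quad P a + (1 + η⁻¹) * quad P b := by
  have hexp : ∀ s : ℝ, quad P (a + s • b) =
      quad P a + s * (a ⬝ᵥ P *ᵥ b + b ⬝ᵥ P *ᵥ a) + s ^ 2 * quad P b := fun s => by
    simp only [quad, mulVec_add, mulVec_smul, add_dotProduct, dotProduct_add, smul_dotProduct,
      dotProduct_smul, smul_eq_mul]
    ring
  have h1 := hexp 1
  have h2 := hexp (-η⁻¹)
  rw [one_smul] at h1
  have h3 := mul_nonneg hη.le (quad_nonneg hP (a + (-η⁻¹) • b))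
  rw [h2] at h3
  have h4 : η * (quad P a + -η⁻¹ * (a ⬝ᵥ P *ᵥ b + b ⬝ᵥ P *ᵥ a) + (-η⁻¹) ^ 2 * quad P b) =
      η * quad P a - (a ⬝ᵥ P *ᵥ b + b ⬝ᵥ P *ᵥ a) + η⁻¹ * quad P b := by
    field_simp
    ring
  rw [h1]
  linarith

/-- If `A` is a contraction for some ellipsoid norm, then a small multiple of that norm satisfies
the matrix inequality for all disturbances in a bounded set. -/
theorem exists_common_feasible {P : Matrix (Fin n) (Fin n) ℝ} (hP : P.PosDef) {τ : ℝ} (h0 : 0 < τ)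
    (h1 : τ < 1) (hA : ∀ x, quad P (A *ᵥ x) ≤ τ * quad P x) {Δ : Type*} {r : Δ → Fin n → ℝ} {R : ℝ}
    (hR0 : 0 < R) (hR : ∀ a, quad P (r a) ≤ R) : ∃ v ∈ domain n, ∀ a, gap A v (r a) 1 ≤ 0 := by
  -- The choice of `η` is such that `(1 + η) τ` is the midpoint of `τ` and `1`.
  set η := (1 - τ) / (2 * τ) with hη
  have hη0 : 0 < η := div_pos (by linarith) (by linarith)
  have hητ : (1 + η) * τ = (1 + τ) / 2 := by
    rw [hη]
    field_simp
    ring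
  set δ := (1 - (1 + τ) / 2) / ((1 + η⁻¹) * R) with hδ
  have hδ0 : 0 < δ := div_pos (by linarith) (by positivity)
  have hδR : δ * ((1 + η⁻¹) * R) = 1 - (1 + τ) / 2 := div_mul_cancel₀ _ (by positivity)
  have hδP := hP.smul hδ0
  have hmat : mat (mk (δ • P) ((1 + τ) / 2)) = δ • P := mat_mk hδP.transpose_eq_self _
  refine ⟨mk (δ • P) ((1 + τ) / 2), ⟨by rwa [hmat], ?_, ?_⟩, fun a => ?_⟩
  · rw [tau_mk]
    linarith
  · rw [tau_mk]
    linarith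
  · rw [gap_nonpos_iff, hmat, tau_mk]
    intro y
    set x : Fin n → ℝ := fun i => y (Sum.inl i) with hx
    set s := y (Sum.inr ()) with hs
    rw [num, den, ← hx, ← hs, quad_matrix_smul, quad_matrix_smul, one_mul]
    have h2 := quad_add_le hP.posSemidef hη0 (A *ᵥ x) (s • r a)
    rw [quad_smul] at h2
    have h3 := mul_le_mul_of_nonneg_left (hA x) (by positivity : 0 ≤ 1 + η)
    rw [← mul_assoc, hητ] at h3
    have h4 := mul_le_mul_of_nonneg_left (hR a) (by positivity : 0 ≤ (1 + η⁻¹) * s ^ 2)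
    calc _ ≤ δ * ((1 + τ) / 2 * quad P x + (1 + η⁻¹) * s ^ 2 * R) :=
          mul_le_mul_of_nonneg_left (by linarith) hδ0.le
      _ = (1 + τ) / 2 * (δ * quad P x) + δ * ((1 + η⁻¹) * R) * s ^ 2 := by ring
      _ = _ := by rw [hδR]

end Scenario

/-! ### The probability of a solution that is not robustly feasible -/

namespace Scenario

open Matrix

open Decision ScenarioRPI

/-- With fewer scenarios than decision variables the binomial sum is complete. -/
theorem sum_binomial_eq_one {N d : ℕ} (h : N < d) (ε : ℝ) :
    ∑ i ∈ Finset.range d, (N.choose i : ℝ) * ε ^ i * (1 - ε) ^ (N - i) = 1 := by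
  have h1 := add_pow ε (1 - ε) N
  rw [add_sub_cancel, one_pow] at h1
  refine Eq.trans (Finset.sum_subset (Finset.range_subset_range.2 h) fun i _ hi => ?_).symm
    (h1.trans (Finset.sum_congr rfl fun i _ => (mul_rotate _ _ _).symm)).symm
  rw [Nat.choose_eq_zero_of_lt (by simpa using hi)]
  simp

variable {n N : ℕ} (A : Matrix (Fin n) (Fin n) ℝ) (W : Set (Fin n → ℝ))
  (μ : Measure (Fin n → ℝ)) (ε : ℝ)

/-- The samples from `W` with a solution that violates the inequality with probability more than
`ε` and at which the barrier is at most `b`. -/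
def badSamples (N : ℕ) (b : ℝ) : Set (Fin N → Fin n → ℝ) :=
  {s | (∀ i, s i ∈ W) ∧ ∃ P τ, IsSolution A s P τ ∧ ¬ IsLevelRobustlyFeasible A W μ ε P τ ∧
    barrier (mk P τ) ≤ b}

/-- The map that fixes the points of `W` and sends everything else to `0`. It makes every vector an
admissible scenario, without changing the scenarios that occur almost surely. -/
noncomputable def retract (v : Fin n → ℝ) : Fin n → ℝ := W.indicator id v

variable {A W μ ε}

theorem retract_of_mem {v : Fin n → ℝ} (hv : v ∈ W) : retract W v = v :=
  Set.indicator_of_mem hv _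

theorem measurable_retract (hW : MeasurableSet W) : Measurable (retract W) :=
  measurable_id.indicator hW

/-- On these samples the solution is also the unique solution of the program with cost
`barrierCost b`, to which the scenario bound applies. -/
theorem measure_badSamples_le [IsProbabilityMeasure μ] [Nonempty (Fin n)] (hW : IsCompact W)
    (hN : numVars n ≤ N) (hε₀ : 0 ≤ ε) (hε₁ : ε ≤ 1) (b : ℝ) :
    (Measure.pi fun _ : Fin N => μ) (badSamples A W μ ε N b) ≤ ENNReal.ofReal
      (∑ i ∈ Finset.range (numVars n), (N.choose i : ℝ) * ε ^ i * (1 - ε) ^ (N - i)) := by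
  have : Nonempty (Fin N) :=
    Fin.pos_iff_nonempty.1 (lt_of_lt_of_le (Nat.succ_pos _) hN)
  rcases (badSamples A W μ ε N b).eq_empty_or_nonempty with hempty | ⟨s₀, hs₀, P₀, τ₀, hsol₀, -⟩
  · rw [hempty, measure_empty]
    exact zero_le
  -- A solution for one sample yields a common feasible point.
  have hfeas : ∃ v ∈ domain n, ∀ a, gap A v (retract W a) 1 ≤ 0 := by
    have hP₀ := hsol₀.feasible.posDef
    obtain ⟨R, hR⟩ := (hW.image (f := quad P₀) (by fun_prop)).bddAbove
    refine exists_common_feasible hP₀ hsol₀.feasible.pos hsol₀.tau_lt_one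
      (quad_mulVec_le hP₀ (hsol₀.feasible.lmi (Classical.arbitrary _))) (R := max R 1)
      (zero_lt_one.trans_le (le_max_right _ _)) fun a => ?_
    by_cases ha : a ∈ W
    · rw [retract_of_mem ha]
      exact (hR (Set.mem_image_of_mem _ ha)).trans (le_max_left _ _)
    · rw [retract, Set.indicator_of_notMem ha]
      simp [quad]
  have hmain := (barrierProgram A (measurable_retract hW.measurableSet) b
    hfeas).measure_violation_le (N := N) μ (by rw [finrank_decision]; exact Nat.succ_pos _)
    (by rwa [finrank_decision]) hε₀ hε₁
  rw [finrank_decision] at hmain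
  refine (measure_mono ?_).trans hmain
  rintro s ⟨hsW, P, τ, hsol, hbad, hb⟩
  have hmat : mat (mk P τ) = P := mat_mk hsol.feasible.posDef.transpose_eq_self _
  set v := mk P τ with hv
  have hdom : v ∈ domain n :=
    ⟨by rw [hmat]; exact hsol.feasible.posDef, hsol.feasible.pos, hsol.tau_lt_one⟩
  have hsol' : IsSolution A s (mat v) (tau v) := by
    rw [hmat]
    exact hsol
  refine ⟨v, ⟨hdom, fun i => ?_, fun v' hv' hfeas' hle => ?_⟩, ?_⟩
  · change gap A v (retract W (s i)) 1 ≤ 0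
    rw [retract_of_mem (hsW i)]
    exact lmi_iff_gap_nonpos.1 (hsol'.feasible.lmi i)
  · refine hsol'.unique hdom hv' (fun i => ?_) ?_
    · have := hfeas' i
      change gap A v' (retract W (s i)) 1 ≤ 0 at this
      rw [retract_of_mem (hsW i)] at this
      exact lmi_iff_gap_nonpos.2 this
    · change barrierCost b v' ≤ barrierCost b v at hle
      rw [barrierCost_eq hb] at hle
      exact (neg_log_det_le_barrierCost b v').trans hle
  · rw [IsLevelRobustlyFeasible, not_le] at hbad
    refine hbad.trans_le (measureReal_mono ?_)
    rintro a ⟨haW, ha⟩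
    change 0 < gap A v (retract W a) 1
    rw [retract_of_mem haW, ← not_le, ← lmi_iff_gap_nonpos, hmat]
    exact ha

/-- The scenario bound for the program of the matrix inequalities, as a bound for the outer measure
of the event that some solution is not robustly feasible. -/
theorem measure_not_robust_le [IsProbabilityMeasure μ] (hW : IsCompact W)
    (hμ : ∀ᵐ v ∂μ, v ∈ W) {Ω : Type*} [MeasurableSpace Ω] {ν : Measure Ω} [IsProbabilityMeasure ν]
    {w : Fin N → Ω → Fin n → ℝ} (hw_law : ∀ i, HasLaw (w i) μ ν) (hw_indep : iIndepFun w ν)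
    (hε₀ : 0 ≤ ε) (hε₁ : ε ≤ 1) :
    ν {ω | ∃ P τ, IsSolution A (fun i => w i ω) P τ ∧ ¬ IsLevelRobustlyFeasible A W μ ε P τ} ≤
      ENNReal.ofReal
        (∑ i ∈ Finset.range (numVars n), (N.choose i : ℝ) * ε ^ i * (1 - ε) ^ (N - i)) := by
  rcases lt_or_ge N (numVars n) with hN | hN
  · rw [sum_binomial_eq_one hN, ENNReal.ofReal_one]
    exact prob_le_one
  rcases isEmpty_or_nonempty (Fin n) with hn | hn
  · -- In dimension zero there is only one disturbance.
    refine (measure_mono_null ?_ measure_empty).le.trans (zero_le)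
    rintro ω ⟨P, τ, hsol, hbad⟩
    refine hbad ?_
    have hempty : {v | v ∈ W ∧ ¬ LMI A P τ v} = ∅ := by
      rw [Set.eq_empty_iff_forall_notMem]
      rintro v ⟨-, hv⟩
      have := hsol.feasible.lmi ⟨0, lt_of_lt_of_le (Nat.succ_pos _) hN⟩
      rw [Subsingleton.elim (w _ ω) v] at this
      exact hv this
    rw [IsLevelRobustlyFeasible, hempty, measureReal_empty]
    exact hε₀
  have hmeas : AEMeasurable (fun ω i => w i ω) ν :=
    aemeasurable_pi_lambda _ fun i => (hw_law i).aemeasurable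
  have hmap : ν.map (fun ω i => w i ω) = Measure.pi fun _ => μ := by
    rw [(iIndepFun_iff_map_fun_eq_pi_map fun i => (hw_law i).aemeasurable).1 hw_indep]
    simp only [(hw_law _).map_eq]
  have hmem : ∀ᵐ ω ∂ν, ∀ i, w i ω ∈ W := ae_all_iff.2 fun i =>
    ae_of_ae_map (hw_law i).aemeasurable (by rw [(hw_law i).map_eq]; exact hμ)
  calc _ ≤ ν ((fun ω i => w i ω) ⁻¹' ⋃ k : ℕ, badSamples A W μ ε N k) := by
        refine measure_mono_ae ?_
        filter_upwards [hmem] with ω hω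
        rintro ⟨P, τ, hsol, hbad⟩
        obtain ⟨k, hk⟩ := exists_nat_ge (barrier (mk P τ))
        exact Set.mem_iUnion.2 ⟨k, hω, P, τ, hsol, hbad, hk⟩
    _ ≤ (Measure.pi fun _ => μ) (⋃ k : ℕ, badSamples A W μ ε N k) := by
        rw [← hmap]
        exact Measure.le_map_apply hmeas _
    _ = ⨆ k : ℕ, (Measure.pi fun _ => μ) (badSamples A W μ ε N k) := by
        refine Monotone.measure_iUnion fun k k' hk s hs => ?_
        obtain ⟨hsW, P, τ, hsol, hbad, hb⟩ := hs
        exact ⟨hsW, P, τ, hsol, hbad, hb.trans (Nat.cast_le.2 hk)⟩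
    _ ≤ _ := iSup_le fun k => measure_badSamples_le hW hN hε₀ hε₁ k

end Scenario

theorem proposition1 {n m N : ℕ}
    (A : Matrix (Fin n) (Fin n) ℝ) (B : Matrix (Fin n) (Fin m) ℝ)
    (K : Matrix (Fin m) (Fin n) ℝ)
    (W : Set (Fin n → ℝ)) (hW : IsCompact W)
    (μ : Measure (Fin n → ℝ)) [IsProbabilityMeasure μ] (hμ : ∀ᵐ v ∂μ, v ∈ W)
    {Ω : Type*} [MeasurableSpace Ω] (ν : Measure Ω) [IsProbabilityMeasure ν]
    (w : Fin N → Ω → Fin n → ℝ)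
    (hw_law : ∀ i, HasLaw (w i) μ ν) (hw_indep : iIndepFun w ν)
    (ε : ℝ) (hε₀ : 0 ≤ ε) (hε₁ : ε ≤ 1) :
    ∃ E : Set Ω, MeasurableSet E ∧
      1 - ∑ i ∈ Finset.range (ScenarioRPI.numVars n),
          (N.choose i : ℝ) * ε ^ i * (1 - ε) ^ (N - i) ≤ ν.real E ∧
      ∀ ω ∈ E, ∀ (P : Matrix (Fin n) (Fin n) ℝ) (τ : ℝ),
        ScenarioRPI.IsSolution (A + B * K) (fun i => w i ω) P τ →
          ScenarioRPI.IsLevelRobustlyFeasible (A + B * K) W μ ε P τ := by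
  have h := Scenario.measure_not_robust_le (A := A + B * K) hW hμ hw_law hw_indep hε₀ hε₁
  set bad := {ω | ∃ P τ, ScenarioRPI.IsSolution (A + B * K) (fun i => w i ω) P τ ∧
    ¬ ScenarioRPI.IsLevelRobustlyFeasible (A + B * K) W μ ε P τ} with hbad
  have hmeas := measurableSet_toMeasurable ν bad
  refine ⟨(toMeasurable ν bad)ᶜ, hmeas.compl, ?_, fun ω hω P τ hsol => by_contra fun hnot =>
    hω (subset_toMeasurable ν bad ⟨P, τ, hsol, hnot⟩)⟩
  rw [probReal_compl_eq_one_sub hmeas, measureReal_def, measure_toMeasurable]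
  have hsum : 0 ≤ ∑ i ∈ Finset.range (ScenarioRPI.numVars n),
      (N.choose i : ℝ) * ε ^ i * (1 - ε) ^ (N - i) := Finset.sum_nonneg fun i _ =>
    mul_nonneg (mul_nonneg (Nat.cast_nonneg _) (pow_nonneg hε₀ _))
      (pow_nonneg (sub_nonneg.2 hε₁) _)
  have := ENNReal.toReal_le_of_le_ofReal hsum h
  linarith
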